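/- For $t\ge 0$ let $P_t$ be the path on $t$ vertices; a finite simple graph is $P_t$-free if it has no induced subgraph isomorphic to $P_t$. Given a graph $G$ with nonnegative real vertex weights $w$, Maximum-Weight Independent Set asks for an independent set $S$ of $G$ maximizing $w(S)=\sum_{v\in S}w(v)$; with $w\equiv 1$ it is Maximum Independent Set (MIS). The running time is the number of steps of a deterministic random access machine with unit-cost addition, truncated subtraction, comparison, and indirect memory access on natural numbers, and unit-cost copying, addition and comparison (and no other operation) on weights. There are a single algorithm and a constant $C$ such that, for all integers $t,n\ge 0$, given $t$, the adjacency matrix of any $n$-vertex $P_t$-free graph $G$, and any vertex weights $w\colon V(G)\to\mathbb{R}_{\ge 0}$, the algorithm outputs a maximum-weight independent set of $G$ together with its weight after at most $$C\cdot 2^{\,C\sqrt{t\,n\log n}}$$ steps (where $n\log n$ is read as $0$ for $n=0$). That is, Maximum-Weight Independent Set on $n$-vertex $P_t$-free graphs can be solved in time $2^{O(\sqrt{tn\log n})}$, where the hidden constant does not depend on $t$, $n$, $G$ or $w$. In particular, for every fixed $t\ge 5$ there are an algorithm and a constant $C$ (which may depend on $t$) such that the algorithm solves MIS on every $n$-vertex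 $P_t$-free graph after at most $C\cdot 2^{\,C\sqrt{n\log n}}$ steps. -/

import Mathlib

open scoped NNReal

/-! A deterministic random access machine in structured form. Besides natural numbers it handles
vertex weights, which are nonnegative reals that can only be copied, added and compared. -/

namespace RAM

/-- Contents of the machine: number registers, number arrays (array name, then cell), weight
registers and weight arrays. The registers and the arrays named by a program are fixed by its text,
so there are finitely many of them; cells of an array are addressed by the content of a register. -/
structure State where
  reg : ℕ → ℕ
  arr : ℕ → ℕ → ℕ
  wreg : ℕ → ℝ≥0
  warr : ℕ → ℕ → ℝ≥0

/-- Elementary instructions. There is no multiplication, and no conversion between numbers and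
weights. -/
inductive Instr where
  /-- `reg x := c` -/
  | const (x c : ℕ)
  /-- `reg x := reg y` -/
  | move (x y : ℕ)
  /-- `reg x := reg y + reg z` -/
  | add (x y z : ℕ)
  /-- `reg x := reg y - reg z` (truncated at zero) -/
  | sub (x y z : ℕ)
  /-- `reg x := arr a (reg y)` -/
  | load (x a y : ℕ)
  /-- `arr a (reg x) := reg y` -/
  | store (a x y : ℕ)
  /-- `wreg u := 0` -/
  | wzero (u : ℕ)
  /-- `wreg u := wreg v` -/
  | wmove (u v : ℕ)
  /-- `wreg u := wreg v + wreg v'` -/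
  | wadd (u v v' : ℕ)
  /-- `wreg u := warr a (reg y)` -/
  | wload (u a y : ℕ)
  /-- `warr a (reg x) := wreg u` -/
  | wstore (a x u : ℕ)

/-- The effect of an elementary instruction. -/
def Instr.apply : Instr → State → State
  | .const x c, s => { s with reg := Function.update s.reg x c }
  | .move x y, s => { s with reg := Function.update s.reg x (s.reg y) }
  | .add x y z, s => { s with reg := Function.update s.reg x (s.reg y + s.reg z) }
  | .sub x y z, s => { s with reg := Function.update s.reg x (s.reg y - s.reg z) }
  | .load x a y, s => { s with reg := Function.update s.reg x (s.arr a (s.reg y)) }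
  | .store a x y, s =>
      { s with arr := Function.update s.arr a (Function.update (s.arr a) (s.reg x) (s.reg y)) }
  | .wzero u, s => { s with wreg := Function.update s.wreg u 0 }
  | .wmove u v, s => { s with wreg := Function.update s.wreg u (s.wreg v) }
  | .wadd u v v', s => { s with wreg := Function.update s.wreg u (s.wreg v + s.wreg v') }
  | .wload u a y, s => { s with wreg := Function.update s.wreg u (s.warr a (s.reg y)) }
  | .wstore a x u, s =>
      { s with warr := Function.update s.warr a (Function.update (s.warr a) (s.reg x) (s.wreg u)) }

/-- Tests on the contents of two registers. -/
inductive Test where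
  | lt (x y : ℕ)
  | le (x y : ℕ)
  | eq (x y : ℕ)
  | ne (x y : ℕ)
  | wlt (u v : ℕ)
  | wle (u v : ℕ)

/-- The outcome of a test. -/
def Test.Holds : Test → State → Prop
  | .lt x y, s => s.reg x < s.reg y
  | .le x y, s => s.reg x ≤ s.reg y
  | .eq x y, s => s.reg x = s.reg y
  | .ne x y, s => s.reg x ≠ s.reg y
  | .wlt u v, s => s.wreg u < s.wreg v
  | .wle u v, s => s.wreg u ≤ s.wreg v

/-- Commands: `branch b p q` is "if `b` then `p` else `q`", `loop b p` is "while `b` do `p`", and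
`call k` executes the `k`-th procedure of the program. -/
inductive Cmd where
  | skip
  | instr (i : Instr)
  | seq (p q : Cmd)
  | branch (b : Test) (p q : Cmd)
  | loop (b : Test) (p : Cmd)
  | call (k : ℕ)

/-- A program: a main command and finitely many (possibly mutually recursive) parameterless
procedures. All registers and arrays are global. -/
structure Program where
  main : Cmd
  procs : List Cmd

/-- `Exec ps p s T s'`: with procedures `ps`, the command `p` started in the state `s` halts in the
state `s'` after exactly `T` steps. Every instruction, every evaluation of a test and every
procedure call is one step. -/
inductive Exec (ps : List Cmd) : Cmd → State → ℕ → State → Prop where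
  | skip (s : State) : Exec ps .skip s 1 s
  | instr (i : Instr) (s : State) : Exec ps (.instr i) s 1 (i.apply s)
  | seq {p q : Cmd} {s s' s'' : State} {T T' : ℕ} :
      Exec ps p s T s' → Exec ps q s' T' s'' → Exec ps (.seq p q) s (T + T') s''
  | branch_true {b : Test} {p q : Cmd} {s s' : State} {T : ℕ} :
      b.Holds s → Exec ps p s T s' → Exec ps (.branch b p q) s (T + 1) s'
  | branch_false {b : Test} {p q : Cmd} {s s' : State} {T : ℕ} :
      ¬ b.Holds s → Exec ps q s T s' → Exec ps (.branch b p q) s (T + 1) s'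
  | loop_true {b : Test} {p : Cmd} {s s' s'' : State} {T T' : ℕ} :
      b.Holds s → Exec ps p s T s' → Exec ps (.loop b p) s' T' s'' →
      Exec ps (.loop b p) s (T + T' + 1) s''
  | loop_false {b : Test} {p : Cmd} {s : State} :
      ¬ b.Holds s → Exec ps (.loop b p) s 1 s
  | call {k : ℕ} {p : Cmd} {s s' : State} {T : ℕ} :
      ps[k]? = some p → Exec ps p s T s' → Exec ps (.call k) s (T + 1) s'

end RAM

/-- `S` is an independent set of `G` of maximum weight with respect to `w`. -/
def IsMaxWeightIndepSet {n : ℕ} (G : SimpleGraph (Fin n)) (w : Fin n → ℝ≥0)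
    (S : Finset (Fin n)) : Prop :=
  G.IsIndepSet (S : Set (Fin n)) ∧
    ∀ S' : Finset (Fin n), G.IsIndepSet (S' : Set (Fin n)) → ∑ v ∈ S', w v ≤ ∑ v ∈ S, w v

/-- `G` is `P_t`-free: it has no induced path on `t` vertices. -/
def IsPathFree (t : ℕ) {n : ℕ} (G : SimpleGraph (Fin n)) : Prop :=
  ¬ (SimpleGraph.pathGraph t).IsIndContained G

open Classical in
/-- The input `(t, G, w)`: register `0` holds the number `n` of vertices, register `1` holds `t`,
number array `0` holds the adjacency matrix of `G` row by row, weight array `0` holds the weights.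
Everything else is zero. -/
noncomputable def inputState (t : ℕ) {n : ℕ} (G : SimpleGraph (Fin n)) (w : Fin n → ℝ≥0) :
    RAM.State where
  reg x := if x = 0 then n else if x = 1 then t else 0
  arr a c := if a = 0 ∧ ∃ i j : Fin n, G.Adj i j ∧ c = n * (i : ℕ) + (j : ℕ) then 1 else 0
  wreg _ := 0
  warr a c := if h : a = 0 ∧ c < n then w ⟨c, h.2⟩ else 0

/-- The final state `s` presents the vertex set `S` and its weight: cells `0, …, n - 1` of number
array `1` are the indicator function of `S`, and weight register `0` is the weight of `S`. -/
def IsOutput {n : ℕ} (w : Fin n → ℝ≥0) (S : Finset (Fin n)) (s : RAM.State) : Prop :=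
  (∀ v : Fin n, s.arr 1 (v : ℕ) = if v ∈ S then 1 else 0) ∧ s.wreg 0 = ∑ v ∈ S, w v

/-- On the input `(t, G, w)` the program halts after at most `B` steps and outputs a maximum weight
independent set of `G` together with its weight. -/
def SolvesWithin (P : RAM.Program) (t : ℕ) {n : ℕ} (G : SimpleGraph (Fin n)) (w : Fin n → ℝ≥0)
    (B : ℝ) : Prop :=
  ∃ (T : ℕ) (s : RAM.State) (S : Finset (Fin n)),
    RAM.Exec P.procs P.main (inputState t G w) T s ∧ (T : ℝ) ≤ B ∧
    IsMaxWeightIndepSet G w S ∧ IsOutput w S s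

/-! The algorithm branches in two regimes, separated by a degree threshold `d`. As long as some
active vertex has degree at least `d`, it is either discarded or taken, and taking it removes at
least `d + 1` vertices. With `q = 1 + L / d` and `n < 2 ^ L`, the inequality `q ^ d + 1 ≤ q ^ (d +
1)` (`pow_add_one_le`) bounds this regime by `q ^ n ≤ exp (n * L / d)` (`RecTree.le`).

When all degrees are below `d`, the branching follows the Gyárfás path argument. A connected active
part is attacked through the active neighbours of one removed vertex `z`, of which there are at most
`d`. All of them are branched on; then the active part is split into components, and for each
component a removed vertex with a neighbour in it takes over the role of `z`. These vertices end
induced paths whose earlier vertices have no neighbour in the remaining core, and every change of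
`z` lengthens the paths (`TrailInvariant.advance`). Since an induced path has fewer than `t`
vertices, at most about `t * d` branchings occur on the way to a leaf. Splitting is cheap because
the bound is additive in the number of active vertices. This gives a factor `n * 2 ^ O(t * d)`
(`RecTree.le_of_trailInvariant`, `RecTree.le_of_degreesBelow`).

The least `d` with `n * L ≤ t * d ^ 2` balances `t * d` against `n * L / d`; both are of order `√(t
* n * L)`, and `L` is of order `log n`. As `d` is rounded up, `t` has to be replaced by `min t (n +
1)` for large `t`.

On the machine the algorithm is one recursive procedure whose frames are blocks of `n` cells. A call
spends polynomially many steps besides its two recursive calls, so the running time is a polynomial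
times the number of nodes of the recursion tree (`exec_solve`, `exec_program`), and the polynomial
is absorbed by the exponential (`steps_le`). -/

namespace PathFreeMWIS

open Finset

/-! ### Labellings and recursion trees. -/

variable {n : ℕ}

/-! Every vertex carries a label: `0` for discarded, `1` for removed but remembered, `2` for active,
and `3` for active and next in line for branching. -/

/-- The vertices that are still active. -/
def active (lab : Fin n → ℕ) : Finset (Fin n) := {x | 2 ≤ lab x}

/-- The vertices on which the algorithm branches next. -/
def pending (lab : Fin n → ℕ) : Finset (Fin n) := {x | lab x = 3}

/-- The labelling in which `v` has been removed with label `m`. -/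
def dropVertex (lab : Fin n → ℕ) (v : Fin n) (m : ℕ) : Fin n → ℕ :=
  fun x => if x = v then m else lab x

open Classical in
/-- The labelling in which `v` and its active neighbours have been removed with label `m`. -/
noncomputable def takeVertex (G : SimpleGraph (Fin n)) (lab : Fin n → ℕ) (v : Fin n) (m : ℕ) :
    Fin n → ℕ :=
  fun x => if x = v ∨ (2 ≤ lab x ∧ G.Adj v x) then m else lab x

open Classical in
/-- The labelling whose frontier is the active neighbourhood of `z`. -/
noncomputable def advance (G : SimpleGraph (Fin n)) (lab : Fin n → ℕ) (z : Fin n) : Fin n → ℕ :=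
  fun x => if 2 ≤ lab x then (if G.Adj z x then 3 else 2) else 0

/-- The labelling whose active vertices are those in `C`. -/
def restrictTo (lab : Fin n → ℕ) (C : Finset (Fin n)) : Fin n → ℕ :=
  fun x => if 2 ≤ lab x ∧ x ∉ C then 0 else lab x

/-- The labelling whose active vertices are those outside `C`. -/
def restrictAway (lab : Fin n → ℕ) (C : Finset (Fin n)) : Fin n → ℕ :=
  fun x => if 2 ≤ lab x ∧ x ∈ C then 0 else lab x

/-- `C` is a nonempty union of components of the graph induced on `A`. -/
def IsUnionOfComponents (G : SimpleGraph (Fin n)) (A C : Finset (Fin n)) : Prop :=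
  C ⊆ A ∧ C.Nonempty ∧ ∀ x ∈ C, ∀ y ∈ A, G.Adj x y → y ∈ C

/-- No nonempty proper subset of `A` is a union of components. -/
def IsConnectedOn (G : SimpleGraph (Fin n)) (A : Finset (Fin n)) : Prop :=
  ∀ C, IsUnionOfComponents G A C → C = A

open Classical in
/-- All degrees in the graph induced on `A` are less than `d`. -/
def DegreesBelow (G : SimpleGraph (Fin n)) (d : ℕ) (A : Finset (Fin n)) : Prop :=
  ∀ u ∈ A, #{x ∈ A | G.Adj u x} < d

open Classical in
/-- `RecTree G d lab c`: the branching algorithm with degree threshold `d`, started with the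
labelling `lab`, may lead to a recursion tree with `c` nodes. -/
inductive RecTree (G : SimpleGraph (Fin n)) (d : ℕ) : (Fin n → ℕ) → ℕ → Prop
  | empty {lab : Fin n → ℕ} : active lab = ∅ → RecTree G d lab 1
  -- Removal with label `0` keeps no memory, so the labels stay in `{0, 2}` until all degrees are
  -- below `d`.
  | high {lab : Fin n → ℕ} {c₁ c₂ : ℕ} (v : Fin n) : v ∈ active lab →
      d ≤ #{x ∈ active lab | G.Adj v x} →
      RecTree G d (dropVertex lab v 0) c₁ → RecTree G d (takeVertex G lab v 0) c₂ →
      RecTree G d lab (c₁ + c₂ + 1)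
  | frontier {lab : Fin n → ℕ} {c₁ c₂ : ℕ} (v : Fin n) : DegreesBelow G d (active lab) →
      lab v = 3 →
      RecTree G d (dropVertex lab v 1) c₁ → RecTree G d (takeVertex G lab v 1) c₂ →
      RecTree G d lab (c₁ + c₂ + 1)
  | split {lab : Fin n → ℕ} {c₁ c₂ : ℕ} (C : Finset (Fin n)) : DegreesBelow G d (active lab) →
      (∀ v, lab v ≠ 3) → IsUnionOfComponents G (active lab) C → C ≠ active lab →
      RecTree G d (restrictTo lab C) c₁ → RecTree G d (restrictAway lab C) c₂ →
      RecTree G d lab (c₁ + c₂ + 1)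
  -- Advancing to the neighbourhood of `z` and branching on a first vertex `v` of it form one node,
  -- so that every inner node branches or splits.
  | extend {lab : Fin n → ℕ} {c₁ c₂ : ℕ} (z v : Fin n) : DegreesBelow G d (active lab) →
      (∀ v, lab v ≠ 3) → IsConnectedOn G (active lab) → lab z = 1 → v ∈ active lab → G.Adj z v →
      RecTree G d (dropVertex (advance G lab z) v 1) c₁ →
      RecTree G d (takeVertex G (advance G lab z) v 1) c₂ →
      RecTree G d lab (c₁ + c₂ + 1)
  -- Impossible under the trail invariant; this case serves the components left over by the
  -- branching on high degrees.
  | start {lab : Fin n → ℕ} {c₁ c₂ : ℕ} (v : Fin n) : DegreesBelow G d (active lab) →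
      (∀ v, lab v ≠ 3) → IsConnectedOn G (active lab) →
      (∀ z, lab z = 1 → ∀ x ∈ active lab, ¬ G.Adj z x) → v ∈ active lab →
      RecTree G d (dropVertex lab v 1) c₁ → RecTree G d (takeVertex G lab v 1) c₂ →
      RecTree G d lab (c₁ + c₂ + 1)

@[simp] lemma mem_active {lab : Fin n → ℕ} {x : Fin n} : x ∈ active lab ↔ 2 ≤ lab x := by
  simp [active]

@[simp] lemma mem_pending {lab : Fin n → ℕ} {x : Fin n} : x ∈ pending lab ↔ lab x = 3 := by
  simp [pending]

lemma active_dropVertex {lab : Fin n → ℕ} {v : Fin n} {m : ℕ} (hm : m ≤ 1) :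
    active (dropVertex lab v m) = (active lab).erase v := by
  ext x
  simp only [mem_active, dropVertex, mem_erase]
  split_ifs <;> simp_all

open Classical in
lemma active_takeVertex {G : SimpleGraph (Fin n)} {lab : Fin n → ℕ} {v : Fin n} {m : ℕ}
    (hm : m ≤ 1) :
    active (takeVertex G lab v m) = {x ∈ active lab | x ≠ v ∧ ¬ G.Adj v x} := by
  ext x
  simp only [mem_active, takeVertex, mem_filter]
  split_ifs with h
  · constructor
    · omega
    · rintro ⟨h1, h2, h3⟩
      rcases h with h | h
      · exact absurd h h2
      · exact absurd h.2 h3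
  · push Not at h
    exact ⟨fun hx => ⟨hx, h.1, h.2 hx⟩, fun hx => hx.1⟩

lemma active_advance {G : SimpleGraph (Fin n)} {lab : Fin n → ℕ} {z : Fin n} :
    active (advance G lab z) = active lab := by
  ext x
  simp only [mem_active, advance]
  split_ifs <;> simp_all

lemma active_restrictTo {lab : Fin n → ℕ} {C : Finset (Fin n)} (hC : C ⊆ active lab) :
    active (restrictTo lab C) = C := by
  ext x
  have := @hC x
  simp only [mem_active, restrictTo] at *
  by_cases hx : x ∈ C
  · simp [hx, this hx]
  · simp only [hx, not_false_eq_true, and_true, iff_false]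
    split_ifs <;> omega

lemma active_restrictAway {lab : Fin n → ℕ} {C : Finset (Fin n)} :
    active (restrictAway lab C) = active lab \ C := by
  ext x
  simp only [mem_active, restrictAway, mem_sdiff]
  by_cases hx : x ∈ C
  · simp only [hx, and_true, not_true_eq_false, and_false, iff_false]
    split_ifs <;> omega
  · simp [hx]

/-! ### Induced paths that avoid a set. -/

/-- `IsTrail G X k r`: there is an induced path of `G` with `k` vertices that ends in `r`, avoids
`X`, and all of whose vertices other than `r` have no neighbour in `X`. -/
def IsTrail (G : SimpleGraph (Fin n)) (X : Set (Fin n)) (k : ℕ) (r : Fin n) : Prop :=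
  ∃ f : ℕ → Fin n, (∀ i < k, ∀ j < k, f i = f j → i = j) ∧
    (∀ i < k, ∀ j < k, G.Adj (f i) (f j) ↔ (i + 1 = j ∨ j + 1 = i)) ∧
    (∀ i < k, f i ∉ X) ∧ (∀ i, i + 1 < k → ∀ x ∈ X, ¬ G.Adj (f i) x) ∧
    ∀ i, i + 1 = k → f i = r

lemma IsTrail.mono {G : SimpleGraph (Fin n)} {X Y : Set (Fin n)} {k : ℕ} {r : Fin n}
    (h : IsTrail G X k r) (hY : Y ⊆ X) : IsTrail G Y k r := by
  obtain ⟨f, h1, h2, h3, h4, h5⟩ := h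
  exact ⟨f, h1, h2, fun i hi hx => h3 i hi (hY hx), fun i hi x hx => h4 i hi x (hY hx), h5⟩

lemma isTrail_one {G : SimpleGraph (Fin n)} {X : Set (Fin n)} {r : Fin n} (h : r ∉ X) :
    IsTrail G X 1 r := by
  refine ⟨fun _ => r, by intros; omega, ?_, fun _ _ => h, by intros; omega, fun _ _ => rfl⟩
  intro i hi j hj
  simp; omega

/-- A trail can be prolonged by a neighbour of its end. -/
lemma IsTrail.extend {G : SimpleGraph (Fin n)} {X Y : Set (Fin n)} {k : ℕ} {r y : Fin n}
    (h : IsTrail G X k r) (hYX : Y ⊆ X) (hy : y ∈ X) (hyY : y ∉ Y)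
    (hry : G.Adj r y) (hY : ∀ x ∈ Y, ¬ G.Adj r x) : IsTrail G Y (k + 1) y := by
  obtain ⟨f, h1, h2, h3, h4, h5⟩ := h
  have hne : ∀ i < k, f i ≠ y := fun i hi e => h3 i hi (e ▸ hy)
  have hadj : ∀ i < k, (G.Adj (f i) y ↔ i + 1 = k) := by
    intro i hi
    constructor
    · intro h
      by_contra hc
      exact h4 i (by omega) y hy h
    · intro h
      rw [h5 i h]
      exact hry
  have hlt : ∀ i < k, (if i < k then f i else y) = f i := fun i hi => by simp [hi]
  refine ⟨fun i => if i < k then f i else y, ?_, ?_, ?_, ?_, ?_⟩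
  · intro i hi j hj e
    by_cases hik : i < k <;> by_cases hjk : j < k <;> simp only [hik, hjk, if_true, if_false] at e
    · exact h1 i hik j hjk e
    · exact absurd e (hne i hik)
    · exact absurd e.symm (hne j hjk)
    · omega
  · intro i hi j hj
    by_cases hik : i < k <;> by_cases hjk : j < k <;> simp only [hik, hjk, if_true, if_false]
    · exact h2 i hik j hjk
    · rw [hadj i hik]; omega
    · rw [G.adj_comm, hadj j hjk]; omega
    · simp; omega
  · intro i hi
    by_cases hik : i < k <;> simp only [hik, if_true, if_false]
    · exact fun h => h3 i hik (hYX h)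
    · exact hyY
  · intro i hi x hx
    have hik : i < k := by omega
    simp only [hik, if_true]
    by_cases hc : i + 1 = k
    · rw [h5 i hc]
      exact hY x hx
    · exact h4 i (by omega) x (hYX hx)
  · intro i hi
    have hik : ¬ i < k := by omega
    simp [hik]

/-- The first `t` vertices of a longer trail would induce a `P_t`. -/
lemma IsTrail.lt_of_isPathFree {G : SimpleGraph (Fin n)} {X : Set (Fin n)} {k t : ℕ} {r : Fin n}
    (h : IsTrail G X k r) (ht : IsPathFree t G) : k < t := by
  obtain ⟨f, h1, h2, -⟩ := h
  by_contra hk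
  push Not at hk
  apply ht
  refine ⟨⟨⟨fun i => f i, fun i j e => Fin.ext (h1 i (by omega) j (by omega) e)⟩, ?_⟩⟩
  intro i j
  rw [SimpleGraph.pathGraph_adj]
  exact h2 i (by omega) j (by omega)

/-- A second bound on trails, needed because `t` may be much larger than `n`. -/
lemma IsTrail.le_card {G : SimpleGraph (Fin n)} {X : Set (Fin n)} {k : ℕ} {r : Fin n}
    (h : IsTrail G X k r) : k ≤ n := by
  obtain ⟨f, h1, -⟩ := h
  have := Fintype.card_le_of_injective (fun i : Fin k => f i)
    (fun i j e => Fin.ext (h1 i i.2 j j.2 e))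
  simpa using this

/-! ### The invariant of the branching at low degrees. -/

/-- The active vertices outside the frontier. -/
def core (lab : Fin n → ℕ) : Set (Fin n) := {x | 2 ≤ lab x ∧ lab x ≠ 3}

open Classical in
/-- The invariant of the branching below the vertices of high degree: the frontier and the removed
vertices end induced paths with at least `k` vertices, and every component of the active part meets
the frontier or has a neighbour among the removed vertices. -/
structure TrailInvariant (G : SimpleGraph (Fin n)) (A₀ : Finset (Fin n)) (k : ℕ)
    (lab : Fin n → ℕ) : Prop where
  mem : ∀ x, 1 ≤ lab x → x ∈ A₀
  trail : ∀ r, lab r = 1 ∨ lab r = 3 → ∃ k', k ≤ k' ∧ IsTrail G (core lab) k' r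
  link : ∀ C, IsUnionOfComponents G (active lab) C →
    (∃ x ∈ C, lab x = 3) ∨ ∃ r, lab r = 1 ∧ ∃ x ∈ C, G.Adj r x

section Invariant

variable {G : SimpleGraph (Fin n)} {A₀ : Finset (Fin n)} {k : ℕ} {lab : Fin n → ℕ}

lemma core_dropVertex_subset {v : Fin n} :
    core (dropVertex lab v 1) ⊆ core lab := by
  intro x hx
  simp only [core, dropVertex, Set.mem_ofPred_eq] at *
  split_ifs at hx <;> simp_all

/-- With label `1` the vertex `v` still counts as the end of its trail. A union of components
adjacent to `v` is linked through `v`; any other one was a union of components before the removal.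
-/
lemma TrailInvariant.dropVertex (h : TrailInvariant G A₀ k lab) {v : Fin n} (hv : lab v = 3) :
    TrailInvariant G A₀ k (dropVertex lab v 1) := by
  refine ⟨fun x hx => h.mem x ?_, fun r hr => ?_, fun C hC => ?_⟩
  · by_cases hxv : x = v
    · subst hxv; omega
    · simpa [PathFreeMWIS.dropVertex, hxv] using hx
  · have : lab r = 1 ∨ lab r = 3 := by
      by_cases hrv : r = v
      · subst hrv; omega
      · simpa [PathFreeMWIS.dropVertex, hrv] using hr
    obtain ⟨k', hk', ht⟩ := h.trail r this
    exact ⟨k', hk', ht.mono core_dropVertex_subset⟩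
  · obtain ⟨hCA, hne, hcl⟩ := hC
    rw [active_dropVertex le_rfl] at hCA hcl
    have hvC : v ∉ C := fun hv => by simpa using hCA hv
    by_cases hadj : ∃ x ∈ C, G.Adj v x
    · exact Or.inr ⟨v, by simp [PathFreeMWIS.dropVertex], hadj⟩
    · push Not at hadj
      have : IsUnionOfComponents G (active lab) C := by
        refine ⟨fun x hx => (mem_erase.1 (hCA hx)).2, hne, fun x hx y hy hxy => ?_⟩
        by_cases hyv : y = v
        · subst hyv
          exact absurd hxy.symm (hadj x hx)
        · exact hcl x hx y (mem_erase.2 ⟨hyv, hy⟩) hxy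
      rcases h.link C this with ⟨x, hx, hx3⟩ | ⟨r, hr, hx⟩
      · refine Or.inl ⟨x, hx, ?_⟩
        have : x ≠ v := fun e => hvC (e ▸ hx)
        simpa [PathFreeMWIS.dropVertex, this] using hx3
      · refine Or.inr ⟨r, ?_, hx⟩
        have : r ≠ v := fun e => by subst e; omega
        simpa [PathFreeMWIS.dropVertex, this] using hr

lemma core_takeVertex_subset {v : Fin n} :
    core (takeVertex G lab v 1) ⊆ core lab := by
  intro x hx
  simp only [core, takeVertex, Set.mem_ofPred_eq] at *
  split_ifs at hx <;> simp_all

lemma not_adj_of_mem_core_takeVertex {v x : Fin n} (hx : x ∈ core (takeVertex G lab v 1)) :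
    ¬ G.Adj v x := by
  intro hvx
  have h2 := (core_takeVertex_subset hx).1
  simp [core, takeVertex, hvx, h2] at hx

/-- Active neighbours of `v` outside the frontier receive label `1` without having ended a trail
before. The trail of `v` can be prolonged to each of them because no neighbour of `v` is left in the
new core. -/
lemma TrailInvariant.takeVertex (h : TrailInvariant G A₀ k lab) {v : Fin n}
    (hv : lab v = 3) : TrailInvariant G A₀ k (takeVertex G lab v 1) := by
  classical
  refine ⟨fun x hx => h.mem x ?_, fun r hr => ?_, fun C hC => ?_⟩
  · simp only [PathFreeMWIS.takeVertex] at hx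
    split_ifs at hx with hc
    · rcases hc with rfl | hc <;> omega
    · exact hx
  · by_cases hrl : lab r = 1 ∨ lab r = 3
    · obtain ⟨k', hk', ht⟩ := h.trail r hrl
      exact ⟨k', hk', ht.mono core_takeVertex_subset⟩
    · have hr' : r ≠ v ∧ 2 ≤ lab r ∧ G.Adj v r := by
        simp only [PathFreeMWIS.takeVertex] at hr
        split_ifs at hr with hc
        · rcases hc with rfl | hc
          · omega
          · exact ⟨fun e => by subst e; omega, hc⟩
        · exact absurd hr hrl
      obtain ⟨k', hk', ht⟩ := h.trail v (Or.inr hv)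
      refine ⟨k' + 1, by omega, ht.extend core_takeVertex_subset ⟨hr'.2.1, by omega⟩ ?_
        hr'.2.2 fun x hx => not_adj_of_mem_core_takeVertex hx⟩
      exact fun hc => not_adj_of_mem_core_takeVertex hc hr'.2.2
  · obtain ⟨hCA, hne, hcl⟩ := hC
    rw [active_takeVertex le_rfl] at hCA hcl
    have hCA' := fun x hx => (mem_filter.1 (@hCA x hx)).2
    by_cases hadj : ∃ r, (r = v ∨ 2 ≤ lab r ∧ G.Adj v r) ∧ ∃ x ∈ C, G.Adj r x
    · obtain ⟨r, hr, hx⟩ := hadj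
      exact Or.inr ⟨r, by simp only [PathFreeMWIS.takeVertex]; rw [if_pos hr], hx⟩
    · push Not at hadj
      have : IsUnionOfComponents G (active lab) C := by
        refine ⟨fun x hx => (mem_filter.1 (hCA hx)).1, hne, fun x hx y hy hxy => ?_⟩
        by_cases hyv : y = v ∨ 2 ≤ lab y ∧ G.Adj v y
        · exact absurd hxy.symm (hadj y hyv x hx)
        · refine hcl x hx y (mem_filter.2 ⟨hy, ?_⟩) hxy
          push Not at hyv
          exact ⟨hyv.1, hyv.2 (mem_active.1 hy)⟩
      rcases h.link C this with ⟨x, hx, hx3⟩ | ⟨r, hr, hx⟩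
      · refine Or.inl ⟨x, hx, ?_⟩
        simp only [PathFreeMWIS.takeVertex]
        rw [if_neg, hx3]
        rintro (h | h)
        · exact (hCA' x hx).1 h
        · exact (hCA' x hx).2 h.2
      · refine Or.inr ⟨r, ?_, hx⟩
        simp only [PathFreeMWIS.takeVertex]
        rw [hr]; simp

/-- Covers both sides of a split. Labels change only from active to `0`, so the core shrinks and all
removed vertices are kept; as the frontier is empty, it is always a removed vertex that links a
component. -/
lemma TrailInvariant.restrict (h : TrailInvariant G A₀ k lab) (h3 : ∀ v, lab v ≠ 3)
    {lab' : Fin n → ℕ} (h0 : ∀ x, lab' x = lab x ∨ 2 ≤ lab x ∧ lab' x = 0)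
    {D : Finset (Fin n)} (hA : active lab' = D)
    (hD : ∀ C, IsUnionOfComponents G D C → IsUnionOfComponents G (active lab) C) :
    TrailInvariant G A₀ k lab' := by
  have hcore : core lab' ⊆ core lab := by
    intro x hx
    simp only [core, Set.mem_ofPred_eq] at *
    rcases h0 x with e | e <;> omega
  refine ⟨fun x hx => h.mem x ?_, fun r hr => ?_, fun C hC => ?_⟩
  · rcases h0 x with e | e <;> omega
  · obtain ⟨k', hk', ht⟩ := h.trail r (by rcases h0 r with e | e <;> omega)
    exact ⟨k', hk', ht.mono hcore⟩
  · rw [hA] at hC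
    rcases h.link C (hD C hC) with ⟨x, hx, hx3⟩ | ⟨r, hr, hx⟩
    · exact absurd hx3 (h3 x)
    · refine Or.inr ⟨r, ?_, hx⟩
      rcases h0 r with e | e <;> omega

lemma IsUnionOfComponents.trans {A C D : Finset (Fin n)} (hC : IsUnionOfComponents G A C)
    (hD : IsUnionOfComponents G C D) : IsUnionOfComponents G A D :=
  ⟨hD.1.trans hC.1, hD.2.1, fun x hx y hy hxy =>
    hD.2.2 x hx y (hC.2.2 x (hD.1 hx) y hy hxy) hxy⟩

lemma IsUnionOfComponents.sdiff {A C : Finset (Fin n)} (hC : IsUnionOfComponents G A C)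
    (hne : C ≠ A) : IsUnionOfComponents G A (A \ C) := by
  refine ⟨sdiff_subset, ?_, fun x hx y hy hxy => ?_⟩
  · rw [sdiff_nonempty]
    exact fun h => hne (hC.1.antisymm h)
  · rw [mem_sdiff] at *
    exact ⟨hy, fun hyC => hx.2 (hC.2.2 y hyC x hx.1 hxy.symm)⟩

/-- The step of the Gyárfás path argument. All active neighbours of `z` enter the frontier, hence
none is left in the core, and each of them prolongs the trail of `z`. The other removed vertices can
be forgotten: by connectedness the whole active part is the only union of components, and it meets
the frontier in `v`. -/
lemma TrailInvariant.advance (h : TrailInvariant G A₀ k lab) (h3 : ∀ v, lab v ≠ 3)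
    (hconn : IsConnectedOn G (active lab)) {z v : Fin n} (hz : lab z = 1) (hv : v ∈ active lab)
    (hzv : G.Adj z v) : TrailInvariant G A₀ (k + 1) (advance G lab z) := by
  have hcore : core (PathFreeMWIS.advance G lab z) ⊆ core lab := by
    intro x hx
    have := h3 x
    simp only [core, PathFreeMWIS.advance, Set.mem_ofPred_eq] at *
    split_ifs at hx <;> simp_all
  have hnadj : ∀ x ∈ core (PathFreeMWIS.advance G lab z), ¬ G.Adj z x := by
    intro x hx hzx
    have := hcore hx
    simp only [core, PathFreeMWIS.advance, Set.mem_ofPred_eq] at *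
    simp [this.1, hzx] at hx
  refine ⟨fun x hx => h.mem x ?_, fun r hr => ?_, fun C hC => ?_⟩
  · simp only [PathFreeMWIS.advance] at hx
    split_ifs at hx <;> omega
  · have hr' : 2 ≤ lab r ∧ G.Adj z r := by
      simp only [PathFreeMWIS.advance] at hr
      split_ifs at hr with h1 h2 <;> simp_all
    obtain ⟨k', hk', ht⟩ := h.trail z (Or.inl hz)
    exact ⟨k' + 1, by omega, ht.extend hcore ⟨hr'.1, h3 r⟩
      (fun hc => hnadj r hc hr'.2) hr'.2 hnadj⟩
  · rw [active_advance] at hC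
    refine Or.inl ⟨v, ?_, ?_⟩
    · rw [hconn C hC]; exact hv
    · have := mem_active.1 hv
      simp [PathFreeMWIS.advance, this, hzv]

end Invariant

/-! ### Counting the nodes of recursion trees. -/

lemma pending_dropVertex {lab : Fin n → ℕ} {v : Fin n} (hv : lab v = 3) :
    #(pending (dropVertex lab v 1)) + 1 ≤ #(pending lab) := by
  rw [← card_erase_add_one (mem_pending.2 hv)]
  refine Nat.add_le_add_right (card_le_card fun x hx => ?_) 1
  rw [mem_erase]
  simp only [mem_pending, dropVertex] at *
  split_ifs at hx with h
  · omega
  · exact ⟨h, hx⟩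

lemma pending_takeVertex {G : SimpleGraph (Fin n)} {lab : Fin n → ℕ} {v : Fin n}
    (hv : lab v = 3) : #(pending (takeVertex G lab v 1)) + 1 ≤ #(pending lab) := by
  rw [← card_erase_add_one (mem_pending.2 hv)]
  refine Nat.add_le_add_right (card_le_card fun x hx => ?_) 1
  rw [mem_erase]
  simp only [mem_pending, takeVertex] at *
  split_ifs at hx with h
  · omega
  · push Not at h
    exact ⟨h.1, hx⟩

lemma pending_eq_empty {lab : Fin n → ℕ} (h : ∀ v, lab v ≠ 3) : #(pending lab) = 0 := by
  rw [card_eq_zero]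
  ext x
  simp [h x]

/-- Arithmetic of a branching step that uses up one unit of the exponent. -/
lemma branch_bound {c₁ c₂ m m₁ m₂ e e₁ e₂ : ℕ} (h₁ : c₁ + 1 ≤ 2 * max m₁ 1 * 2 ^ e₁)
    (h₂ : c₂ + 1 ≤ 2 * max m₂ 1 * 2 ^ e₂) (hm₁ : m₁ ≤ m) (hm₂ : m₂ ≤ m) (he₁ : e₁ + 1 ≤ e)
    (he₂ : e₂ + 1 ≤ e) : c₁ + c₂ + 1 + 1 ≤ 2 * max m 1 * 2 ^ e := by
  obtain ⟨e, rfl⟩ : ∃ e', e = e' + 1 := ⟨e - 1, by omega⟩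
  have a₁ : 2 * max m₁ 1 * 2 ^ e₁ ≤ 2 * max m 1 * 2 ^ e := by gcongr <;> omega
  have a₂ : 2 * max m₂ 1 * 2 ^ e₂ ≤ 2 * max m 1 * 2 ^ e := by gcongr <;> omega
  rw [pow_succ]
  linarith

/-- Arithmetic of a splitting step. -/
lemma split_bound {c₁ c₂ m m₁ m₂ e : ℕ} (h₁ : c₁ + 1 ≤ 2 * max m₁ 1 * 2 ^ e)
    (h₂ : c₂ + 1 ≤ 2 * max m₂ 1 * 2 ^ e) (hm₁ : 1 ≤ m₁) (hm₂ : 1 ≤ m₂) (hm : m₁ + m₂ = m) :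
    c₁ + c₂ + 1 + 1 ≤ 2 * max m 1 * 2 ^ e := by
  rw [max_eq_left hm₁] at h₁
  rw [max_eq_left hm₂] at h₂
  rw [max_eq_left (by omega), ← hm]
  linarith

lemma restrictTo_apply_or (lab : Fin n → ℕ) (C : Finset (Fin n)) (x : Fin n) :
    restrictTo lab C x = lab x ∨ 2 ≤ lab x ∧ restrictTo lab C x = 0 := by
  simp only [restrictTo]
  split_ifs with h <;> simp_all

lemma restrictAway_apply_or (lab : Fin n → ℕ) (C : Finset (Fin n)) (x : Fin n) :
    restrictAway lab C x = lab x ∨ 2 ≤ lab x ∧ restrictAway lab C x = 0 := by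
  simp only [restrictAway]
  split_ifs with h <;> simp_all

section Bounds

variable {G : SimpleGraph (Fin n)} {A₀ : Finset (Fin n)} {d τ : ℕ}

lemma card_active_dropVertex_le {lab : Fin n → ℕ} {v : Fin n} {m : ℕ} (hm : m ≤ 1) :
    #(active (dropVertex lab v m)) ≤ #(active lab) := by
  rw [active_dropVertex hm]
  exact card_le_card (erase_subset _ _)

lemma card_active_takeVertex_le {lab : Fin n → ℕ} {v : Fin n} {m : ℕ} (hm : m ≤ 1) :
    #(active (takeVertex G lab v m)) ≤ #(active lab) := by
  classical
  rw [active_takeVertex hm]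
  exact card_le_card (filter_subset _ _)

/-- The exponent bounds the branchings still possible on the way to a leaf: one for each pending
vertex and `d` for each of the at most `τ - k` advances. A split leaves the exponent alone and is
paid for by the factor `#(active lab)`, which adds up over the two sides. Bounding `c + 1` instead
of `c` absorbs the node itself, and `max _ 1` takes care of the empty labelling. -/
lemma RecTree.le_of_trailInvariant (hτ : ∀ X k r, IsTrail G X k r → k < τ)
    (hA₀ : DegreesBelow G d A₀) {lab : Fin n → ℕ} {c : ℕ} (hc : RecTree G d lab c) :
    ∀ k, TrailInvariant G A₀ k lab →
      c + 1 ≤ 2 * max #(active lab) 1 * 2 ^ (#(pending lab) + (τ - k) * d) := by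
  classical
  induction hc with
  | @empty lab h =>
    intro k _
    have := Nat.one_le_two_pow (n := #(pending lab) + (τ - k) * d)
    simp only [h, card_empty]
    simp; omega
  | @high lab c₁ c₂ v hv hd h₁ h₂ ih₁ ih₂ =>
    intro k hI
    -- Degrees were already below `d` in the larger set `A₀`, so this case is contradictory.
    have hsub : active lab ⊆ A₀ := fun x hx => hI.mem x (by have := mem_active.1 hx; omega)
    have := hA₀ v (hsub hv)
    have := card_le_card (filter_subset_filter (fun x => G.Adj v x) hsub)
    omega
  | @frontier lab c₁ c₂ v hd hv h₁ h₂ ih₁ ih₂ =>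
    intro k hI
    have f₁ := pending_dropVertex hv
    have f₂ := pending_takeVertex (G := G) hv
    exact branch_bound (ih₁ k (hI.dropVertex hv)) (ih₂ k (hI.takeVertex hv))
      (card_active_dropVertex_le le_rfl) (card_active_takeVertex_le le_rfl) (by omega) (by omega)
  | @split lab c₁ c₂ C hd h3 hC hne h₁ h₂ ih₁ ih₂ =>
    intro k hI
    have i₁ := ih₁ k (hI.restrict h3 (restrictTo_apply_or lab C) (active_restrictTo hC.1)
      fun D hD => hC.trans hD)
    have i₂ := ih₂ k (hI.restrict h3 (restrictAway_apply_or lab C) active_restrictAway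
      fun D hD => (hC.sdiff hne).trans hD)
    have f : ∀ lab' : Fin n → ℕ, (∀ x, lab' x = lab x ∨ 2 ≤ lab x ∧ lab' x = 0) →
        #(pending lab') = 0 := by
      refine fun lab' h => pending_eq_empty fun x hx => ?_
      rcases h x with e | e
      · exact h3 x (e ▸ hx)
      · omega
    rw [f _ (restrictTo_apply_or lab C), active_restrictTo hC.1] at i₁
    rw [f _ (restrictAway_apply_or lab C), active_restrictAway] at i₂
    rw [pending_eq_empty h3]
    exact split_bound i₁ i₂ hC.2.1.card_pos (hC.sdiff hne).2.1.card_pos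
      (by rw [card_sdiff_of_subset hC.1]; have := card_le_card hC.1; omega)
  | @extend lab c₁ c₂ z v hd h3 hconn hz hv hzv h₁ h₂ ih₁ ih₂ =>
    intro k hI
    have hI' := hI.advance h3 hconn hz hv hzv
    have hv' : PathFreeMWIS.advance G lab z v = 3 := by
      have := mem_active.1 hv
      simp [PathFreeMWIS.advance, this, hzv]
    have f₁ := pending_dropVertex hv'
    have f₂ := pending_takeVertex (G := G) hv'
    -- Because subtraction is truncated, only this makes `(τ - k) * d` drop by a full `d`.
    have hkτ : k < τ := by
      obtain ⟨k', hk', ht⟩ := hI.trail z (Or.inl hz)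
      have := hτ _ _ _ ht
      omega
    -- The removed vertex `z` is not active, but it lies in `A₀`, where its degree is below `d` as
    -- well.
    have hfr : #(pending (PathFreeMWIS.advance G lab z)) ≤ d := by
      refine le_trans (card_le_card fun x hx => ?_) (hA₀ z (hI.mem z (by omega))).le
      rw [mem_filter]
      simp only [mem_pending, PathFreeMWIS.advance] at hx
      split_ifs at hx with a b
      · exact ⟨hI.mem x (by omega), b⟩
      · omega
    have hmul : (τ - k) * d = (τ - (k + 1)) * d + d := by
      rw [← Nat.succ_mul]
      congr 1
      omega
    refine branch_bound (ih₁ (k + 1) (hI'.dropVertex hv'))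
      (ih₂ (k + 1) (hI'.takeVertex hv')) ?_ ?_ (by omega) (by omega)
    · exact (card_active_dropVertex_le le_rfl).trans_eq (by rw [active_advance])
    · exact (card_active_takeVertex_le le_rfl).trans_eq (by rw [active_advance])
  | @start lab c₁ c₂ v hd h3 hconn hlink hv h₁ h₂ ih₁ ih₂ =>
    intro k hI
    have : IsUnionOfComponents G (active lab) (active lab) :=
      ⟨Subset.refl _, ⟨v, hv⟩, fun _ _ y hy _ => hy⟩
    rcases hI.link _ this with ⟨x, -, hx⟩ | ⟨r, hr, x, hx, hrx⟩
    · exact absurd hx (h3 x)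
    · exact absurd hrx (hlink r hr x hx)

/-- The invariant holds once some vertex of a connected graph is declared the frontier. -/
lemma trailInvariant_singleton {lab : Fin n → ℕ} (hlab : ∀ x, lab x = 0 ∨ lab x = 2)
    (hconn : IsConnectedOn G (active lab)) {v : Fin n} (hv : v ∈ active lab)
    (hsub : active lab ⊆ A₀) : TrailInvariant G A₀ 1 (dropVertex lab v 3) := by
  have hact : active (dropVertex lab v 3) = active lab := by
    ext x
    simp only [mem_active, dropVertex]
    split_ifs with h
    · subst h
      simpa using hv
    · rfl
  refine ⟨fun x hx => ?_, fun r hr => ?_, fun C hC => ?_⟩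
  · simp only [dropVertex] at hx
    split_ifs at hx with h
    · exact h ▸ hsub hv
    · exact hsub (mem_active.2 (by rcases hlab x with e | e <;> omega))
  · have : r = v := by
      by_contra h
      simp only [dropVertex, if_neg h] at hr
      rcases hlab r with e | e <;> omega
    exact ⟨1, le_rfl, isTrail_one (by simp [core, dropVertex, this])⟩
  · rw [hact] at hC
    exact Or.inl ⟨v, by rw [hconn C hC]; exact hv, by simp [dropVertex]⟩

/-- There is no frontier yet. Splits add up as before, and the first branching in a connected part
can be read as one on a singleton frontier: giving `v` the label `3` beforehand leads to the same
two children. This is the extra `1` in the exponent. -/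
lemma RecTree.le_of_degreesBelow (hτ : ∀ X k r, IsTrail G X k r → k < τ)
    (hA₀ : DegreesBelow G d A₀) {lab : Fin n → ℕ} {c : ℕ} (hc : RecTree G d lab c)
    (hlab : ∀ x, lab x = 0 ∨ lab x = 2) (hsub : active lab ⊆ A₀) :
    c + 1 ≤ 2 * max #(active lab) 1 * 2 ^ (1 + τ * d) := by
  classical
  induction hc with
  | @empty lab h =>
    have := Nat.one_le_two_pow (n := 1 + τ * d)
    simp only [h, card_empty]
    simp; omega
  | @high lab c₁ c₂ v hv hd h₁ h₂ ih₁ ih₂ =>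
    have := hA₀ v (hsub hv)
    have := card_le_card (filter_subset_filter (fun x => G.Adj v x) hsub)
    omega
  | @frontier lab c₁ c₂ v hd hv h₁ h₂ ih₁ ih₂ => rcases hlab v with e | e <;> omega
  | @split lab c₁ c₂ C hd h3 hC hne h₁ h₂ ih₁ ih₂ =>
    have i₁ := ih₁ (fun x => by
      rcases restrictTo_apply_or lab C x with e | e <;> rcases hlab x with e' | e' <;> omega)
      (by rw [active_restrictTo hC.1]; exact hC.1.trans hsub)
    have i₂ := ih₂ (fun x => by
      rcases restrictAway_apply_or lab C x with e | e <;> rcases hlab x with e' | e' <;> omega)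
      (by rw [active_restrictAway]; exact sdiff_subset.trans hsub)
    rw [active_restrictTo hC.1] at i₁
    rw [active_restrictAway] at i₂
    exact split_bound i₁ i₂ hC.2.1.card_pos (hC.sdiff hne).2.1.card_pos
      (by rw [card_sdiff_of_subset hC.1]; have := card_le_card hC.1; omega)
  | @extend lab c₁ c₂ z v hd h3 hconn hz hv hzv h₁ h₂ ih₁ ih₂ =>
    rcases hlab z with e | e <;> omega
  | @start lab c₁ c₂ v hd h3 hconn hlink hv h₁ h₂ ih₁ ih₂ =>
    have hI := trailInvariant_singleton hlab hconn hv hsub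
    have hv3 : dropVertex lab v 3 v = 3 := by simp [dropVertex]
    have e₁ : dropVertex (dropVertex lab v 3) v 1 = dropVertex lab v 1 := by
      ext x
      simp only [dropVertex]
      split_ifs <;> rfl
    have e₂ : takeVertex G (dropVertex lab v 3) v 1 = takeVertex G lab v 1 := by
      ext x
      by_cases h : x = v <;> simp [takeVertex, dropVertex, h]
    have i₁ := h₁.le_of_trailInvariant hτ hA₀ 1 (e₁ ▸ hI.dropVertex hv3)
    have i₂ := h₂.le_of_trailInvariant hτ hA₀ 1 (e₂ ▸ hI.takeVertex hv3)
    have f₀ : #(pending (dropVertex lab v 3)) ≤ 1 := by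
      rw [card_le_one]
      have : ∀ x, dropVertex lab v 3 x = 3 → x = v := by
        intro x hx
        by_contra h
        simp only [dropVertex, if_neg h] at hx
        rcases hlab x with e | e <;> omega
      intro a ha b hb
      rw [this a (mem_pending.1 ha), this b (mem_pending.1 hb)]
    have f₁ := pending_dropVertex hv3
    have f₂ := pending_takeVertex (G := G) hv3
    rw [e₁] at f₁
    rw [e₂] at f₂
    have hmul : (τ - 1) * d ≤ τ * d := Nat.mul_le_mul_right d (by omega)
    exact branch_bound i₁ i₂ (card_active_dropVertex_le le_rfl) (card_active_takeVertex_le le_rfl)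
      (by omega) (by omega)

/-- The size of the recursion trees, for the labellings met while there are vertices of high
degree. -/
lemma RecTree.le (hτ : ∀ X k r, IsTrail G X k r → k < τ) {q : ℝ} (hq : 1 ≤ q)
    (hqd : d < n → q ^ d + 1 ≤ q ^ (d + 1)) {lab : Fin n → ℕ} {c : ℕ} (hc : RecTree G d lab c)
    (hlab : ∀ x, lab x = 0 ∨ lab x = 2) :
    (c : ℝ) + 1 ≤ 2 * n.succ * 2 ^ (1 + τ * d) * q ^ #(active lab) := by
  classical
  -- From the first node with low degrees on, the previous bound takes over; the factor `q ^
  -- #(active lab)` is at least `1`.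
  have key : ∀ {lab : Fin n → ℕ} {c : ℕ}, RecTree G d lab c → (∀ x, lab x = 0 ∨ lab x = 2) →
      DegreesBelow G d (active lab) →
      (c : ℝ) + 1 ≤ 2 * n.succ * 2 ^ (1 + τ * d) * q ^ #(active lab) := by
    intro lab c hc hlab hd
    have h := hc.le_of_degreesBelow hτ hd hlab Subset.rfl
    have hn : #(active lab) ≤ n := by simpa using card_le_univ (active lab)
    have h' : c + 1 ≤ 2 * n.succ * 2 ^ (1 + τ * d) := h.trans (by gcongr; omega)
    have h'' : (c : ℝ) + 1 ≤ 2 * n.succ * 2 ^ (1 + τ * d) := by exact_mod_cast h'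
    exact h''.trans (le_mul_of_one_le_right (by positivity) (one_le_pow₀ hq))
  induction hc with
  | @empty lab h => exact key (.empty h) hlab (by simp [DegreesBelow, h])
  | @high lab c₁ c₂ v hv hd h₁ h₂ ih₁ ih₂ =>
    have i₁ := ih₁ (fun x => by simp only [dropVertex]; split_ifs; exacts [Or.inl rfl, hlab x])
    have i₂ := ih₂ (fun x => by simp only [takeVertex]; split_ifs; exacts [Or.inl rfl, hlab x])
    have a₁ : #(active (dropVertex lab v 0)) + 1 = #(active lab) := by
      rw [active_dropVertex (by omega), card_erase_add_one hv]
    -- The vertex `v` and its at least `d` active neighbours disappear.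
    have a₂ : #(active (takeVertex G lab v 0)) + d + 1 ≤ #(active lab) := by
      rw [active_takeVertex (by omega)]
      have hdis : Disjoint ({x ∈ active lab | x ≠ v ∧ ¬ G.Adj v x})
          (insert v ({x ∈ active lab | G.Adj v x})) := by
        rw [disjoint_left]
        intro x hx hx'
        simp only [mem_filter, mem_insert] at hx hx'
        tauto
      have hcard : #(insert v ({x ∈ active lab | G.Adj v x}))
          = #{x ∈ active lab | G.Adj v x} + 1 := by
        rw [card_insert_of_notMem (by simp)]
      have := card_le_card (union_subset (filter_subset (fun x => x ≠ v ∧ ¬ G.Adj v x) (active lab))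
        (insert_subset hv (filter_subset (fun x => G.Adj v x) (active lab))))
      rw [card_union_of_disjoint hdis, hcard] at this
      omega
    obtain ⟨e, he⟩ : ∃ e, #(active lab) = e + (d + 1) := ⟨#(active lab) - (d + 1), by omega⟩
    have hn : #(active lab) ≤ n := by simpa using card_le_univ (active lab)
    -- A vertex of degree at least `d` forces `d + 1 ≤ n`.
    have hq' := hqd (by omega)
    have b₁ : #(active (dropVertex lab v 0)) = e + d := by omega
    have b₂ : q ^ #(active (takeVertex G lab v 0)) ≤ q ^ e := pow_le_pow_right₀ hq (by omega)
    rw [b₁] at i₁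
    rw [he]
    rw [Nat.cast_add, Nat.cast_add, Nat.cast_one]
    have hB : (0 : ℝ) ≤ 2 * n.succ * 2 ^ (1 + τ * d) := by positivity
    generalize (2 * (n.succ : ℝ) * 2 ^ (1 + τ * d)) = B at *
    calc (c₁ : ℝ) + c₂ + 1 + 1 ≤ B * q ^ (e + d) + B * q ^ e := by
          have := i₂.trans (mul_le_mul_of_nonneg_left b₂ hB)
          linarith
      _ = B * (q ^ e * (q ^ d + 1)) := by ring
      _ ≤ B * (q ^ e * q ^ (d + 1)) := by gcongr
      _ = B * q ^ (e + (d + 1)) := by rw [pow_add q e]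
  | @frontier lab c₁ c₂ v hd hv h₁ h₂ ih₁ ih₂ => exact key (.frontier v hd hv h₁ h₂) hlab hd
  | @split lab c₁ c₂ C hd h3 hC hne h₁ h₂ ih₁ ih₂ =>
    exact key (.split C hd h3 hC hne h₁ h₂) hlab hd
  | @extend lab c₁ c₂ z v hd h3 hconn hz hv hzv h₁ h₂ ih₁ ih₂ =>
    exact key (.extend z v hd h3 hconn hz hv hzv h₁ h₂) hlab hd
  | @start lab c₁ c₂ v hd h3 hconn hlink hv h₁ h₂ ih₁ ih₂ =>
    exact key (.start v hd h3 hconn hlink hv h₁ h₂) hlab hd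

end Bounds

end PathFreeMWIS

/-! ### Structured code: semantics, frames, compilation and cost. -/

namespace PathFreeMWIS

open RAM

/-! Code whose only loops run a counter from `0` to the content of register `0`, with its meaning as
a function on states. Register `2` is expected to hold the constant `1`. -/

/-- Code without recursion and with bounded loops. -/
inductive Code where
  | skip
  | instr (i : Instr)
  | seq (p q : Code)
  | branch (b : Test) (p q : Code)
  | rep (i : ℕ) (p : Code)

infixr:60 ";;" => Code.seq

instance : Coe Instr Code := ⟨Code.instr⟩

/-- The registers written by an instruction. -/
def outReg : Instr → List ℕ
  | .const x _ | .move x _ | .add x _ _ | .sub x _ _ | .load x _ _ => [x]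
  | _ => []

/-- The number arrays written by an instruction. -/
def outArr : Instr → List ℕ
  | .store a _ _ => [a]
  | _ => []

/-- The weight registers written by an instruction. -/
def outWreg : Instr → List ℕ
  | .wzero u | .wmove u _ | .wadd u _ _ | .wload u _ _ => [u]
  | _ => []

/-- The weight arrays written by an instruction. -/
def outWarr : Instr → List ℕ
  | .wstore a _ _ => [a]
  | _ => []

namespace Code

/-- The locations written by a piece of code, given those written by an instruction and by the
counting of a loop. -/
def writes (f : Instr → List ℕ) (g : ℕ → List ℕ) : Code → List ℕ
  | skip => []
  | instr i => f i
  | seq p q => p.writes f g ++ q.writes f g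
  | branch _ p q => p.writes f g ++ q.writes f g
  | rep i p => g i ++ p.writes f g

/-- The registers written by a piece of code. -/
def regs : Code → List ℕ := writes outReg fun i => [i]

/-- The number arrays written by a piece of code. -/
def arrs : Code → List ℕ := writes outArr fun _ => []

/-- The weight registers written by a piece of code. -/
def wregs : Code → List ℕ := writes outWreg fun _ => []

/-- The weight arrays written by a piece of code. -/
def warrs : Code → List ℕ := writes outWarr fun _ => []

/-- No loop writes its own counter in its body. -/
def countersFresh : Code → Prop
  | skip => True
  | instr _ => True
  | seq p q => p.countersFresh ∧ q.countersFresh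
  | branch _ p q => p.countersFresh ∧ q.countersFresh
  | rep i p => i ∉ p.regs ∧ p.countersFresh

instance decidableCountersFresh : DecidablePred countersFresh
  | skip => inferInstanceAs (Decidable True)
  | instr _ => inferInstanceAs (Decidable True)
  | seq p q => @instDecidableAnd _ _ (decidableCountersFresh p) (decidableCountersFresh q)
  | branch _ p q => @instDecidableAnd _ _ (decidableCountersFresh p) (decidableCountersFresh q)
  | rep _ p => @instDecidableAnd _ _ inferInstance (decidableCountersFresh p)

/-- Loops run as intended: counters are fresh, and neither the bound in register `0` nor the constant
in register `2` is ever written. -/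
def WellFormed (p : Code) : Prop := p.countersFresh ∧ 0 ∉ p.regs ∧ 2 ∉ p.regs

instance (p : Code) : Decidable p.WellFormed := inferInstanceAs (Decidable (_ ∧ _ ∧ _))

open Classical in
/-- The effect of a piece of code. -/
noncomputable def run : Code → State → State
  | skip, s => s
  | instr i, s => i.apply s
  | seq p q, s => q.run (p.run s)
  | branch b p q, s => if b.Holds s then p.run s else q.run s
  | rep i p, s =>
      (fun s => (Instr.add i i 2).apply (p.run s))^[s.reg 0] ((Instr.const i 0).apply s)

lemma run_seq (p q : Code) (s : State) : (p ;; q).run s = q.run (p.run s) := rfl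

lemma run_branch_of {b : Test} {p q : Code} {s : State} (h : b.Holds s) :
    (branch b p q).run s = p.run s := by
  simp [run, h]

lemma run_branch_of_not {b : Test} {p q : Code} {s : State} (h : ¬ b.Holds s) :
    (branch b p q).run s = q.run s := by
  simp [run, h]

/-- Translation into commands of the machine. -/
def compile : Code → Cmd
  | skip => .skip
  | instr i => .instr i
  | seq p q => .seq p.compile q.compile
  | branch b p q => .branch b p.compile q.compile
  | rep i p => .seq (.instr (.const i 0)) (.loop (.lt i 0) (.seq p.compile (.instr (.add i i 2))))

/-- An upper bound for the number of steps, where register `0` holds `n`. -/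
def cost (n : ℕ) : Code → ℕ
  | skip => 1
  | instr _ => 1
  | seq p q => p.cost n + q.cost n
  | branch _ p q => p.cost n + q.cost n + 1
  | rep _ p => n * (p.cost n + 2) + 2

/-- `s'` differs from `s` only in locations written by the code. -/
structure Frame (p : Code) (s s' : State) : Prop where
  reg : ∀ x ∉ p.regs, s'.reg x = s.reg x
  arr : ∀ a ∉ p.arrs, s'.arr a = s.arr a
  wreg : ∀ u ∉ p.wregs, s'.wreg u = s.wreg u
  warr : ∀ a ∉ p.warrs, s'.warr a = s.warr a

lemma Frame.refl (p : Code) (s : State) : p.Frame s s :=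
  ⟨fun _ _ => rfl, fun _ _ => rfl, fun _ _ => rfl, fun _ _ => rfl⟩

lemma Frame.trans {p : Code} {s s' s'' : State} (h : p.Frame s s') (h' : p.Frame s' s'') :
    p.Frame s s'' :=
  ⟨fun x hx => (h'.reg x hx).trans (h.reg x hx), fun x hx => (h'.arr x hx).trans (h.arr x hx),
    fun x hx => (h'.wreg x hx).trans (h.wreg x hx), fun x hx => (h'.warr x hx).trans (h.warr x hx)⟩

lemma Frame.mono {p q : Code} {s s' : State} (h : p.Frame s s')
    (hpq : ∀ f g, p.writes f g ⊆ q.writes f g) : q.Frame s s' :=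
  ⟨fun x hx => h.reg x fun h => hx (hpq _ _ h), fun x hx => h.arr x fun h => hx (hpq _ _ h),
    fun x hx => h.wreg x fun h => hx (hpq _ _ h), fun x hx => h.warr x fun h => hx (hpq _ _ h)⟩

lemma frame_instr (i : Instr) (s : State) : (instr i).Frame s (i.apply s) := by
  constructor <;> intro x hx <;> cases i <;>
    simp_all [Instr.apply, regs, arrs, wregs, warrs, writes, outReg, outArr, outWreg, outWarr]

lemma frame_iterate {p : Code} {f : State → State} (h : ∀ s, p.Frame s (f s)) (k : ℕ) (s : State) :
    p.Frame s (f^[k] s) := by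
  induction k with
  | zero => exact Frame.refl _ _
  | succ k ih =>
    rw [Function.iterate_succ_apply']
    exact ih.trans (h _)

lemma frame_const (i : ℕ) (p : Code) (s : State) :
    (rep i p).Frame s ((Instr.const i 0).apply s) := by
  have := frame_instr (Instr.const i 0) s
  constructor <;> intro x hx
  · exact this.reg x fun h => hx (by simp_all [regs, writes, outReg])
  · exact this.arr x (by simp [arrs, writes, outArr])
  · exact this.wreg x (by simp [wregs, writes, outWreg])
  · exact this.warr x (by simp [warrs, writes, outWarr])

lemma frame_add (i : ℕ) (p : Code) (s : State) :
    (rep i p).Frame s ((Instr.add i i 2).apply s) := by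
  have := frame_instr (Instr.add i i 2) s
  constructor <;> intro x hx
  · exact this.reg x fun h => hx (by simp_all [regs, writes, outReg])
  · exact this.arr x (by simp [arrs, writes, outArr])
  · exact this.wreg x (by simp [wregs, writes, outWreg])
  · exact this.warr x (by simp [warrs, writes, outWarr])

/-- Code changes only the locations that it writes. -/
lemma frame_run (p : Code) (s : State) : p.Frame s (p.run s) := by
  induction p generalizing s with
  | skip => exact Frame.refl _ _
  | instr i => exact frame_instr i s
  | seq p q ihp ihq =>
    exact ((ihp s).mono fun f g => List.subset_append_left _ _).trans
      ((ihq _).mono fun f g => List.subset_append_right _ _)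
  | branch b p q ihp ihq =>
    unfold run
    split_ifs
    · exact (ihp s).mono fun f g => List.subset_append_left _ _
    · exact (ihq s).mono fun f g => List.subset_append_right _ _
  | rep i p ih =>
    refine (frame_const i p s).trans (frame_iterate (fun s => ?_) _ _)
    exact ((ih s).mono fun f g => List.subset_append_right _ _).trans (frame_add i p _)

/-- The state before the `k`-th round of a loop. -/
noncomputable def round (i : ℕ) (p : Code) (s : State) (k : ℕ) : State :=
  (fun s => (Instr.add i i 2).apply (p.run s))^[k] ((Instr.const i 0).apply s)

lemma frame_round (i : ℕ) (p : Code) (s : State) (k : ℕ) : (rep i p).Frame s (round i p s k) :=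
  (frame_const i p s).trans (frame_iterate
    (fun s => ((frame_run p s).mono fun _ _ => List.subset_append_right _ _).trans
      (frame_add i p _)) _ _)

lemma round_succ (i : ℕ) (p : Code) (s : State) (k : ℕ) :
    round i p s (k + 1) = (Instr.add i i 2).apply (p.run (round i p s k)) :=
  Function.iterate_succ_apply' _ _ _

lemma WellFormed.of_rep {i : ℕ} {p : Code} (h : (rep i p).WellFormed) :
    p.WellFormed ∧ i ∉ p.regs := by
  obtain ⟨⟨h1, h2⟩, h3, h4⟩ := h
  refine ⟨⟨h2, fun h => h3 ?_, fun h => h4 ?_⟩, h1⟩ <;>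
  · simp only [regs, writes, List.mem_append] at h ⊢
    exact Or.inr h

lemma round_reg_counter {i : ℕ} {p : Code} (h : (rep i p).WellFormed) {s : State}
    (h2 : s.reg 2 = 1) (k : ℕ) : (round i p s k).reg i = k := by
  induction k with
  | zero => simp [round, Instr.apply]
  | succ k ih =>
    have e : (p.run (round i p s k)).reg 2 = 1 := by
      rw [(frame_run p _).reg 2 h.of_rep.1.2.2, (frame_round i p s k).reg 2 h.2.2, h2]
    rw [round_succ]
    simp [Instr.apply, e, (frame_run p _).reg i h.of_rep.2, ih]

/-- Induction along the rounds of a loop. -/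
lemma run_rep_induction {i : ℕ} {p : Code} {s : State} {n : ℕ} (h : (rep i p).WellFormed)
    (hn : s.reg 0 = n) (h2 : s.reg 2 = 1) (I : ℕ → State → Prop)
    (zero : I 0 { s with reg := Function.update s.reg i 0 })
    -- The frame refers to the state before the loop, so whatever the loop does not write is known
    -- in every round.
    (succ : ∀ (v : Fin n) (s' : State), s'.reg i = v → (rep i p).Frame s s' → I v s' →
      I (v + 1) { p.run s' with reg := Function.update (p.run s').reg i (v + 1) }) :
    I n ((rep i p).run s) := by
  have key : ∀ k ≤ n, I k (round i p s k) := by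
    intro k hk
    induction k with
    | zero => exact zero
    | succ k ih =>
      have hr := round_reg_counter h h2 k
      have := succ ⟨k, hk⟩ (round i p s k) hr (frame_round i p s k) (ih (by omega))
      rw [round_succ]
      convert this using 1
      simp only [Instr.apply]
      rw [(frame_run p _).reg i h.of_rep.2, hr, (frame_run p _).reg 2 h.of_rep.1.2.2,
        (frame_round i p s k).reg 2 h.2.2, h2]
  have := key n le_rfl
  unfold run
  rw [hn]
  exact this

/-- Induction on the number `j` of rounds left. Each round pays `2` for its test and the increment;
the final `1` is the failing test. -/
lemma exec_rounds {ps : List Cmd} {i : ℕ} {p : Code} {s : State} (h : (rep i p).WellFormed)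
    (h2 : s.reg 2 = 1) {c : ℕ}
    (hp : ∀ k, ∃ T ≤ c, Exec ps p.compile (round i p s k) T (p.run (round i p s k))) (j : ℕ) :
    ∀ k, k + j = s.reg 0 → ∃ T ≤ j * (c + 2) + 1,
      Exec ps (.loop (.lt i 0) (.seq p.compile (.instr (.add i i 2)))) (round i p s k) T
        (round i p s (s.reg 0)) := by
  have hi := round_reg_counter h h2
  have h0 : ∀ k, (round i p s k).reg 0 = s.reg 0 := fun k => (frame_round i p s k).reg 0 h.2.1
  induction j with
  | zero =>
    intro k hk
    obtain rfl : k = s.reg 0 := by omega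
    exact ⟨1, by omega, .loop_false (by simp [Test.Holds, hi, h0])⟩
  | succ j ih =>
    intro k hk
    obtain ⟨T, hT, hE⟩ := hp k
    obtain ⟨T', hT', hrest⟩ := ih (k + 1) (by omega)
    refine ⟨T + 1 + T' + 1, by linarith, .loop_true ?_ (.seq hE (.instr _ _)) ?_⟩
    · simp only [Test.Holds, hi, h0]; omega
    · rw [← round_succ]; exact hrest

/-- The translation does what the code says, within the estimated number of steps. -/
lemma exec_compile (ps : List Cmd) (p : Code) (hp : p.WellFormed) (s : State) (h2 : s.reg 2 = 1) :
    ∃ T ≤ p.cost (s.reg 0), Exec ps p.compile s T (p.run s) := by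
  have left : ∀ {p q : Code}, p.countersFresh → 0 ∉ p.regs ++ q.regs → 2 ∉ p.regs ++ q.regs →
      p.WellFormed := fun h h0 h2 =>
    ⟨h, fun h => h0 (List.mem_append_left _ h), fun h => h2 (List.mem_append_left _ h)⟩
  have right : ∀ {p q : Code}, q.countersFresh → 0 ∉ p.regs ++ q.regs → 2 ∉ p.regs ++ q.regs →
      q.WellFormed := fun h h0 h2 =>
    ⟨h, fun h => h0 (List.mem_append_right _ h), fun h => h2 (List.mem_append_right _ h)⟩
  induction p generalizing s with
  | skip => exact ⟨1, le_rfl, .skip s⟩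
  | instr i => exact ⟨1, le_rfl, .instr i s⟩
  | seq p q ihp ihq =>
    obtain ⟨⟨hp1, hp2⟩, h0, h2'⟩ := hp
    have hp' := left (q := q) hp1 h0 h2'
    obtain ⟨T, hT, hE⟩ := ihp hp' s h2
    have f := frame_run p s
    obtain ⟨T', hT', hE'⟩ := ihq (right (p := p) hp2 h0 h2') (p.run s)
      ((f.reg 2 hp'.2.2).trans h2)
    rw [f.reg 0 hp'.2.1] at hT'
    exact ⟨T + T', Nat.add_le_add hT hT', .seq hE hE'⟩
  | branch b p q ihp ihq =>
    obtain ⟨⟨hp1, hp2⟩, h0, h2'⟩ := hp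
    obtain ⟨T, hT, hE⟩ := ihp (left (q := q) hp1 h0 h2') s h2
    obtain ⟨T', hT', hE'⟩ := ihq (right (p := p) hp2 h0 h2') s h2
    by_cases hb : b.Holds s
    · refine ⟨T + 1, by simp only [cost]; omega, ?_⟩
      simp only [run, if_pos hb]
      exact .branch_true hb hE
    · refine ⟨T' + 1, by simp only [cost]; omega, ?_⟩
      simp only [run, if_neg hb]
      exact .branch_false hb hE'
  | rep i p ih =>
    have hround : ∀ k, ∃ T ≤ p.cost (s.reg 0),
        Exec ps p.compile (round i p s k) T (p.run (round i p s k)) := by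
      intro k
      have f := frame_round i p s k
      obtain ⟨T, hT, hE⟩ := ih hp.of_rep.1 (round i p s k) ((f.reg 2 hp.2.2).trans h2)
      rw [f.reg 0 hp.2.1] at hT
      exact ⟨T, hT, hE⟩
    obtain ⟨T, hT, hE⟩ := exec_rounds hp h2 hround (s.reg 0) 0 (by omega)
    exact ⟨1 + T, by simp only [cost]; omega, .seq (.instr _ _) hE⟩

/-- The number of steps is polynomial. -/
lemma exists_cost_le (p : Code) : ∃ k, ∀ n, p.cost n ≤ k * (n + 1) ^ k := by
  have mono : ∀ {a b n : ℕ}, a ≤ b → a * (n + 1) ^ a ≤ b * (n + 1) ^ b := fun {a b n} h =>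
    Nat.mul_le_mul h (Nat.pow_le_pow_right (by omega) h)
  have pos : ∀ k n : ℕ, 1 ≤ (n + 1) ^ k := fun k n => Nat.one_le_pow _ _ (by omega)
  induction p with
  | skip => exact ⟨1, fun n => by simp [cost]⟩
  | instr i => exact ⟨1, fun n => by simp [cost]⟩
  | seq p q ihp ihq =>
    obtain ⟨k, hk⟩ := ihp
    obtain ⟨l, hl⟩ := ihq
    refine ⟨k + l, fun n => (Nat.add_le_add (hk n) (hl n)).trans ?_⟩
    rw [add_mul]
    gcongr <;> omega
  | branch b p q ihp ihq =>
    obtain ⟨k, hk⟩ := ihp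
    obtain ⟨l, hl⟩ := ihq
    refine ⟨k + l + 1, fun n => (Nat.add_le_add_right (Nat.add_le_add (hk n) (hl n)) 1).trans ?_⟩
    rw [add_mul, add_mul, one_mul]
    gcongr
    · omega
    · omega
    · omega
    · omega
    · exact pos _ _
  | rep i p ih =>
    obtain ⟨k, hk⟩ := ih
    refine ⟨k + 2, fun n => ?_⟩
    have h1 := hk n
    have h2 := pos k n
    have h3 := pos (k + 1) n
    have e1 : (n + 1) ^ (k + 2) = (n + 1) * (n + 1) ^ (k + 1) := by ring
    have e2 : (n + 1) ^ (k + 1) = (n + 1) * (n + 1) ^ k := by ring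
    have h4 : (n + 1) ^ k ≤ (n + 1) ^ (k + 1) := Nat.pow_le_pow_right (by omega) (by omega)
    calc n * (p.cost n + 2) + 2 ≤ n * ((k + 2) * (n + 1) ^ (k + 1)) + (k + 2) * (n + 1) ^ (k + 1) := by
          have : p.cost n + 2 ≤ (k + 2) * (n + 1) ^ (k + 1) := by nlinarith
          have : 2 ≤ (k + 2) * (n + 1) ^ (k + 1) := by nlinarith
          gcongr
      _ = (k + 2) * (n + 1) ^ (k + 2) := by rw [e1]; ring

end Code

end PathFreeMWIS

/-! ### Memory layout, and the search for a vertex of high degree. -/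

namespace PathFreeMWIS

open RAM Finset

variable {n : ℕ} {G : SimpleGraph (Fin n)} {w : Fin n → ℝ≥0} {d : ℕ} {lab : Fin n → ℕ}

open Classical in
/-- The read-only data: the registers `0`, `2`, `3`, `4`, `5`, `6` hold `n`, `1`, `2`, `3`, `0` and
the degree threshold, and the adjacency matrix, its row addresses and the weights are in place. -/
structure Ambient (G : SimpleGraph (Fin n)) (w : Fin n → ℝ≥0) (d : ℕ) (s : State) : Prop where
  size : s.reg 0 = n
  one : s.reg 2 = 1
  two : s.reg 3 = 2
  three : s.reg 4 = 3
  zero : s.reg 5 = 0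
  threshold : s.reg 6 = d
  adj : ∀ x y : Fin n, s.arr 0 (n * x + y) = if G.Adj x y then 1 else 0
  row : ∀ x : Fin n, s.arr 6 x = n * x
  weight : ∀ x : Fin n, s.warr 0 x = w x

/-- The code does not write the read-only data. -/
def Code.PreservesAmbient (p : Code) : Prop :=
  p.WellFormed ∧ (∀ x ∈ [3, 4, 5, 6], x ∉ p.regs) ∧ (∀ a ∈ [0, 6], a ∉ p.arrs) ∧ 0 ∉ p.warrs

instance (p : Code) : Decidable p.PreservesAmbient := inferInstanceAs (Decidable (_ ∧ _ ∧ _ ∧ _))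

lemma Ambient.of_frame {s s' : State} (h : Ambient G w d s) {p : Code} (hf : p.Frame s s')
    (hp : p.PreservesAmbient) : Ambient G w d s' := by
  obtain ⟨⟨-, h0, h2⟩, hr, ha, hw⟩ := hp
  constructor
  · rw [hf.reg 0 h0, h.size]
  · rw [hf.reg 2 h2, h.one]
  · rw [hf.reg 3 (hr 3 (by simp)), h.two]
  · rw [hf.reg 4 (hr 4 (by simp)), h.three]
  · rw [hf.reg 5 (hr 5 (by simp)), h.zero]
  · rw [hf.reg 6 (hr 6 (by simp)), h.threshold]
  · rw [hf.arr 0 (ha 0 (by simp))]; exact h.adj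
  · rw [hf.arr 6 (ha 6 (by simp))]; exact h.row
  · rw [hf.warr 0 hw]; exact h.weight

lemma Ambient.run {s : State} (h : Ambient G w d s) {p : Code} (hp : p.PreservesAmbient) :
    Ambient G w d (p.run s) :=
  h.of_frame (p.frame_run s) hp

/-- The labels of the current call are in array `2`, from the address in register `7` on. -/
def HasLabels (s : State) (lab : Fin n → ℕ) : Prop := ∀ x : Fin n, s.arr 2 (s.reg 7 + x) = lab x

lemma HasLabels.of_frame {s s' : State} (h : HasLabels s lab) {p : Code} (hf : p.Frame s s')
    (h7 : 7 ∉ p.regs) (h2 : 2 ∉ p.arrs) : HasLabels s' lab := by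
  intro x
  rw [hf.reg 7 h7, hf.arr 2 h2, h x]

/-- Read the label of the vertex in register `x` into register `r`. -/
def getLabel (r x : ℕ) : Code := Instr.add r 7 x ;; Instr.load r 2 r

/-- Read the adjacency of the vertices in registers `x` and `y` into register `r`. -/
def getAdj (r x y : ℕ) : Code := Instr.load r 6 x ;; Instr.add r r y ;; Instr.load r 0 r

/-- The gain of one round of a counting loop over the vertices. -/
lemma card_filter_lt_succ (P : Fin n → Prop) [DecidablePred P] (v : Fin n) :
    #{x : Fin n | (x : ℕ) < v + 1 ∧ P x} = #{x : Fin n | (x : ℕ) < v ∧ P x} + if P v then 1 else 0 := by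
  split_ifs with h
  · have : ({x : Fin n | (x : ℕ) < v + 1 ∧ P x} : Finset (Fin n)) =
        insert v ({x : Fin n | (x : ℕ) < v ∧ P x} : Finset (Fin n)) := by
      ext x
      simp only [mem_filter, mem_univ, true_and, mem_insert, Nat.lt_succ_iff_lt_or_eq, Fin.ext_iff]
      constructor
      · rintro ⟨h1 | h1, h2⟩
        · exact Or.inr ⟨h1, h2⟩
        · exact Or.inl h1
      · rintro (h1 | ⟨h1, h2⟩)
        · exact ⟨Or.inr h1, by rwa [Fin.ext h1]⟩
        · exact ⟨Or.inl h1, h2⟩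
    rw [this, card_insert_of_notMem (by simp)]
  · rw [add_zero]
    congr 1
    ext x
    simp only [mem_filter, mem_univ, true_and, Nat.lt_succ_iff_lt_or_eq]
    constructor
    · rintro ⟨h1 | h1, h2⟩
      · exact ⟨h1, h2⟩
      · exact absurd (Fin.ext h1 ▸ h2) h
    · exact fun h => ⟨Or.inl h.1, h.2⟩

/-- Add the active degree of the vertex in register `11` to register `13`. -/
def countNeighbours : Code :=
  .rep 12 (getLabel 15 12 ;; .branch (.le 3 15) (getAdj 15 11 12 ;; Instr.add 13 13 15) .skip)

open Classical in
lemma run_countNeighbours {s : State} (h : Ambient G w d s) (hl : HasLabels s lab) (v : Fin n)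
    (hv : s.reg 11 = v) (h0 : s.reg 13 = 0) :
    (countNeighbours.run s).reg 13 = #{x ∈ active lab | G.Adj v x} := by
  have key : (countNeighbours.run s).reg 13 = _ := Code.run_rep_induction (by decide) h.size h.one
    (fun k s' => s'.reg 13 = #{x : Fin n | (x : ℕ) < k ∧ (2 ≤ lab x ∧ G.Adj v x)})
    (by simp [h0]) (fun u s' hu hf hI => by
      have h' := h.of_frame hf (by decide)
      have hl' := hl.of_frame hf (by decide) (by decide)
      have hv' : s'.reg 11 = v := (hf.reg 11 (by decide)).trans hv
      rw [card_filter_lt_succ (fun x => 2 ≤ lab x ∧ G.Adj v x)]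
      by_cases h1 : 2 ≤ lab u <;> by_cases h2 : G.Adj v u <;>
      simp [Code.run, Instr.apply, Test.Holds, getLabel, getAdj, h'.two, hu, hv', hl' u, h'.row v,
        h'.adj v u, h1, h2, hI])
  simpa [active, filter_filter] using key

/-- Write into register `8` a vertex whose active degree is at least the threshold, or `n`. -/
def findHigh : Code :=
  Instr.move 8 0 ;;
  .rep 11 (getLabel 14 11 ;; .branch (.le 3 14)
    (Instr.const 13 0 ;; countNeighbours ;; .branch (.le 6 13) (Instr.move 8 11) .skip) .skip)

open Classical in
/-- Register `r` holds a vertex with the property `P` if there is one, and `n` otherwise. -/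
def Finds (P : Fin n → Prop) (k r : ℕ) : Prop :=
  (r = n ∧ ∀ x : Fin n, (x : ℕ) < k → ¬ P x) ∨ ∃ v : Fin n, r = v ∧ P v

lemma finds_zero (P : Fin n → Prop) : Finds P 0 n := Or.inl ⟨rfl, by simp⟩

lemma Finds.succ_of_not {P : Fin n → Prop} {v : Fin n} {r : ℕ} (h : Finds P v r) (hv : ¬ P v) :
    Finds P (v + 1) r := by
  rcases h with ⟨h1, h2⟩ | h
  · refine Or.inl ⟨h1, fun x hx => ?_⟩
    rcases Nat.lt_succ_iff_lt_or_eq.1 hx with hx | hx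
    · exact h2 x hx
    · rwa [Fin.ext hx]
  · exact Or.inr h

lemma finds_of {P : Fin n → Prop} {v : Fin n} {k : ℕ} (h : P v) : Finds P k v :=
  Or.inr ⟨v, rfl, h⟩

open Classical in
lemma run_findHigh {s : State} (h : Ambient G w d s) (hl : HasLabels s lab) :
    Finds (fun v => 2 ≤ lab v ∧ d ≤ #{x ∈ active lab | G.Adj v x}) n
      ((findHigh.run s).reg 8) := by
  have h1 := h.run (p := Instr.move 8 0) (by decide)
  have hl1 := hl.of_frame (Code.frame_run (Instr.move 8 0) s) (by decide) (by decide)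
  refine Code.run_rep_induction (by decide) h1.size h1.one
    (fun k s' => Finds (fun v => 2 ≤ lab v ∧ d ≤ #{x ∈ active lab | G.Adj v x}) k (s'.reg 8))
    (by simp [Code.run, Instr.apply, h.size, finds_zero]) (fun v s' hv hf hI => ?_)
  have h' := h1.of_frame hf (by decide)
  have hl' := hl1.of_frame hf (by decide) (by decide)
  by_cases hv2 : 2 ≤ lab v
  · set s₁ := Code.run (getLabel 14 11 ;; Instr.const 13 0) s' with hs₁
    have fr := Code.frame_run (getLabel 14 11 ;; Instr.const 13 0) s'
    have hc := run_countNeighbours (h'.of_frame fr (by decide))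
      (hl'.of_frame fr (by decide) (by decide)) v (by rw [fr.reg 11 (by decide), hv])
      (by simp [Code.run, Instr.apply])
    rw [← hs₁] at hc fr
    have h2 := (h'.of_frame fr (by decide)).run (p := countNeighbours) (by decide)
    have e8 := (Code.frame_run countNeighbours s₁).reg 8 (by decide)
    have e11 := (Code.frame_run countNeighbours s₁).reg 11 (by decide)
    rw [fr.reg 8 (by decide)] at e8
    rw [fr.reg 11 (by decide), hv] at e11
    -- The continuation `q` stays abstract, so that the inner loop enters only through its final
    -- state.
    have e : ∀ q : Code, Code.run (getLabel 14 11 ;; .branch (.le 3 14)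
        (Instr.const 13 0 ;; countNeighbours ;; q) .skip) s' = q.run (countNeighbours.run s₁) := by
      intro q
      simp [hs₁, Code.run, Instr.apply, Test.Holds, getLabel, hv, hl' v, h'.two, hv2]
    rw [e]
    by_cases hd : d ≤ #{x ∈ active lab | G.Adj v x}
    · simp [Code.run, Test.Holds, Instr.apply, h2.threshold, hc, hd, e11]
      exact finds_of ⟨hv2, hd⟩
    · simp [Code.run, Test.Holds, h2.threshold, hc, hd, e8]
      exact hI.succ_of_not fun h => hd h.2
  · simp [Code.run, Instr.apply, Test.Holds, getLabel, hv, hl' v, h'.two, hv2]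
    exact hI.succ_of_not fun h => hv2 h.1

end PathFreeMWIS

/-! ### Searching for active vertices, components and links; relabelling. -/

namespace PathFreeMWIS

open RAM Finset

variable {n : ℕ} {G : SimpleGraph (Fin n)} {w : Fin n → ℝ≥0} {d : ℕ} {lab : Fin n → ℕ}

/-- Write into register `9` an active vertex, and into register `18` a pending vertex, or `n`. -/
def findActive : Code :=
  Instr.move 9 0 ;; Instr.move 18 0 ;;
  .rep 11 (getLabel 14 11 ;; .branch (.le 3 14)
    (Instr.move 9 11 ;; .branch (.eq 14 4) (Instr.move 18 11) .skip) .skip)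

lemma run_findActive {s : State} (h : Ambient G w d s) (hl : HasLabels s lab) :
    Finds (fun v => 2 ≤ lab v) n ((findActive.run s).reg 9) ∧
      Finds (fun v => lab v = 3) n ((findActive.run s).reg 18) := by
  have fr := Code.frame_run (Instr.move 9 0 ;; Instr.move 18 0) s
  have h1 := h.of_frame fr (by decide)
  have hl1 := hl.of_frame fr (by decide) (by decide)
  refine Code.run_rep_induction (by decide) h1.size h1.one
    (fun k s' => Finds (fun v => 2 ≤ lab v) k (s'.reg 9) ∧ Finds (fun v => lab v = 3) k (s'.reg 18))
    (by simp [Code.run, Instr.apply, h.size, finds_zero]) (fun v s' hv hf hI => ?_)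
  have h' := h1.of_frame hf (by decide)
  have hl' := hl1.of_frame hf (by decide) (by decide)
  by_cases h3 : lab v = 3
  · simp [Code.run, Instr.apply, Test.Holds, getLabel, hv, hl' v, h'.two, h'.three, h3]
    exact ⟨finds_of (by omega), finds_of h3⟩
  by_cases h2 : 2 ≤ lab v
  · simp [Code.run, Instr.apply, Test.Holds, getLabel, hv, hl' v, h'.two, h'.three, h3, h2]
    exact ⟨finds_of h2, hI.2.succ_of_not h3⟩
  · simp [Code.run, Instr.apply, Test.Holds, getLabel, hv, hl' v, h'.two, h2]
    exact ⟨hI.1.succ_of_not h2, hI.2.succ_of_not h3⟩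

/-- The cells of `f` from `b` on hold the indicator function of `S`. -/
def HasSet (f : ℕ → ℕ) (b : ℕ) (S : Finset (Fin n)) : Prop :=
  ∀ x : Fin n, f (b + x) = if x ∈ S then 1 else 0

/-- Mark the active neighbours of the vertex in register `12`. -/
def markNeighbours : Code :=
  .rep 13 (getLabel 15 13 ;; .branch (.le 3 15)
    (getAdj 15 12 13 ;; .branch (.eq 15 2) (Instr.store 4 13 2) .skip) .skip)

/-- Mark the active neighbours of all marked vertices. -/
def markSweep : Code :=
  .rep 12 (Instr.load 14 4 12 ;; .branch (.eq 14 2) markNeighbours .skip)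

/-- Mark the component of the vertex in register `9`. -/
def markComponent : Code :=
  .rep 11 (Instr.store 4 11 5) ;; Instr.store 4 9 2 ;; .rep 11 markSweep

open Classical in
lemma run_markNeighbours {s : State} (h : Ambient G w d s) (hl : HasLabels s lab)
    {C : Finset (Fin n)} (hC : HasSet (s.arr 4) 0 C) {x : Fin n} (hx : s.reg 12 = x) :
    HasSet ((markNeighbours.run s).arr 4) 0 (C ∪ univ.filter fun y => 2 ≤ lab y ∧ G.Adj x y) := by
  have key : HasSet ((markNeighbours.run s).arr 4) 0
      (C ∪ univ.filter (fun y : Fin n => (y : ℕ) < n ∧ 2 ≤ lab y ∧ G.Adj x y)) := by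
    refine Code.run_rep_induction (by decide) h.size h.one
      (fun k s' => HasSet (s'.arr 4) 0 (C ∪ univ.filter (fun y : Fin n => (y : ℕ) < k ∧ 2 ≤ lab y ∧ G.Adj x y)))
      (by simpa using hC) (fun v s' hv hf hI => ?_)
    have h' := h.of_frame hf (by decide)
    have hl' := hl.of_frame hf (by decide) (by decide)
    have hx' : s'.reg 12 = x := (hf.reg 12 (by decide)).trans hx
    intro y
    have hy := hI y
    by_cases hv2 : 2 ≤ lab v ∧ G.Adj x v
    · by_cases hyv' : y = v
      · subst hyv'
        simp [Code.run, Instr.apply, Test.Holds, getLabel, getAdj, h'.two, h'.one, hv, hx', hl' y,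
          h'.row x, h'.adj x y, hv2.1, hv2.2]
      · have hyv2 : (y : ℕ) ≠ v := fun e => hyv' (Fin.ext e)
        have : y ≤ v ↔ y < v := ⟨fun h => lt_of_le_of_ne h hyv', le_of_lt⟩
        simp [Code.run, Instr.apply, Test.Holds, getLabel, getAdj, h'.two, h'.one, hv, hx', hl' v,
          h'.row x, h'.adj x v, hv2.1, hv2.2, Function.update_of_ne hyv2, this]
        simpa using hy
    · have e : (C ∪ univ.filter (fun y : Fin n => (y : ℕ) < v + 1 ∧ 2 ≤ lab y ∧ G.Adj x y) : Finset (Fin n)) =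
          C ∪ univ.filter (fun y : Fin n => (y : ℕ) < v ∧ 2 ≤ lab y ∧ G.Adj x y) := by
        ext z
        simp only [mem_union, mem_filter, mem_univ, true_and, Nat.lt_succ_iff_lt_or_eq]
        constructor
        · rintro (h | ⟨h | h, h'⟩)
          · exact Or.inl h
          · exact Or.inr ⟨h, h'⟩
          · rw [Fin.ext h] at h'; exact absurd h' hv2
        · rintro (h | ⟨h, h'⟩)
          · exact Or.inl h
          · exact Or.inr ⟨Or.inl h, h'⟩
      rw [e]
      by_cases h1 : 2 ≤ lab v
      · have h2 : ¬ G.Adj x v := fun h => hv2 ⟨h1, h⟩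
        rw [← hy]
        simp [Code.run, Instr.apply, Test.Holds, getLabel, getAdj, h'.two, h'.one, hv, hx', hl' v,
          h'.row x, h'.adj x v, h1, h2]
      · rw [← hy]
        simp [Code.run, Instr.apply, Test.Holds, getLabel, h'.two, hv, hl' v, h1]
  simpa using key

/-- `C` consists of active vertices in the component of `a`. -/
def WithinComponent (G : SimpleGraph (Fin n)) (lab : Fin n → ℕ) (a : Fin n) (C : Finset (Fin n)) :
    Prop :=
  a ∈ C ∧ C ⊆ active lab ∧
    ∀ D, a ∈ D → IsUnionOfComponents G (active lab) D → C ⊆ D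

/-- Marks are set in place, so vertices marked during the sweep may already pass marks on. The new
set is therefore only enclosed: it contains the active neighbours of `C` and remains within the
component of `a`. -/
lemma run_markSweep {s : State} (h : Ambient G w d s) (hl : HasLabels s lab)
    {C : Finset (Fin n)} (hC : HasSet (s.arr 4) 0 C) {a : Fin n} (ha : WithinComponent G lab a C) :
    ∃ C', HasSet ((markSweep.run s).arr 4) 0 C' ∧ WithinComponent G lab a C' ∧ C ⊆ C' ∧
      ∀ x ∈ C, ∀ y, 2 ≤ lab y → G.Adj x y → y ∈ C' := by
  classical
  have key : ∃ C', HasSet ((markSweep.run s).arr 4) 0 C' ∧ WithinComponent G lab a C' ∧ C ⊆ C' ∧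
      ∀ x ∈ C, (x : ℕ) < n → ∀ y, 2 ≤ lab y → G.Adj x y → y ∈ C' := by
    refine Code.run_rep_induction (by decide) h.size h.one
      (fun k s' => ∃ C', HasSet (s'.arr 4) 0 C' ∧ WithinComponent G lab a C' ∧ C ⊆ C' ∧
        ∀ x ∈ C, (x : ℕ) < k → ∀ y, 2 ≤ lab y → G.Adj x y → y ∈ C')
      ⟨C, hC, ha, Subset.rfl, by simp⟩ (fun v s' hv hf hI => ?_)
    have h' := h.of_frame hf (by decide)
    have hl' := hl.of_frame hf (by decide) (by decide)
    obtain ⟨C', hC', ha', hCC', hcl⟩ := hI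
    have hv4 := hC' v
    rw [zero_add] at hv4
    by_cases hvC : v ∈ C'
    · have fr := Code.frame_run (Instr.load 14 4 12) s'
      have hm := run_markNeighbours (h'.of_frame fr (by decide))
        (hl'.of_frame fr (by decide) (by decide)) (C := C')
        (by rw [fr.arr 4 (by decide)]; exact hC') (x := v) (by rw [fr.reg 12 (by decide), hv])
      refine ⟨C' ∪ univ.filter fun y => 2 ≤ lab y ∧ G.Adj v y, ?_, ⟨mem_union_left _ ha'.1, ?_, ?_⟩, ?_, ?_⟩
      · rw [Code.run, Code.run_branch_of]
        · exact hm
        · simp [Code.run, Test.Holds, Instr.apply, h'.one, hv, hv4, hvC]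
      · refine union_subset ha'.2.1 fun y hy => ?_
        simp only [mem_filter, mem_univ, true_and] at hy
        exact mem_active.2 hy.1
      · intro D haD hD
        refine union_subset (ha'.2.2 D haD hD) fun y hy => ?_
        simp only [mem_filter, mem_univ, true_and] at hy
        exact hD.2.2 v (ha'.2.2 D haD hD hvC) y (mem_active.2 hy.1) hy.2
      · exact hCC'.trans subset_union_left
      · intro x hx hxk y hy hxy
        rcases Nat.lt_succ_iff_lt_or_eq.1 hxk with hlt | heq
        · exact mem_union_left _ (hcl x hx hlt y hy hxy)
        · rw [Fin.ext heq] at hxy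
          exact mem_union_right _ (by simp [hy, hxy])
    · refine ⟨C', ?_, ha', hCC', ?_⟩
      · simpa [Code.run, Test.Holds, Instr.apply, h'.one, hv, hv4, hvC] using hC'
      · intro x hx hxk y hy hxy
        rcases Nat.lt_succ_iff_lt_or_eq.1 hxk with hlt | heq
        · exact hcl x hx hlt y hy hxy
        · rw [Fin.ext heq] at hx
          exact absurd (hCC' hx) hvC
  obtain ⟨C', h1, h2, h3, h4⟩ := key
  exact ⟨C', h1, h2, h3, fun x hx => h4 x hx x.2⟩

lemma run_clearMarks {s : State} (h : Ambient G w d s) :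
    HasSet ((Code.run (.rep 11 (Instr.store 4 11 5)) s).arr 4) 0 (∅ : Finset (Fin n)) := by
  have key : ∀ x : Fin n, (x : ℕ) < n →
      (Code.run (.rep 11 (Instr.store 4 11 5)) s).arr 4 x = 0 := by
    refine Code.run_rep_induction (by decide) h.size h.one
      (fun k s' => ∀ x : Fin n, (x : ℕ) < k → s'.arr 4 x = 0) (by simp) (fun v s' hv hf hI => ?_)
    have h' := h.of_frame hf (by decide)
    intro x hx
    by_cases e : (x : ℕ) = v
    · simp [Code.run, Instr.apply, hv, e, h'.zero]
    · simp [Code.run, Instr.apply, hv, Function.update_of_ne e, hI x (by omega)]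
  intro x
  simpa using key x x.2

/-- A sweep that changes nothing shows that the marked set is closed under active neighbours; any
other sweep adds a vertex. Starting from one mark, `n` gains would produce `n + 1` marked vertices.
-/
lemma run_markComponent {s : State} (h : Ambient G w d s) (hl : HasLabels s lab) {a : Fin n}
    (ha : s.reg 9 = a) (ha2 : 2 ≤ lab a) :
    ∃ C, HasSet ((markComponent.run s).arr 4) 0 C ∧ WithinComponent G lab a C ∧
      IsUnionOfComponents G (active lab) C := by
  classical
  set p : Code := .rep 11 (Instr.store 4 11 5) ;; Instr.store 4 9 2 with hp
  have fr := Code.frame_run p s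
  have h1 := h.of_frame fr (by decide)
  have hl1 := hl.of_frame fr (by decide) (by decide)
  have hC0 : HasSet ((p.run s).arr 4) 0 {a} := by
    intro x
    have h9 := (Code.frame_run (.rep 11 (Instr.store 4 11 5)) s).reg 9 (by decide)
    have h2 := (Code.frame_run (.rep 11 (Instr.store 4 11 5)) s).reg 2 (by decide)
    have hx := run_clearMarks h x
    simp only [hp]
    rw [Code.run]
    generalize Code.run (.rep 11 (Instr.store 4 11 5)) s = s₁ at *
    by_cases e : x = a
    · simp [Code.run, Instr.apply, h9, ha, h2, h.one, e]
    · have e' : (x : ℕ) ≠ a := fun h => e (Fin.ext h)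
      simp [Code.run, Instr.apply, h9, ha, Function.update_of_ne e', e]
      simpa using hx
  have haC : WithinComponent G lab a {a} :=
    ⟨by simp, by simpa using ha2, fun D hD _ => by simpa using hD⟩
  have key : ∃ C, HasSet ((markComponent.run s).arr 4) 0 C ∧ WithinComponent G lab a C ∧
      (IsUnionOfComponents G (active lab) C ∨ n + 1 ≤ #C) := by
    refine Code.run_rep_induction (s := p.run s) (p := markSweep) (i := 11) (by decide) h1.size
      h1.one
      (fun k s' => ∃ C, HasSet (s'.arr 4) 0 C ∧ WithinComponent G lab a C ∧
        (IsUnionOfComponents G (active lab) C ∨ k + 1 ≤ #C))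
      ⟨{a}, hC0, haC, by simp⟩ (fun v s' hv hf hI => ?_)
    have h' := h1.of_frame hf (by decide)
    have hl' := hl1.of_frame hf (by decide) (by decide)
    obtain ⟨C, hC, haC, hor⟩ := hI
    obtain ⟨C', hC', haC', hsub, hcl⟩ := run_markSweep h' hl' hC haC
    refine ⟨C', hC', haC', ?_⟩
    by_cases e : C' = C
    · subst e
      exact Or.inl ⟨haC'.2.1, ⟨a, haC'.1⟩, fun x hx y hy => hcl x hx y (mem_active.1 hy)⟩
    · rcases hor with hor | hor
      · exact absurd ((haC'.2.2 C haC.1 hor).antisymm hsub) e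
      · have := card_lt_card (hsub.ssubset_of_ne (Ne.symm e))
        right; omega
  obtain ⟨C, h1, h2, h3 | h3⟩ := key
  · exact ⟨C, h1, h2, h3⟩
  · have := card_le_univ C
    simp at this
    omega

/-- If the component of `a` is everything then the active part is connected. -/
lemma WithinComponent.isConnectedOn {a : Fin n} {C : Finset (Fin n)}
    (h : WithinComponent G lab a C) (hC : C = active lab) : IsConnectedOn G (active lab) := by
  intro D hD
  by_contra hne
  by_cases haD : a ∈ D
  · exact hne (hD.1.antisymm (hC ▸ h.2.2 D haD hD))
  · have := h.2.2 _ (mem_sdiff.2 ⟨h.2.1 h.1, haD⟩) (hD.sdiff hne)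
    obtain ⟨x, hx⟩ := hD.2.1
    have hxc := this (hC ▸ hD.1 hx)
    exact (mem_sdiff.1 hxc).2 hx

/-- Write into register `16` an active vertex that is not marked, or `n`. -/
def findUnmarked : Code :=
  Instr.move 16 0 ;;
  .rep 11 (getLabel 14 11 ;; .branch (.le 3 14)
    (Instr.load 15 4 11 ;; .branch (.eq 15 5) (Instr.move 16 11) .skip) .skip)

lemma run_findUnmarked {s : State} (h : Ambient G w d s) (hl : HasLabels s lab)
    {C : Finset (Fin n)} (hC : HasSet (s.arr 4) 0 C) :
    Finds (fun v => 2 ≤ lab v ∧ v ∉ C) n ((findUnmarked.run s).reg 16) := by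
  have fr := Code.frame_run (Instr.move 16 0) s
  have h1 := h.of_frame fr (by decide)
  have hl1 := hl.of_frame fr (by decide) (by decide)
  refine Code.run_rep_induction (by decide) h1.size h1.one
    (fun k s' => Finds (fun v => 2 ≤ lab v ∧ v ∉ C) k (s'.reg 16))
    (by simp [Code.run, Instr.apply, h.size, finds_zero]) (fun v s' hv hf hI => ?_)
  have h' := h1.of_frame hf (by decide)
  have hl' := hl1.of_frame hf (by decide) (by decide)
  have hv4 : s'.arr 4 v = if v ∈ C then 1 else 0 := by
    rw [hf.arr 4 (by decide), fr.arr 4 (by decide)]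
    simpa using hC v
  by_cases h2 : 2 ≤ lab v
  · by_cases hvC : v ∈ C
    · simp [Code.run, Instr.apply, Test.Holds, getLabel, hv, hl' v, h'.two, h'.zero, hv4, h2, hvC]
      exact hI.succ_of_not fun h => h.2 hvC
    · simp [Code.run, Instr.apply, Test.Holds, getLabel, hv, hl' v, h'.two, h'.zero, hv4, h2, hvC]
      exact finds_of ⟨h2, hvC⟩
  · simp [Code.run, Instr.apply, Test.Holds, getLabel, hv, hl' v, h'.two, h2]
    exact hI.succ_of_not fun h => h2 h.1

/-- If the vertex in register `11` has an active neighbour, write that vertex into register `17` and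
the neighbour into register `8`. -/
def linkNeighbour : Code :=
  .rep 12 (getLabel 15 12 ;; .branch (.le 3 15)
    (getAdj 15 11 12 ;; .branch (.eq 15 2) (Instr.move 17 11 ;; Instr.move 8 12) .skip) .skip)

/-- Look for a removed vertex with an active neighbour. -/
def findLink : Code :=
  Instr.move 17 0 ;; .rep 11 (getLabel 14 11 ;; .branch (.eq 14 2) linkNeighbour .skip)

/-- The registers `17` and `8` hold a removed vertex and an active neighbour of it. -/
def Linked (G : SimpleGraph (Fin n)) (lab : Fin n → ℕ) (s : State) : Prop :=
  ∃ z v : Fin n, s.reg 17 = z ∧ s.reg 8 = v ∧ lab z = 1 ∧ 2 ≤ lab v ∧ G.Adj z v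

lemma Linked.congr {s s' : State} (h : Linked G lab s) (h17 : s'.reg 17 = s.reg 17)
    (h8 : s'.reg 8 = s.reg 8) : Linked G lab s' := by
  unfold Linked at *
  rwa [h17, h8]

/-- An unsuccessful search leaves the registers `17` and `8` alone, so a link found for an earlier
vertex survives. -/
lemma run_linkNeighbour {s : State} (h : Ambient G w d s) (hl : HasLabels s lab) {z : Fin n}
    (hz : s.reg 11 = z) (hz1 : lab z = 1) :
    ((linkNeighbour.run s).reg 17 = s.reg 17 ∧ (linkNeighbour.run s).reg 8 = s.reg 8 ∧
      ∀ x, 2 ≤ lab x → ¬ G.Adj z x) ∨ Linked G lab (linkNeighbour.run s) := by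
  classical
  have key : ((linkNeighbour.run s).reg 17 = s.reg 17 ∧ (linkNeighbour.run s).reg 8 = s.reg 8 ∧
      ∀ x : Fin n, (x : ℕ) < n → 2 ≤ lab x → ¬ G.Adj z x) ∨ Linked G lab (linkNeighbour.run s) := by
    refine Code.run_rep_induction (by decide) h.size h.one
      (fun k s' => (s'.reg 17 = s.reg 17 ∧ s'.reg 8 = s.reg 8 ∧
        ∀ x : Fin n, (x : ℕ) < k → 2 ≤ lab x → ¬ G.Adj z x) ∨ Linked G lab s')
      (Or.inl (by simp)) (fun v s' hv hf hI => ?_)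
    have h' := h.of_frame hf (by decide)
    have hl' := hl.of_frame hf (by decide) (by decide)
    have hz' : s'.reg 11 = z := (hf.reg 11 (by decide)).trans hz
    by_cases hc : 2 ≤ lab v ∧ G.Adj z v
    · right
      refine ⟨z, v, ?_, ?_, hz1, hc.1, hc.2⟩ <;>
      simp [Code.run, Instr.apply, Test.Holds, getLabel, getAdj, h'.two, h'.one, hv, hz', hl' v,
          h'.row z, h'.adj z v, hc.1, hc.2]
    · have hc' : ∀ x : Fin n, (x : ℕ) < v + 1 → (x : ℕ) < v ∨ ¬ (2 ≤ lab x ∧ G.Adj z x) := by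
        intro x hx
        rcases Nat.lt_succ_iff_lt_or_eq.1 hx with hx | hx
        · exact Or.inl hx
        · rw [Fin.ext hx]; exact Or.inr hc
      have e : ∀ r ∈ [17, 8], (Code.run (getLabel 15 12 ;; .branch (.le 3 15) (getAdj 15 11 12 ;;
          .branch (.eq 15 2) (Instr.move 17 11 ;; Instr.move 8 12) .skip) .skip) s').reg r
            = s'.reg r := by
        intro r hr
        by_cases h1 : 2 ≤ lab v
        · have h2 : ¬ G.Adj z v := fun h => hc ⟨h1, h⟩
          simp only [List.mem_cons, List.not_mem_nil, or_false] at hr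
          rcases hr with rfl | rfl <;>
          simp [Code.run, Instr.apply, Test.Holds, getLabel, getAdj, h'.two, h'.one, hv, hz',
            hl' v, h'.row z, h'.adj z v, h1, h2]
        · simp only [List.mem_cons, List.not_mem_nil, or_false] at hr
          rcases hr with rfl | rfl <;>
          simp [Code.run, Instr.apply, Test.Holds, getLabel, h'.two, hv, hl' v, h1]
      have e17 := e 17 (by simp)
      have e8 := e 8 (by simp)
      rcases hI with hI | hI
      · exact Or.inl ⟨by simpa [e17] using hI.1, by simpa [e8] using hI.2.1,
          fun x hx hx2 hzx => (hc' x hx).elim (fun h => hI.2.2 x h hx2 hzx) fun h => h ⟨hx2, hzx⟩⟩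
      · exact Or.inr (hI.congr (by simp [e17]) (by simp [e8]))
  rcases key with key | key
  · exact Or.inl ⟨key.1, key.2.1, fun x => key.2.2 x x.2⟩
  · exact Or.inr key

lemma run_findLink {s : State} (h : Ambient G w d s) (hl : HasLabels s lab) :
    ((findLink.run s).reg 17 = n ∧ ∀ z, lab z = 1 → ∀ x, 2 ≤ lab x → ¬ G.Adj z x) ∨
      Linked G lab (findLink.run s) := by
  have fr := Code.frame_run (Instr.move 17 0) s
  have h1 := h.of_frame fr (by decide)
  have hl1 := hl.of_frame fr (by decide) (by decide)
  have key : ((findLink.run s).reg 17 = n ∧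
      ∀ z : Fin n, (z : ℕ) < n → lab z = 1 → ∀ x, 2 ≤ lab x → ¬ G.Adj z x) ∨
      Linked G lab (findLink.run s) := by
    refine Code.run_rep_induction (by decide) h1.size h1.one
      (fun k s' => (s'.reg 17 = n ∧
        ∀ z : Fin n, (z : ℕ) < k → lab z = 1 → ∀ x, 2 ≤ lab x → ¬ G.Adj z x) ∨ Linked G lab s')
      (Or.inl (by simp [Code.run, Instr.apply, h.size])) (fun v s' hv hf hI => ?_)
    have h' := h1.of_frame hf (by decide)
    have hl' := hl1.of_frame hf (by decide) (by decide)
    by_cases hv1 : lab v = 1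
    · have fr2 := Code.frame_run (getLabel 14 11) s'
      have e : ∀ p : Code, Code.run (getLabel 14 11 ;; .branch (.eq 14 2) p .skip) s' =
          p.run ((getLabel 14 11).run s') := by
        intro p
        simp [Code.run, Instr.apply, Test.Holds, getLabel, hv, hl' v, h'.one, hv1]
      rw [e]
      have hn := run_linkNeighbour (h'.of_frame fr2 (by decide))
        (hl'.of_frame fr2 (by decide) (by decide)) (z := v) (by rw [fr2.reg 11 (by decide), hv]) hv1
      rw [fr2.reg 17 (by decide), fr2.reg 8 (by decide)] at hn
      rcases hn with ⟨e17, e8, hno⟩ | hn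
      · rcases hI with ⟨hI, hI'⟩ | hI
        · refine Or.inl ⟨by simp [e17, hI], fun z hz hz1 => ?_⟩
          rcases Nat.lt_succ_iff_lt_or_eq.1 hz with hz | hz
          · exact hI' z hz hz1
          · rw [Fin.ext hz]; exact hno
        · exact Or.inr (hI.congr (by simp [e17]) (by simp [e8]))
      · exact Or.inr (hn.congr (by simp) (by simp))
    · have e : ∀ p : Code, Code.run (getLabel 14 11 ;; .branch (.eq 14 2) p .skip) s' =
          (getLabel 14 11).run s' := by
        intro p
        simp [Code.run, Instr.apply, Test.Holds, getLabel, hv, hl' v, h'.one, hv1]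
      rw [e]
      rcases hI with ⟨hI, hI'⟩ | hI
      · refine Or.inl ⟨by simp [getLabel, Code.run, Instr.apply, hI], fun z hz hz1 => ?_⟩
        rcases Nat.lt_succ_iff_lt_or_eq.1 hz with hz | hz
        · exact hI' z hz hz1
        · rw [Fin.ext hz] at hz1; exact absurd hz1 hv1
      · exact Or.inr (hI.congr (by simp [getLabel, Code.run, Instr.apply])
          (by simp [getLabel, Code.run, Instr.apply]))
  rcases key with key | key
  · exact Or.inl ⟨key.1, fun x => key.2 x x.2⟩
  · exact Or.inr key

/-- Make the active neighbours of the vertex in register `17` the pending vertices. -/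
def relabel : Code :=
  .rep 11 (getLabel 14 11 ;;
    .branch (.le 3 14) (getAdj 15 17 11 ;; .branch (.eq 15 2) (Instr.move 15 4) (Instr.move 15 3))
      (Instr.move 15 5) ;;
    Instr.add 14 7 11 ;; Instr.store 2 14 15)

/-- Overwriting in place is safe, since the new label of a vertex depends only on its own old label
and on the adjacency matrix. The cells below the base belong to suspended calls. -/
lemma run_relabel {s : State} (h : Ambient G w d s) (hl : HasLabels s lab) {z : Fin n}
    (hz : s.reg 17 = z) : HasLabels (relabel.run s) (advance G lab z) ∧
      ∀ c < s.reg 7, (relabel.run s).arr 2 c = s.arr 2 c := by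
  classical
  have key : (∀ x : Fin n, (relabel.run s).arr 2 (s.reg 7 + x) =
      if (x : ℕ) < n then advance G lab z x else lab x) ∧
      ∀ c < s.reg 7, (relabel.run s).arr 2 c = s.arr 2 c := by
    refine Code.run_rep_induction (by decide) h.size h.one
      (fun k s' => (∀ x : Fin n, s'.arr 2 (s.reg 7 + x) =
        if (x : ℕ) < k then advance G lab z x else lab x) ∧ ∀ c < s.reg 7, s'.arr 2 c = s.arr 2 c)
      (by simpa using fun x => hl x) (fun v s' hv hf hI => ?_)
    have h' := h.of_frame hf (by decide)
    have hz' : s'.reg 17 = z := (hf.reg 17 (by decide)).trans hz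
    have h7 : s'.reg 7 = s.reg 7 := hf.reg 7 (by decide)
    have hv' := hI.1 v
    simp only [lt_irrefl, if_false] at hv'
    have e : (Code.run (getLabel 14 11 ;;
        .branch (.le 3 14)
          (getAdj 15 17 11 ;; .branch (.eq 15 2) (Instr.move 15 4) (Instr.move 15 3))
          (Instr.move 15 5) ;;
        Instr.add 14 7 11 ;; Instr.store 2 14 15) s').arr 2 =
        Function.update (s'.arr 2) (s.reg 7 + v) (advance G lab z v) := by
      by_cases h1 : 2 ≤ lab v <;> by_cases h2 : G.Adj z v <;>
      simp [Code.run, Instr.apply, Test.Holds, getLabel, getAdj, h'.two, h'.one, h'.three, h'.zero,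
        hv, hz', hv', h7, h'.row z, h'.adj z v, h1, h2, advance]
    simp only [e]
    refine ⟨fun x => ?_, fun c hc => ?_⟩
    · by_cases hx : x = v
      · simp [hx]
      · have hx' : (x : ℕ) ≠ v := fun e => hx (Fin.ext e)
        rw [Function.update_of_ne (by omega), hI.1 x]
        have : (x : ℕ) < v + 1 ↔ (x : ℕ) < v := by omega
        simp [this]
    · rw [Function.update_of_ne (by omega), hI.2 c hc]
  refine ⟨fun x => ?_, key.2⟩
  rw [(Code.frame_run relabel s).reg 7 (by decide)]
  simpa using key.1 x

end PathFreeMWIS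

/-! ### Choosing the branching step and preparing the two calls. -/

namespace PathFreeMWIS

open RAM Finset

variable {n : ℕ} {G : SimpleGraph (Fin n)} {w : Fin n → ℝ≥0} {d : ℕ} {lab : Fin n → ℕ}

/-- Decide what to do with the current labelling. Afterwards register `9` holds `n` if nothing is
active; otherwise register `8` holds the vertex to branch on and register `10` the label for removed
vertices, or register `8` holds `n` and a proper union of components is marked. -/
def select : Code :=
  Instr.move 10 5 ;; findActive ;; findHigh ;;
  .branch (.lt 8 0) .skip
    (Instr.move 10 2 ;;
    .branch (.lt 18 0) (Instr.move 8 18)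
      (.branch (.lt 9 0)
        (markComponent ;; findUnmarked ;;
        .branch (.lt 16 0) .skip
          (findLink ;; .branch (.lt 17 0) relabel (Instr.move 8 9)))
        .skip))

/-- In the state `s` it remains to branch on a vertex. -/
def SelectsPivot (G : SimpleGraph (Fin n)) (d : ℕ) (lab : Fin n → ℕ) (s : State) : Prop :=
  ∃ (lab' : Fin n → ℕ) (v : Fin n), s.reg 9 < n ∧ s.reg 8 = v ∧ s.reg 10 ≤ 1 ∧ v ∈ active lab ∧
    HasLabels s lab' ∧ active lab' = active lab ∧
    ∀ c₁ c₂, RecTree G d (dropVertex lab' v (s.reg 10)) c₁ →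
      RecTree G d (takeVertex G lab' v (s.reg 10)) c₂ → RecTree G d lab (c₁ + c₂ + 1)

/-- In the state `s` it remains to split off the marked vertices. -/
def SelectsSplit (G : SimpleGraph (Fin n)) (d : ℕ) (lab : Fin n → ℕ) (s : State) : Prop :=
  ∃ C : Finset (Fin n), s.reg 9 < n ∧ s.reg 8 = n ∧ HasSet (s.arr 4) 0 C ∧ HasLabels s lab ∧
    IsUnionOfComponents G (active lab) C ∧ C ≠ active lab ∧
    ∀ c₁ c₂, RecTree G d (restrictTo lab C) c₁ →
      RecTree G d (restrictAway lab C) c₂ → RecTree G d lab (c₁ + c₂ + 1)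

/-- The cascade of tests mirrors the constructors of `RecTree`: each failed search supplies a
hypothesis for the later cases, namely low degrees, empty frontier, connectedness and absence of
links. -/
lemma run_select {s : State} (h : Ambient G w d s) (hl : HasLabels s lab) :
    (((select.run s).reg 9 = n ∧ active lab = ∅) ∨ SelectsPivot G d lab (select.run s) ∨
      SelectsSplit G d lab (select.run s)) ∧
    ∀ c < s.reg 7, (select.run s).arr 2 c = s.arr 2 c := by
  classical
  have hf₁ := Code.frame_run (Instr.move 10 5) s
  have h₁ := h.of_frame hf₁ (by decide)
  have hl₁ := hl.of_frame hf₁ (by decide) (by decide)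
  have e10 : (Code.run (Instr.move 10 5) s).reg 10 = 0 := by simp [Code.run, Instr.apply, h.zero]
  have ha := run_findActive h₁ hl₁
  rw [select, Code.run_seq, Code.run_seq, Code.run_seq]
  have e7₁ := hf₁.reg 7 (by decide)
  have e2₁ := hf₁.arr 2 (by decide)
  rw [← e2₁, ← e7₁]
  generalize Code.run (Instr.move 10 5) s = s₁ at *
  have hf₂ := Code.frame_run findActive s₁
  have h₂ := h₁.of_frame hf₂ (by decide)
  have hl₂ := hl₁.of_frame hf₂ (by decide) (by decide)
  rw [← hf₂.reg 10 (by decide)] at e10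
  rw [← hf₂.reg 7 (by decide), ← hf₂.arr 2 (by decide)]
  have hh := run_findHigh h₂ hl₂
  generalize findActive.run s₁ = s₂ at *
  have hf₃ := Code.frame_run findHigh s₂
  have h₃ := h₂.of_frame hf₃ (by decide)
  have hl₃ := hl₂.of_frame hf₃ (by decide) (by decide)
  rw [← hf₃.reg 10 (by decide)] at e10
  rw [← hf₃.reg 7 (by decide), ← hf₃.arr 2 (by decide)]
  rw [← hf₃.reg 9 (by decide), ← hf₃.reg 18 (by decide)] at ha
  generalize findHigh.run s₂ = s₃ at *
  have lt_of_active : ∀ v, 2 ≤ lab v → s₃.reg 9 < n := by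
    intro v hv
    rcases ha.1 with ⟨-, h⟩ | ⟨x, hx, -⟩
    · exact absurd hv (h v v.2)
    · rw [hx]; exact x.2
  rcases hh with ⟨e8, hlow⟩ | ⟨v, e8, hv⟩
  swap
  · rw [Code.run_branch_of (b := .lt 8 0) (s := s₃)
      (by simp [Test.Holds, e8, h₃.size])]
    refine ⟨Or.inr (Or.inl ⟨lab, v, lt_of_active v hv.1, e8, by simp [Code.run, e10],
      mem_active.2 hv.1, hl₃, rfl, fun c₁ c₂ t₁ t₂ => ?_⟩), fun c _ => rfl⟩
    simp only [Code.run, e10] at t₁ t₂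
    exact .high v (mem_active.2 hv.1) hv.2 t₁ t₂
  have hdeg : DegreesBelow G d (active lab) := by
    intro u hu
    by_contra hc
    exact hlow u u.2 ⟨mem_active.1 hu, by omega⟩
  rw [Code.run_branch_of_not (b := .lt 8 0) (s := s₃)
      (by simp [Test.Holds, e8, h₃.size]), Code.run_seq]
  have hf₄ := Code.frame_run (Instr.move 10 2) s₃
  have h₄ := h₃.of_frame hf₄ (by decide)
  have hl₄ := hl₃.of_frame hf₄ (by decide) (by decide)
  have e10' : (Code.run (Instr.move 10 2) s₃).reg 10 = 1 := by simp [Code.run, Instr.apply, h₃.one]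
  rw [← hf₄.reg 7 (by decide), ← hf₄.arr 2 (by decide)]
  rw [← hf₄.reg 9 (by decide), ← hf₄.reg 18 (by decide)] at ha
  rw [← hf₄.reg 9 (by decide)] at lt_of_active
  rw [← hf₄.reg 8 (by decide)] at e8
  clear e10
  generalize Code.run (Instr.move 10 2) s₃ = s₄ at *
  rcases ha with ⟨ha9, ⟨e18, hno3⟩ | ⟨v, e18, hv3⟩⟩
  swap
  · rw [Code.run_branch_of (b := .lt 18 0) (s := s₄)
      (by simp [Test.Holds, e18, h₄.size])]
    have hv2 : 2 ≤ lab v := by omega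
    have e10 : (Code.run (Instr.move 8 18) s₄).reg 10 = 1 := by simp [Code.run, Instr.apply, e10']
    refine ⟨Or.inr (Or.inl ⟨lab, v, by simpa [Code.run, Instr.apply] using lt_of_active v hv2,
      by simp [Code.run, Instr.apply, e18], by omega, mem_active.2 hv2,
      hl₄.of_frame (Code.frame_run _ _) (by decide) (by decide), rfl, fun c₁ c₂ t₁ t₂ => ?_⟩),
      fun c _ => rfl⟩
    rw [e10] at t₁ t₂
    exact .frontier v hdeg hv3 t₁ t₂
  rw [Code.run_branch_of_not (b := .lt 18 0) (s := s₄)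
      (by simp [Test.Holds, e18, h₄.size])]
  have h3 : ∀ v, lab v ≠ 3 := fun v => hno3 v v.2
  rcases ha9 with ⟨e9, hempty⟩ | ⟨a, e9, ha2⟩
  · rw [Code.run_branch_of_not (b := .lt 9 0) (s := s₄)
      (by simp [Test.Holds, e9, h₄.size])]
    refine ⟨Or.inl ⟨e9, ?_⟩, fun c _ => rfl⟩
    ext x
    simpa using hempty x x.2
  rw [Code.run_branch_of (b := .lt 9 0) (s := s₄)
      (by simp [Test.Holds, e9, h₄.size]), Code.run_seq, Code.run_seq]
  obtain ⟨C, hC, haC, hCc⟩ := run_markComponent h₄ hl₄ e9 ha2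
  have hf₅ := Code.frame_run markComponent s₄
  have h₅ := h₄.of_frame hf₅ (by decide)
  have hl₅ := hl₄.of_frame hf₅ (by decide) (by decide)
  rw [← hf₅.reg 7 (by decide), ← hf₅.arr 2 (by decide)]
  rw [← hf₅.reg 9 (by decide)] at e9
  rw [← hf₅.reg 8 (by decide)] at e8
  rw [← hf₅.reg 10 (by decide)] at e10'
  generalize markComponent.run s₄ = s₅ at *
  have hu := run_findUnmarked h₅ hl₅ hC
  have hf₆ := Code.frame_run findUnmarked s₅
  have h₆ := h₅.of_frame hf₆ (by decide)
  have hl₆ := hl₅.of_frame hf₆ (by decide) (by decide)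
  rw [← hf₆.reg 7 (by decide), ← hf₆.arr 2 (by decide)]
  rw [← hf₆.reg 9 (by decide)] at e9
  rw [← hf₆.reg 8 (by decide)] at e8
  rw [← hf₆.reg 10 (by decide)] at e10'
  rw [← hf₆.arr 4 (by decide)] at hC
  generalize findUnmarked.run s₅ = s₆ at *
  rcases hu with ⟨e16, hall⟩ | ⟨x, e16, hx⟩
  swap
  · rw [Code.run_branch_of (b := .lt 16 0) (s := s₆)
      (by simp [Test.Holds, e16, h₆.size])]
    have hne : C ≠ active lab := fun e => hx.2 (e ▸ mem_active.2 hx.1)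
    -- Register `8` still holds `n` from the failed search for high degrees; this value signals a
    -- split.
    exact ⟨Or.inr (Or.inr ⟨C, by simp [Code.run, e9], e8, hC, hl₆, hCc, hne,
      fun c₁ c₂ t₁ t₂ => .split C hdeg h3 hCc hne t₁ t₂⟩), fun c _ => rfl⟩
  rw [Code.run_branch_of_not (b := .lt 16 0) (s := s₆)
      (by simp [Test.Holds, e16, h₆.size]), Code.run_seq]
  have hconn : IsConnectedOn G (active lab) := haC.isConnectedOn <| by
    refine hCc.1.antisymm fun x hx => ?_
    by_contra hxC
    exact hall x x.2 ⟨mem_active.1 hx, hxC⟩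
  have hlink := run_findLink h₆ hl₆
  have hf₇ := Code.frame_run findLink s₆
  have h₇ := h₆.of_frame hf₇ (by decide)
  have hl₇ := hl₆.of_frame hf₇ (by decide) (by decide)
  rw [← hf₇.reg 7 (by decide), ← hf₇.arr 2 (by decide)]
  rw [← hf₇.reg 9 (by decide)] at e9
  rw [← hf₇.reg 10 (by decide)] at e10'
  generalize findLink.run s₆ = s₇ at *
  rcases hlink with ⟨e17, hno⟩ | ⟨z, v, e17, e8, hz1, hv2, hzv⟩
  · rw [Code.run_branch_of_not (b := .lt 17 0) (s := s₇)
      (by simp [Test.Holds, e17, h₇.size])]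
    have e10 : (Code.run (Instr.move 8 9) s₇).reg 10 = 1 := by simp [Code.run, Instr.apply, e10']
    refine ⟨Or.inr (Or.inl ⟨lab, a, by simp [Code.run, Instr.apply, e9],
      by simp [Code.run, Instr.apply, e9], by omega, mem_active.2 ha2,
      hl₇.of_frame (Code.frame_run _ _) (by decide) (by decide), rfl, fun c₁ c₂ t₁ t₂ => ?_⟩),
      fun c _ => rfl⟩
    rw [e10] at t₁ t₂
    exact .start a hdeg h3 hconn (fun z hz x hx => hno z hz x (mem_active.1 hx))
      (mem_active.2 ha2) t₁ t₂
  · rw [Code.run_branch_of (b := .lt 17 0) (s := s₇)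
      (by simp [Test.Holds, e17, h₇.size])]
    have hr := run_relabel h₇ hl₇ e17
    have hf₈ := Code.frame_run relabel s₇
    rw [← hf₈.reg 9 (by decide)] at e9
    rw [← hf₈.reg 8 (by decide)] at e8
    rw [← hf₈.reg 10 (by decide)] at e10'
    refine ⟨Or.inr (Or.inl ⟨advance G lab z, v, by simp [e9], e8, by omega, mem_active.2 hv2,
      hr.1, active_advance, fun c₁ c₂ t₁ t₂ => ?_⟩), hr.2⟩
    rw [e10'] at t₁ t₂
    exact .extend z v hdeg h3 hconn hz1 (mem_active.2 hv2) hzv t₁ t₂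

/-- Store the registers `15` and `16` as the labels of the current vertex for the two calls. -/
def storeLabels : Code :=
  Instr.add 17 7 0 ;; Instr.add 18 17 11 ;; Instr.store 2 18 15 ;;
  Instr.add 17 17 0 ;; Instr.add 18 17 11 ;; Instr.store 2 18 16

/-- Labels for the two calls after branching on the vertex in register `8`. -/
def pivotLabels : Code :=
  getLabel 14 11 ;; Instr.move 15 14 ;; Instr.move 16 14 ;;
  .branch (.le 3 14) (getAdj 17 8 11 ;; .branch (.eq 17 2) (Instr.move 16 10) .skip) .skip ;;
  .branch (.eq 11 8) (Instr.move 15 10 ;; Instr.move 16 10) .skip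

/-- Labels for the two calls after splitting off the marked vertices. -/
def splitLabels : Code :=
  getLabel 14 11 ;; Instr.move 15 14 ;; Instr.move 16 14 ;;
  .branch (.le 3 14)
    (Instr.load 17 4 11 ;; .branch (.eq 17 2) (Instr.move 16 5) (Instr.move 15 5)) .skip

/-- Prepare the labels for the two calls, and the address of the second. -/
def build : Code :=
  Instr.store 5 7 8 ;;
  .branch (.lt 8 0) (.rep 11 (pivotLabels ;; storeLabels)) (.rep 11 (splitLabels ;; storeLabels)) ;;
  Instr.add 7 7 0 ;; Instr.add 7 7 0

/-- The children occupy the blocks at `s.reg 7 + n` and `s.reg 7 + n + n`, so the current labels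
stay readable during the loop. Branching and splitting differ only in the code `p` that computes the
two labels. -/
lemma run_storeLabels_loop {p : Code} {s : State} {lab₁ lab₂ : Fin n → ℕ}
    (hp : (Code.rep 11 (p ;; storeLabels)).PreservesAmbient)
    (hp' : 2 ∉ p.arrs ∧ 0 ∉ p.regs ∧ 7 ∉ p.regs ∧ 11 ∉ p.regs)
    (h : Ambient G w d s) (hl : HasLabels s lab)
    (hval : ∀ (v : Fin n) (s' : State), s'.reg 11 = v →
      (Code.rep 11 (p ;; storeLabels)).Frame s s' → HasLabels s' lab →
      (p.run s').reg 15 = lab₁ v ∧ (p.run s').reg 16 = lab₂ v) :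
    (∀ x : Fin n,
      ((Code.rep 11 (p ;; storeLabels)).run s).arr 2 (s.reg 7 + n + x) = lab₁ x ∧
      ((Code.rep 11 (p ;; storeLabels)).run s).arr 2 (s.reg 7 + n + n + x) = lab₂ x) ∧
    ∀ c < s.reg 7 + n, ((Code.rep 11 (p ;; storeLabels)).run s).arr 2 c = s.arr 2 c := by
  have h7mem : 7 ∉ (Code.rep 11 (p ;; storeLabels)).regs := by
    have : (Code.rep 11 (p ;; storeLabels)).regs = 11 :: (p.regs ++ storeLabels.regs) := rfl
    rw [this]
    simp only [List.mem_cons, List.mem_append, not_or]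
    exact ⟨by decide, hp'.2.2.1, by decide⟩
  have key : (∀ x : Fin n, (x : ℕ) < n →
      ((Code.rep 11 (p ;; storeLabels)).run s).arr 2 (s.reg 7 + n + x) = lab₁ x ∧
      ((Code.rep 11 (p ;; storeLabels)).run s).arr 2 (s.reg 7 + n + n + x) = lab₂ x) ∧
    ∀ c < s.reg 7 + n, ((Code.rep 11 (p ;; storeLabels)).run s).arr 2 c = s.arr 2 c := by
    refine Code.run_rep_induction hp.1 h.size h.one
      (fun k s' => (∀ x : Fin n, (x : ℕ) < k → s'.arr 2 (s.reg 7 + n + x) = lab₁ x ∧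
        s'.arr 2 (s.reg 7 + n + n + x) = lab₂ x) ∧ ∀ c < s.reg 7 + n, s'.arr 2 c = s.arr 2 c)
      (by simp) (fun v s' hv hf hI => ?_)
    have h' := h.of_frame hf hp
    have h7 : s'.reg 7 = s.reg 7 := hf.reg 7 h7mem
    have hl' : HasLabels s' lab := fun x => by
      rw [h7, hI.2 _ (by have := x.2; omega), hl x]
    obtain ⟨e15, e16⟩ := hval v s' hv hf hl'
    have fr := Code.frame_run p s'
    have e : (Code.run (p ;; storeLabels) s').arr 2 =
        Function.update (Function.update (s'.arr 2) (s.reg 7 + n + v) (lab₁ v))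
          (s.reg 7 + n + n + v) (lab₂ v) := by
      simp [Code.run, storeLabels, Instr.apply, e15, e16, fr.reg 7 hp'.2.2.1, fr.reg 0 hp'.2.1,
        fr.reg 11 hp'.2.2.2, fr.arr 2 hp'.1, h7, hv, h'.size]
    simp only [e]
    have hvn := v.2
    refine ⟨fun x hx => ?_, fun c hc => ?_⟩
    · have hxn := x.2
      by_cases hxv : x = v
      · subst hxv
        rw [Function.update_of_ne (by omega)]
        simp
      · have hxv' : (x : ℕ) ≠ v := fun e => hxv (Fin.ext e)
        rw [Function.update_of_ne (by omega), Function.update_of_ne (by omega),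
          Function.update_of_ne (by omega), Function.update_of_ne (by omega)]
        exact hI.1 x (by omega)
    · rw [Function.update_of_ne (by omega), Function.update_of_ne (by omega)]
      exact hI.2 c hc
  exact ⟨fun x => key.1 x x.2, key.2⟩

/-- The effect of preparing two calls with labels `lab₁` and `lab₂`. -/
structure Built (s s' : State) (lab₁ lab₂ : Fin n → ℕ) : Prop where
  base : s'.reg 7 = s.reg 7 + n + n
  fst : ∀ x : Fin n, s'.arr 2 (s.reg 7 + n + x) = lab₁ x
  snd : ∀ x : Fin n, s'.arr 2 (s.reg 7 + n + n + x) = lab₂ x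
  low : ∀ c < s.reg 7, s'.arr 2 c = s.arr 2 c
  pivot : s'.arr 5 (s.reg 7) = s.reg 8
  pivot_low : ∀ c < s.reg 7, s'.arr 5 c = s.arr 5 c

lemma built_of_loop {p : Code} {s : State} {lab₁ lab₂ : Fin n → ℕ}
    (hp : (Code.rep 11 (p ;; storeLabels)).PreservesAmbient)
    (hp' : 2 ∉ p.arrs ∧ 5 ∉ p.arrs ∧ 0 ∉ p.regs ∧ 7 ∉ p.regs ∧ 11 ∉ p.regs)
    (h : Ambient G w d s) (hl : HasLabels s lab)
    (hval : ∀ (v : Fin n) (s' : State), s'.reg 11 = v →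
      (Code.rep 11 (p ;; storeLabels)).Frame (Code.run (Instr.store 5 7 8) s) s' →
      HasLabels s' lab → (p.run s').reg 15 = lab₁ v ∧ (p.run s').reg 16 = lab₂ v) :
    Built s (Code.run (Instr.store 5 7 8 ;; .rep 11 (p ;; storeLabels) ;;
      Instr.add 7 7 0 ;; Instr.add 7 7 0) s) lab₁ lab₂ := by
  have fr := Code.frame_run (Instr.store 5 7 8) s
  have h₁ := h.of_frame fr (by decide)
  have hl₁ := hl.of_frame fr (by decide) (by decide)
  have key := run_storeLabels_loop hp ⟨hp'.1, hp'.2.2⟩ h₁ hl₁ hval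
  have e5 : (Code.run (Instr.store 5 7 8) s).arr 5 =
    Function.update (s.arr 5) (s.reg 7) (s.reg 8) := by simp [Code.run, Instr.apply]
  rw [fr.reg 7 (by decide), fr.arr 2 (by decide)] at key
  rw [Code.run_seq, Code.run_seq]
  have e7 := fr.reg 7 (by decide)
  generalize Code.run (Instr.store 5 7 8) s = s₁ at *
  have f := Code.frame_run (.rep 11 (p ;; storeLabels)) s₁
  have h7 : 7 ∉ (Code.rep 11 (p ;; storeLabels)).regs := by
    have : (Code.rep 11 (p ;; storeLabels)).regs = 11 :: (p.regs ++ storeLabels.regs) := rfl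
    rw [this]
    simp only [List.mem_cons, List.mem_append, not_or]
    exact ⟨by decide, hp'.2.2.2.1, by decide⟩
  have h5 : 5 ∉ (Code.rep 11 (p ;; storeLabels)).arrs := by
    have : (Code.rep 11 (p ;; storeLabels)).arrs = p.arrs ++ storeLabels.arrs := rfl
    rw [this]
    simp only [List.mem_append, not_or]
    exact ⟨hp'.2.1, by decide⟩
  have f7 := f.reg 7 h7
  have f0 := f.reg 0 hp.1.2.1
  have f5 := f.arr 5 h5
  generalize Code.run (.rep 11 (p ;; storeLabels)) s₁ = s₂ at *
  constructor
  · simp [Code.run, Instr.apply, f7, f0, e7, h₁.size]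
  · simpa [Code.run, Instr.apply] using fun x => (key.1 x).1
  · simpa [Code.run, Instr.apply] using fun x => (key.1 x).2
  · intro c hc
    simpa [Code.run, Instr.apply] using key.2 c (by omega)
  · simp [Code.run, Instr.apply, f5, e5]
  · intro c hc
    simp [Code.run, Instr.apply, f5, e5, Function.update_of_ne hc.ne]

lemma run_build_pivot {s : State} (h : Ambient G w d s) (hl : HasLabels s lab) {v : Fin n}
    (hv : s.reg 8 = v) :
    Built s (build.run s) (dropVertex lab v (s.reg 10)) (takeVertex G lab v (s.reg 10)) := by
  classical
  have e : build.run s = Code.run (Instr.store 5 7 8 ;; .rep 11 (pivotLabels ;; storeLabels) ;;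
      Instr.add 7 7 0 ;; Instr.add 7 7 0) s := by
    rw [build, Code.run_seq, Code.run_seq, Code.run_branch_of (b := .lt 8 0)]
    · rfl
    · simp [Test.Holds, Code.run, Instr.apply, hv, h.size]
  rw [e]
  have fr := Code.frame_run (Instr.store 5 7 8) s
  refine built_of_loop (by decide) (by decide) h hl fun x s' hx hf hl' => ?_
  have h' := (h.of_frame fr (by decide)).of_frame hf (by decide)
  have hv' : s'.reg 8 = v := by rw [hf.reg 8 (by decide), fr.reg 8 (by decide), hv]
  have h10 : s'.reg 10 = s.reg 10 := by rw [hf.reg 10 (by decide), fr.reg 10 (by decide)]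
  rcases eq_or_ne x v with rfl | h3
  · by_cases h1 : 2 ≤ lab x <;>
    simp [Code.run, pivotLabels, Instr.apply, Test.Holds, getLabel, getAdj, h'.two, h'.one, hx, hv',
      hl' x, h'.row x, h'.adj x x, h1, h10, dropVertex, takeVertex]
  · have hxv : (x : ℕ) ≠ v := fun e => h3 (Fin.ext e)
    by_cases h1 : 2 ≤ lab x <;> by_cases h2 : G.Adj v x <;>
    simp [Code.run, pivotLabels, Instr.apply, Test.Holds, getLabel, getAdj, h'.two, h'.one, hx, hv',
      hl' x, h'.row v, h'.adj v x, h1, h2, h3, h10, hxv, dropVertex, takeVertex]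

lemma run_build_split {s : State} (h : Ambient G w d s) (hl : HasLabels s lab)
    (hv : s.reg 8 = n) {C : Finset (Fin n)} (hC : HasSet (s.arr 4) 0 C) :
    Built s (build.run s) (restrictTo lab C) (restrictAway lab C) := by
  have e : build.run s = Code.run (Instr.store 5 7 8 ;; .rep 11 (splitLabels ;; storeLabels) ;;
      Instr.add 7 7 0 ;; Instr.add 7 7 0) s := by
    rw [build, Code.run_seq, Code.run_seq, Code.run_branch_of_not (b := .lt 8 0)]
    · rfl
    · simp [Test.Holds, Code.run, Instr.apply, hv, h.size]
  rw [e]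
  have fr := Code.frame_run (Instr.store 5 7 8) s
  refine built_of_loop (by decide) (by decide) h hl fun x s' hx hf hl' => ?_
  have h' := (h.of_frame fr (by decide)).of_frame hf (by decide)
  have h4 : s'.arr 4 x = if x ∈ C then 1 else 0 := by
    rw [hf.arr 4 (by decide), fr.arr 4 (by decide)]
    simpa using hC x
  by_cases h1 : 2 ≤ lab x <;> by_cases h2 : x ∈ C <;>
  simp [Code.run, splitLabels, Instr.apply, Test.Holds, getLabel, h'.two, h'.one, h'.zero, hx,
    hl' x, h4, h1, h2, restrictTo, restrictAway]

end PathFreeMWIS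

/-! ### Returning, combining results, and the recursive procedure. -/

namespace PathFreeMWIS

open RAM Finset

variable {n : ℕ} {G : SimpleGraph (Fin n)} {w : Fin n → ℝ≥0} {d : ℕ} {lab : Fin n → ℕ}

/-- Copy the result set from array `1` to the frame of the current call in array `3`. -/
def copyOut : Code := .rep 11 (Instr.load 14 1 11 ;; Instr.add 15 7 11 ;; Instr.store 3 15 14)

/-- Copy the result set back from array `3` to array `1`. -/
def copyIn : Code := .rep 11 (Instr.add 15 7 11 ;; Instr.load 14 3 15 ;; Instr.store 1 11 14)

/-- Add the set in the frame of array `3` to the result set in array `1`. -/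
def mergeIn : Code :=
  .rep 11 (Instr.add 15 7 11 ;; Instr.load 14 3 15 ;; Instr.load 16 1 11 ;;
    Instr.add 14 14 16 ;; Instr.store 1 11 14)

/-- Output the empty set. -/
def outputEmpty : Code := .rep 11 (Instr.store 1 11 5) ;; Instr.wzero 0

lemma run_copyOut {s : State} (h : Ambient G w d s) {S : Finset (Fin n)}
    (hS : HasSet (s.arr 1) 0 S) : HasSet ((copyOut.run s).arr 3) (s.reg 7) S ∧
      ∀ c < s.reg 7, (copyOut.run s).arr 3 c = s.arr 3 c := by
  have key : (∀ x : Fin n, (x : ℕ) < n →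
      (copyOut.run s).arr 3 (s.reg 7 + x) = if x ∈ S then 1 else 0) ∧
      ∀ c < s.reg 7, (copyOut.run s).arr 3 c = s.arr 3 c := by
    refine Code.run_rep_induction (by decide) h.size h.one
      (fun k s' => (∀ x : Fin n, (x : ℕ) < k →
        s'.arr 3 (s.reg 7 + x) = if x ∈ S then 1 else 0) ∧ ∀ c < s.reg 7, s'.arr 3 c = s.arr 3 c)
      (by simp) (fun v s' hv hf hI => ?_)
    have h7 : s'.reg 7 = s.reg 7 := hf.reg 7 (by decide)
    have h1 : s'.arr 1 v = if v ∈ S then 1 else 0 := by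
      rw [hf.arr 1 (by decide)]
      simpa using hS v
    have e : (Code.run (Instr.load 14 1 11 ;; Instr.add 15 7 11 ;; Instr.store 3 15 14) s').arr 3 =
        Function.update (s'.arr 3) (s.reg 7 + v) (if v ∈ S then 1 else 0) := by
      simp [Code.run, Instr.apply, hv, h7, h1]
    simp only [e]
    refine ⟨fun x hx => ?_, fun c hc => ?_⟩
    · by_cases hxv : x = v
      · simp [hxv]
      · have hxv' : (x : ℕ) ≠ v := fun e => hxv (Fin.ext e)
        rw [Function.update_of_ne (by omega), hI.1 x (by omega)]
    · rw [Function.update_of_ne (by omega), hI.2 c hc]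
  exact ⟨fun x => key.1 x x.2, key.2⟩

lemma run_copyIn {s : State} (h : Ambient G w d s) {S : Finset (Fin n)}
    (hS : HasSet (s.arr 3) (s.reg 7) S) : HasSet ((copyIn.run s).arr 1) 0 S := by
  have key : ∀ x : Fin n, (x : ℕ) < n → (copyIn.run s).arr 1 x = if x ∈ S then 1 else 0 := by
    refine Code.run_rep_induction (by decide) h.size h.one
      (fun k s' => ∀ x : Fin n, (x : ℕ) < k → s'.arr 1 x = if x ∈ S then 1 else 0)
      (by simp) (fun v s' hv hf hI => ?_)
    have h7 : s'.reg 7 = s.reg 7 := hf.reg 7 (by decide)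
    have h3 : s'.arr 3 (s.reg 7 + v) = if v ∈ S then 1 else 0 := by
      rw [hf.arr 3 (by decide), hS v]
    have e : (Code.run (Instr.add 15 7 11 ;; Instr.load 14 3 15 ;; Instr.store 1 11 14) s').arr 1 =
        Function.update (s'.arr 1) v (if v ∈ S then 1 else 0) := by
      simp [Code.run, Instr.apply, hv, h7, h3]
    simp only [e]
    intro x hx
    by_cases hxv : x = v
    · simp [hxv]
    · have hxv' : (x : ℕ) ≠ v := fun e => hxv (Fin.ext e)
      rw [Function.update_of_ne hxv', hI x (by omega)]
  intro x
  simpa using key x x.2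

/-- For disjoint sets the cellwise sum of the indicator functions is the indicator function of the
union. -/
lemma run_mergeIn {s : State} (h : Ambient G w d s) {S S' : Finset (Fin n)}
    (hS : HasSet (s.arr 3) (s.reg 7) S) (hS' : HasSet (s.arr 1) 0 S') (hdis : Disjoint S' S) :
    HasSet ((mergeIn.run s).arr 1) 0 (S' ∪ S) := by
  have key : ∀ x : Fin n, (mergeIn.run s).arr 1 x =
      if (x : ℕ) < n then (if x ∈ S' ∪ S then 1 else 0) else (if x ∈ S' then 1 else 0) := by
    refine Code.run_rep_induction (by decide) h.size h.one
      (fun k s' => ∀ x : Fin n, s'.arr 1 x =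
        if (x : ℕ) < k then (if x ∈ S' ∪ S then 1 else 0) else (if x ∈ S' then 1 else 0))
      (by simpa [HasSet] using hS') (fun v s' hv hf hI => ?_)
    have h7 : s'.reg 7 = s.reg 7 := hf.reg 7 (by decide)
    have h3 : s'.arr 3 (s.reg 7 + v) = if v ∈ S then 1 else 0 := by
      rw [hf.arr 3 (by decide), hS v]
    have h1 : s'.arr 1 v = if v ∈ S' then 1 else 0 := by simpa using hI v
    have e : (Code.run (Instr.add 15 7 11 ;; Instr.load 14 3 15 ;; Instr.load 16 1 11 ;;
        Instr.add 14 14 16 ;; Instr.store 1 11 14) s').arr 1 =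
        Function.update (s'.arr 1) v (if v ∈ S' ∪ S then 1 else 0) := by
      have : v ∈ S' → v ∉ S := fun a => disjoint_left.1 hdis a
      by_cases a : v ∈ S' <;> by_cases b : v ∈ S <;>
      simp_all [Code.run, Instr.apply]
    simp only [e]
    intro x
    by_cases hxv : x = v
    · simp [hxv]
    · have hxv' : (x : ℕ) ≠ v := fun e => hxv (Fin.ext e)
      have : (x : ℕ) < v + 1 ↔ (x : ℕ) < v := by omega
      rw [Function.update_of_ne hxv', hI x]
      simp only [this]
  intro x
  simpa using key x

lemma run_outputEmpty {s : State} (h : Ambient G w d s) :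
    HasSet ((outputEmpty.run s).arr 1) 0 (∅ : Finset (Fin n)) ∧ (outputEmpty.run s).wreg 0 = 0 := by
  have key : ∀ x : Fin n, (x : ℕ) < n →
      (Code.run (.rep 11 (Instr.store 1 11 5)) s).arr 1 x = 0 := by
    refine Code.run_rep_induction (by decide) h.size h.one
      (fun k s' => ∀ x : Fin n, (x : ℕ) < k → s'.arr 1 x = 0) (by simp) (fun v s' hv hf hI => ?_)
    have h' := h.of_frame hf (by decide)
    intro x hx
    by_cases e : (x : ℕ) = v
    · simp [Code.run, Instr.apply, hv, e, h'.zero]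
    · simp [Code.run, Instr.apply, hv, Function.update_of_ne e, hI x (by omega)]
  rw [outputEmpty, Code.run_seq]
  generalize Code.run (.rep 11 (Instr.store 1 11 5)) s = s₁ at *
  exact ⟨fun x => by simpa [Code.run, Instr.apply] using key x x.2, by simp [Code.run, Instr.apply]⟩

/-- Return from the second call: save its result, together with the branching vertex if there is
one, and proceed to the address of the first call. -/
def save : Code :=
  Instr.sub 7 7 0 ;; Instr.sub 7 7 0 ;; Instr.load 8 5 7 ;; copyOut ;; Instr.wmove 1 0 ;;
  .branch (.lt 8 0)
    (Instr.add 15 7 8 ;; Instr.store 3 15 2 ;; Instr.wload 2 0 8 ;; Instr.wadd 1 1 2) .skip ;;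
  Instr.wstore 1 7 1 ;; Instr.add 7 7 0

/-- Return from the first call and combine the results. -/
def combine : Code :=
  Instr.sub 7 7 0 ;; Instr.load 8 5 7 ;; Instr.wload 1 1 7 ;;
  .branch (.lt 8 0)
    (.branch (.wlt 0 1) (copyIn ;; Instr.wmove 0 1) .skip)
    (mergeIn ;; Instr.wadd 0 0 1)

/-- The result set and its weight are in place. -/
def HasResult (w : Fin n → ℝ≥0) (s : State) (S : Finset (Fin n)) : Prop :=
  HasSet (s.arr 1) 0 S ∧ s.wreg 0 = ∑ v ∈ S, w v

/-- The set `S` and its weight have been saved in the frame at `b`. -/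
structure Saved (w : Fin n → ℝ≥0) (b : ℕ) (s s' : State) (S : Finset (Fin n)) : Prop where
  base : s'.reg 7 = b + n
  set : HasSet (s'.arr 3) b S
  set_low : ∀ c < b, s'.arr 3 c = s.arr 3 c
  weight : s'.warr 1 b = ∑ v ∈ S, w v
  weight_low : ∀ c < b, s'.warr 1 c = s.warr 1 c

/-- Array `5` tells a branching (a vertex) from a split (the value `n`). After a branching the
second call has solved the part without `v` and its neighbours, so `v` is added to the result.
Register `7` then moves to the block of the first call. -/
lemma run_save {s : State} (h : Ambient G w d s) {b : ℕ} (hb : s.reg 7 = b + n + n)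
    {S : Finset (Fin n)} (hS : HasResult w s S) :
    (∀ v : Fin n, s.arr 5 b = v → v ∉ S → Saved w b s (save.run s) (insert v S)) ∧
    (s.arr 5 b = n → Saved w b s (save.run s) S) := by
  have hf₁ := Code.frame_run (Instr.sub 7 7 0 ;; Instr.sub 7 7 0 ;; Instr.load 8 5 7) s
  have h₁ := h.of_frame hf₁ (by decide)
  have e7 : (Code.run (Instr.sub 7 7 0 ;; Instr.sub 7 7 0 ;; Instr.load 8 5 7) s).reg 7 = b := by
    simp [Code.run, Instr.apply, h.size, hb]
  have e8 : (Code.run (Instr.sub 7 7 0 ;; Instr.sub 7 7 0 ;; Instr.load 8 5 7) s).reg 8 =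
      s.arr 5 b := by
    simp [Code.run, Instr.apply, h.size, hb]
  have e : save.run s = Code.run (copyOut ;; Instr.wmove 1 0 ;;
      .branch (.lt 8 0)
        (Instr.add 15 7 8 ;; Instr.store 3 15 2 ;; Instr.wload 2 0 8 ;; Instr.wadd 1 1 2) .skip ;;
      Instr.wstore 1 7 1 ;; Instr.add 7 7 0)
      (Code.run (Instr.sub 7 7 0 ;; Instr.sub 7 7 0 ;; Instr.load 8 5 7) s) := rfl
  rw [e]
  have e1 := hf₁.arr 1 (by decide)
  have e3 := hf₁.arr 3 (by decide)
  have ew := hf₁.wreg 0 (by decide)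
  have ewa := hf₁.warr 1 (by decide)
  generalize Code.run (Instr.sub 7 7 0 ;; Instr.sub 7 7 0 ;; Instr.load 8 5 7) s = s₁ at *
  rw [Code.run_seq]
  have hc := run_copyOut h₁ (S := S) (by rw [e1]; exact hS.1)
  have hf₂ := Code.frame_run copyOut s₁
  have h₂ := h₁.of_frame hf₂ (by decide)
  have e7' := (hf₂.reg 7 (by decide)).trans e7
  have e8' := (hf₂.reg 8 (by decide)).trans e8
  have ew' := ((hf₂.wreg 0 (by decide)).trans ew).trans hS.2
  have ewa' := (hf₂.warr 1 (by decide)).trans ewa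
  rw [e7, e3] at hc
  generalize copyOut.run s₁ = s₂ at *
  clear e e1 e3 ew ewa hf₁ hf₂
  constructor
  · intro v hv hvS
    have hlt : (v : ℕ) < n := v.2
    constructor
    · simp [Code.run, Instr.apply, Test.Holds, e7', e8', h₂.size, hv]
    · intro x
      have hx := hc.1 x
      by_cases hxv : x = v
      · simp [Code.run, Instr.apply, Test.Holds, e7', e8', h₂.size, h₂.one, hv, hxv]
      · have hxv' : b + (x : ℕ) ≠ b + v := fun e => hxv (Fin.ext (by omega))
        simp [Code.run, Instr.apply, Test.Holds, e7', e8', h₂.size, h₂.one, hv, hxv,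
          Function.update_of_ne hxv', hx]
    · intro c hcb
      have hcb' : c ≠ b + v := by omega
      simp [Code.run, Instr.apply, Test.Holds, e7', e8', h₂.size, h₂.one, hv,
          Function.update_of_ne hcb', hc.2 c hcb]
    · simp [Code.run, Instr.apply, Test.Holds, e7', e8', h₂.size, hv, h₂.weight v, ew',
        sum_insert hvS, add_comm]
    · intro c hcb
      simp [Code.run, Instr.apply, Test.Holds, e7', e8', h₂.size, hv,
          Function.update_of_ne hcb.ne, ewa']
  · intro hv
    constructor
    · simp [Code.run, Instr.apply, Test.Holds, e7', e8', h₂.size, hv]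
    · intro x
      simpa [Code.run, Instr.apply, Test.Holds, e7', e8', h₂.size, hv] using hc.1 x
    · intro c hcb
      simpa [Code.run, Instr.apply, Test.Holds, e7', e8', h₂.size, hv] using hc.2 c hcb
    · simp [Code.run, Instr.apply, Test.Holds, e7', e8', h₂.size, hv, ew']
    · intro c hcb
      simp [Code.run, Instr.apply, Test.Holds, e7', e8', h₂.size, hv,
          Function.update_of_ne hcb.ne, ewa']

open Classical in
lemma run_combine {s : State} (h : Ambient G w d s) {b : ℕ} (hb : s.reg 7 = b + n)
    {S S' : Finset (Fin n)} (hS' : HasResult w s S') (hS : HasSet (s.arr 3) b S)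
    (hw : s.warr 1 b = ∑ v ∈ S, w v) :
    (combine.run s).reg 7 = b ∧
    (∀ v : Fin n, s.arr 5 b = v → HasResult w (combine.run s)
      (if ∑ v ∈ S', w v < ∑ v ∈ S, w v then S else S')) ∧
    (s.arr 5 b = n → Disjoint S' S → HasResult w (combine.run s) (S' ∪ S)) := by
  have hf₁ := Code.frame_run (Instr.sub 7 7 0 ;; Instr.load 8 5 7 ;; Instr.wload 1 1 7) s
  have h₁ := h.of_frame hf₁ (by decide)
  have e7 : (Code.run (Instr.sub 7 7 0 ;; Instr.load 8 5 7 ;; Instr.wload 1 1 7) s).reg 7 = b := by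
    simp [Code.run, Instr.apply, h.size, hb]
  have e8 : (Code.run (Instr.sub 7 7 0 ;; Instr.load 8 5 7 ;; Instr.wload 1 1 7) s).reg 8 =
      s.arr 5 b := by
    simp [Code.run, Instr.apply, h.size, hb]
  have ew1 : (Code.run (Instr.sub 7 7 0 ;; Instr.load 8 5 7 ;; Instr.wload 1 1 7) s).wreg 1 =
      ∑ v ∈ S, w v := by
    simp [Code.run, Instr.apply, h.size, hb, hw]
  have e : combine.run s = Code.run (.branch (.lt 8 0)
      (.branch (.wlt 0 1) (copyIn ;; Instr.wmove 0 1) .skip) (mergeIn ;; Instr.wadd 0 0 1))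
      (Code.run (Instr.sub 7 7 0 ;; Instr.load 8 5 7 ;; Instr.wload 1 1 7) s) := rfl
  rw [e]
  have e1 := hf₁.arr 1 (by decide)
  have e3 := hf₁.arr 3 (by decide)
  have ew0 := (hf₁.wreg 0 (by decide)).trans hS'.2
  generalize Code.run (Instr.sub 7 7 0 ;; Instr.load 8 5 7 ;; Instr.wload 1 1 7) s = s₁ at *
  have hS₁ : HasSet (s₁.arr 3) (s₁.reg 7) S := by rw [e3, e7]; exact hS
  have hS₁' : HasSet (s₁.arr 1) 0 S' := by rw [e1]; exact hS'.1
  refine ⟨?_, fun v hv => ?_, fun hv hdis => ?_⟩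
  · rw [(Code.frame_run _ s₁).reg 7 (by decide), e7]
  · rw [Code.run_branch_of (b := .lt 8 0) (by simp [Test.Holds, e8, hv, h₁.size])]
    by_cases hlt : ∑ v ∈ S', w v < ∑ v ∈ S, w v
    · rw [Code.run_branch_of (b := .wlt 0 1) (by simpa [Test.Holds, ew0, ew1] using hlt), if_pos hlt,
        Code.run_seq]
      have hc := run_copyIn h₁ hS₁
      have ew := (Code.frame_run copyIn s₁).wreg 1 (by decide)
      generalize copyIn.run s₁ = s₂ at *
      exact ⟨by simpa [Code.run, Instr.apply] using hc, by simp [Code.run, Instr.apply, ew, ew1]⟩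
    · rw [Code.run_branch_of_not (b := .wlt 0 1) (by simpa [Test.Holds, ew0, ew1] using hlt),
        if_neg hlt]
      exact ⟨hS₁', ew0⟩
  · rw [Code.run_branch_of_not (b := .lt 8 0) (by simp [Test.Holds, e8, hv, h₁.size]), Code.run_seq]
    have hc := run_mergeIn h₁ hS₁ hS₁' hdis
    have ewa := (Code.frame_run mergeIn s₁).wreg 1 (by decide)
    have ewb := (Code.frame_run mergeIn s₁).wreg 0 (by decide)
    generalize mergeIn.run s₁ = s₂ at *
    exact ⟨by simpa [Code.run, Instr.apply] using hc,
      by simp [Code.run, Instr.apply, ewa, ewb, ew0, ew1, sum_union hdis]⟩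

/-- `S` is an independent subset of `A` of maximum weight. -/
def IsOptimal (G : SimpleGraph (Fin n)) (w : Fin n → ℝ≥0) (A S : Finset (Fin n)) : Prop :=
  S ⊆ A ∧ G.IsIndepSet (S : Set (Fin n)) ∧
    ∀ S' ⊆ A, G.IsIndepSet (S' : Set (Fin n)) → ∑ v ∈ S', w v ≤ ∑ v ∈ S, w v

lemma isIndepSet_mono {S S' : Finset (Fin n)} (h : G.IsIndepSet (S : Set (Fin n)))
    (hS : S' ⊆ S) : G.IsIndepSet (S' : Set (Fin n)) :=
  Set.Pairwise.mono (by exact_mod_cast hS) h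

open Classical in
-- An independent set either avoids `v`, or consists of `v` and an independent set of non-neighbours
-- of `v`.
lemma isOptimal_pivot {A S₁ S₂ : Finset (Fin n)} {v : Fin n} (hv : v ∈ A)
    (h₁ : IsOptimal G w (A.erase v) S₁) (h₂ : IsOptimal G w {x ∈ A | x ≠ v ∧ ¬ G.Adj v x} S₂) :
    IsOptimal G w A (if ∑ x ∈ S₁, w x < ∑ x ∈ insert v S₂, w x then insert v S₂ else S₁) := by
  have hvS : v ∉ S₂ := fun h => (mem_filter.1 (h₂.1 h)).2.1 rfl
  have hins : insert v S₂ ⊆ A ∧ G.IsIndepSet (insert v S₂ : Finset (Fin n)) := by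
    refine ⟨insert_subset hv (h₂.1.trans (filter_subset _ _)), ?_⟩
    rw [coe_insert]
    refine Set.Pairwise.insert h₂.2.1 fun x hx _ => ?_
    have := (mem_filter.1 (h₂.1 hx)).2.2
    exact ⟨this, fun h => this h.symm⟩
  have hmax : ∀ S' ⊆ A, G.IsIndepSet (S' : Set (Fin n)) →
      ∑ x ∈ S', w x ≤ ∑ x ∈ S₁, w x ∨ ∑ x ∈ S', w x ≤ ∑ x ∈ insert v S₂, w x := by
    intro S' hS' hI
    by_cases hvS' : v ∈ S'
    · right
      rw [sum_insert hvS, ← add_sum_erase _ _ hvS']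
      refine add_le_add_right ?_ _
      refine h₂.2.2 _ (fun x hx => ?_) (isIndepSet_mono hI (erase_subset _ _))
      rw [mem_erase] at hx
      exact mem_filter.2 ⟨hS' hx.2, hx.1, hI hvS' hx.2 hx.1.symm⟩
    · left
      exact h₁.2.2 _ (fun x hx => mem_erase.2 ⟨fun e => hvS' (e ▸ hx), hS' hx⟩) hI
  split_ifs with h
  · refine ⟨hins.1, hins.2, fun S' hS' hI => ?_⟩
    rcases hmax S' hS' hI with h' | h'
    · exact h'.trans h.le
    · exact h'
  · refine ⟨h₁.1.trans (erase_subset _ _), h₁.2.1, fun S' hS' hI => ?_⟩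
    rcases hmax S' hS' hI with h' | h'
    · exact h'
    · exact h'.trans (not_lt.1 h)

/-- No edge joins `C` to the rest of `A`, so the two sides can be optimised separately and the
weights add up. -/
lemma isOptimal_split {A C S₁ S₂ : Finset (Fin n)} (hC : IsUnionOfComponents G A C)
    (h₁ : IsOptimal G w C S₁) (h₂ : IsOptimal G w (A \ C) S₂) :
    Disjoint S₁ S₂ ∧ IsOptimal G w A (S₁ ∪ S₂) := by
  have hdis : Disjoint S₁ S₂ := disjoint_of_subset_left h₁.1
    (disjoint_of_subset_right h₂.1 disjoint_sdiff)
  refine ⟨hdis, union_subset (h₁.1.trans hC.1) (h₂.1.trans sdiff_subset), ?_, fun S' hS' hI => ?_⟩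
  · have hcross : ∀ x ∈ S₁, ∀ y ∈ S₂, ¬ G.Adj x y := by
      intro x hx y hy hxy
      have hy' := mem_sdiff.1 (h₂.1 hy)
      exact hy'.2 (hC.2.2 x (h₁.1 hx) y hy'.1 hxy)
    intro x hx y hy hne
    simp only [coe_union, Set.mem_union, mem_coe] at hx hy
    rcases hx with hx | hx <;> rcases hy with hy | hy
    · exact h₁.2.1 hx hy hne
    · exact hcross x hx y hy
    · exact fun h => hcross y hy x hx h.symm
    · exact h₂.2.1 hx hy hne
  · rw [sum_union hdis, ← sum_inter_add_sum_sdiff S' C]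
    refine add_le_add ?_ ?_
    · exact h₁.2.2 _ inter_subset_right (isIndepSet_mono hI inter_subset_left)
    · exact h₂.2.2 _ (sdiff_subset_sdiff hS' Subset.rfl) (isIndepSet_mono hI sdiff_subset)

/-- The recursive procedure. -/
def solve : Cmd :=
  .seq select.compile
    (.branch (.lt 9 0)
      (.seq build.compile (.seq (.call 0) (.seq save.compile (.seq (.call 0) combine.compile))))
      outputEmpty.compile)

/-- A bound for the number of steps per call. -/
def stepCost (n : ℕ) : ℕ :=
  select.cost n + build.cost n + save.cost n + combine.cost n + outputEmpty.cost n + 2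

/-- The effect of a call of the recursive procedure. -/
structure Solved (G : SimpleGraph (Fin n)) (w : Fin n → ℝ≥0) (d : ℕ) (A : Finset (Fin n))
    (s out : State) : Prop where
  ambient : Ambient G w d out
  base : out.reg 7 = s.reg 7
  labels : ∀ c < s.reg 7, out.arr 2 c = s.arr 2 c
  sets : ∀ c < s.reg 7, out.arr 3 c = s.arr 3 c
  pivots : ∀ c < s.reg 7, out.arr 5 c = s.arr 5 c
  weights : ∀ c < s.reg 7, out.warr 1 c = s.warr 1 c
  result : ∃ S, IsOptimal G w A S ∧ HasResult w out S

/-- A call of the recursive procedure succeeds, in time proportional to the recursion tree. -/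
def SolvesCall (G : SimpleGraph (Fin n)) (w : Fin n → ℝ≥0) (d : ℕ) (lab : Fin n → ℕ) (s : State) :
    Prop :=
  ∃ c T out, RecTree G d lab c ∧ T ≤ stepCost n * c ∧ Exec [solve] (.call 0) s T out ∧
    Solved G w d (active lab) s out

/-- Two calls, prepared and combined. -/
lemma exec_calls {s : State} {lab₁ lab₂ : Fin n → ℕ} (hn : 0 < n) (h : Ambient G w d s)
    (hB : Built s (build.run s) lab₁ lab₂)
    (ih₁ : ∀ s₁, Ambient G w d s₁ → HasLabels s₁ lab₁ → SolvesCall G w d lab₁ s₁)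
    (ih₂ : ∀ s₂, Ambient G w d s₂ → HasLabels s₂ lab₂ → SolvesCall G w d lab₂ s₂)
    {A : Finset (Fin n)}
    (hpivot : s.reg 8 < n → ∃ v : Fin n, s.reg 8 = v ∧
      ∀ S, IsOptimal G w (active lab₂) S → v ∉ S ∧ ∀ S', IsOptimal G w (active lab₁) S' →
        open Classical in
        IsOptimal G w A (if ∑ x ∈ S', w x < ∑ x ∈ insert v S, w x then insert v S else S'))
    (hsplit : ¬ s.reg 8 < n → s.reg 8 = n ∧ ∀ S, IsOptimal G w (active lab₂) S →
      ∀ S', IsOptimal G w (active lab₁) S' → Disjoint S' S ∧ IsOptimal G w A (S' ∪ S)) :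
    ∃ c₁ c₂ T s', RecTree G d lab₁ c₁ ∧ RecTree G d lab₂ c₂ ∧
      T ≤ build.cost n + save.cost n + combine.cost n + stepCost n * c₁ + stepCost n * c₂ ∧
      Exec [solve] (.seq build.compile
        (.seq (.call 0) (.seq save.compile (.seq (.call 0) combine.compile)))) s T s' ∧
      Solved G w d A s s' := by
  classical
  obtain ⟨Tb, hTb, hEb⟩ := Code.exec_compile [solve] build (by decide) s h.one
  rw [h.size] at hTb
  have hfb := Code.frame_run build s
  have h₁ := h.of_frame hfb (by decide)
  have ebs := hfb.arr 3 (by decide)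
  have ebw := hfb.warr 1 (by decide)
  generalize build.run s = s₁ at *
  obtain ⟨c₂, T₂, s₂, ht₂, hT₂, hE₂, r₂⟩ := ih₂ s₁ h₁ (fun x => by rw [hB.base]; exact hB.snd x)
  obtain ⟨S₂, hS₂, hR₂⟩ := r₂.result
  obtain ⟨Ts, hTs, hEs⟩ := Code.exec_compile [solve] save (by decide) s₂ r₂.ambient.one
  rw [r₂.ambient.size] at hTs
  have hfs := Code.frame_run save s₂
  have h₃ := r₂.ambient.of_frame hfs (by decide)
  have hb₂ : s₂.reg 7 = s.reg 7 + n + n := r₂.base.trans hB.base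
  have hsv := run_save r₂.ambient hb₂ hR₂
  -- Since `n` is positive, the cells at the base address itself, which hold the pivot and the saved
  -- weight, are protected from the calls.
  have hlow : ∀ c, c ≤ s.reg 7 → c < s₁.reg 7 := fun c hc => by rw [hB.base]; omega
  have e5 : s₂.arr 5 (s.reg 7) = s.reg 8 := (r₂.pivots _ (hlow _ le_rfl)).trans hB.pivot
  have es2 := hfs.arr 2 (by decide)
  have es5 := hfs.arr 5 (by decide)
  generalize save.run s₂ = s₃ at *
  rw [e5] at hsv
  obtain ⟨S, hSv⟩ : ∃ S, Saved w (s.reg 7) s₂ s₃ S ∧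
      ∀ S', IsOptimal G w (active lab₁) S' → ∃ S'', IsOptimal G w A S'' ∧
        ((s.reg 8 < n ∧ S'' = if ∑ x ∈ S', w x < ∑ x ∈ S, w x then S else S') ∨
          (s.reg 8 = n ∧ Disjoint S' S ∧ S'' = S' ∪ S)) := by
    by_cases hc : s.reg 8 < n
    · obtain ⟨v, hv, hopt⟩ := hpivot hc
      obtain ⟨hvS, hopt⟩ := hopt S₂ hS₂
      exact ⟨insert v S₂, hsv.1 v hv hvS, fun S' hS' => ⟨_, hopt S' hS', Or.inl ⟨hc, rfl⟩⟩⟩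
    · obtain ⟨hv, hopt⟩ := hsplit hc
      exact ⟨S₂, hsv.2 hv, fun S' hS' => ⟨_, (hopt S₂ hS₂ S' hS').2,
        Or.inr ⟨hv, (hopt S₂ hS₂ S' hS').1, rfl⟩⟩⟩
  obtain ⟨hSv, hcomb⟩ := hSv
  obtain ⟨c₁, T₁, s₄, ht₁, hT₁, hE₁, r₁⟩ := ih₁ s₃ h₃ (fun x => by
    rw [hSv.base, es2, r₂.labels _ (by rw [hB.base]; have := x.2; omega)]
    exact hB.fst x)
  obtain ⟨S', hS', hR'⟩ := r₁.result
  obtain ⟨S'', hopt, hS''⟩ := hcomb S' hS'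
  obtain ⟨Tc, hTc, hEc⟩ := Code.exec_compile [solve] combine (by decide) s₄ r₁.ambient.one
  rw [r₁.ambient.size] at hTc
  have hfc := Code.frame_run combine s₄
  have hlow₃ : ∀ c, c ≤ s.reg 7 → c < s₃.reg 7 := fun c hc => by rw [hSv.base]; omega
  have hco := run_combine r₁.ambient (r₁.base.trans hSv.base) hR' (S := S)
    (fun x => by rw [r₁.sets _ (by rw [hSv.base]; have := x.2; omega)]; exact hSv.set x)
    (by rw [r₁.weights _ (hlow₃ _ le_rfl)]; exact hSv.weight)
  have e5' : s₄.arr 5 (s.reg 7) = s.reg 8 := by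
    rw [r₁.pivots _ (hlow₃ _ le_rfl), es5, e5]
  rw [e5'] at hco
  refine ⟨c₁, c₂, Tb + (T₂ + (Ts + (T₁ + Tc))), combine.run s₄, ht₁, ht₂, by omega,
    .seq hEb (.seq hE₂ (.seq hEs (.seq hE₁ hEc))), ?_⟩
  constructor
  · exact r₁.ambient.of_frame hfc (by decide)
  · exact hco.1
  · intro c hc
    rw [hfc.arr 2 (by decide), r₁.labels c (hlow₃ c hc.le), es2, r₂.labels c (hlow c hc.le),
      hB.low c hc]
  · intro c hc
    rw [hfc.arr 3 (by decide), r₁.sets c (hlow₃ c hc.le), hSv.set_low c hc,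
      r₂.sets c (hlow c hc.le), ebs]
  · intro c hc
    rw [hfc.arr 5 (by decide), r₁.pivots c (hlow₃ c hc.le), es5, r₂.pivots c (hlow c hc.le),
      hB.pivot_low c hc]
  · intro c hc
    rw [hfc.warr 1 (by decide), r₁.weights c (hlow₃ c hc.le), hSv.weight_low c hc,
      r₂.weights c (hlow c hc.le), ebw]
  · refine ⟨S'', hopt, ?_⟩
    rcases hS'' with ⟨hc, rfl⟩ | ⟨hc, hdis, rfl⟩
    · exact hco.2.1 ⟨s.reg 8, hc⟩ rfl
    · exact hco.2.2 hc hdis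

/-- A call of the recursive procedure finds an optimal set among the active vertices. -/
lemma exec_solve (m : ℕ) : ∀ (lab : Fin n → ℕ), #(active lab) ≤ m → ∀ s, Ambient G w d s →
    HasLabels s lab → SolvesCall G w d lab s := by
  classical
  induction m using Nat.strong_induction_on with
  | _ m ih =>
  intro lab hm s h hl
  obtain ⟨Ts, hTs, hEs⟩ := Code.exec_compile [solve] select (by decide) s h.one
  rw [h.size] at hTs
  have hfs := Code.frame_run select s
  have h₁ := h.of_frame hfs (by decide)
  obtain ⟨hsel, hlow⟩ := run_select h hl
  have e7 := hfs.reg 7 (by decide)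
  have e3 := hfs.arr 3 (by decide)
  have e5 := hfs.arr 5 (by decide)
  have ew := hfs.warr 1 (by decide)
  generalize select.run s = s₁ at *
  have lift : ∀ {A : Finset (Fin n)} {s' : State}, Solved G w d A s₁ s' → Solved G w d A s s' := by
    intro A s' r
    refine ⟨r.ambient, r.base.trans e7, fun c hc => ?_, fun c hc => ?_, fun c hc => ?_,
      fun c hc => ?_, r.result⟩
    · rw [r.labels c (by omega), hlow c hc]
    · rw [r.sets c (by omega), e3]
    · rw [r.pivots c (by omega), e5]
    · rw [r.weights c (by omega), ew]
  have recurse : ∀ {c₁ c₂ T : ℕ} {s' : State},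
      RecTree G d lab (c₁ + c₂ + 1) → s₁.reg 9 < n →
      T ≤ build.cost n + save.cost n + combine.cost n + stepCost n * c₁ + stepCost n * c₂ →
      Exec [solve] (.seq build.compile
        (.seq (.call 0) (.seq save.compile (.seq (.call 0) combine.compile)))) s₁ T s' →
      Solved G w d (active lab) s₁ s' → SolvesCall G w d lab s := by
    intro c₁ c₂ T s' hrec h9 hT hE r
    refine ⟨_, Ts + (T + 1) + 1, s', hrec, ?_, .call (p := solve) rfl (.seq hEs (.branch_true ?_ hE)),
      lift r⟩
    -- The `2` in `stepCost` pays for the procedure call and for the test of register `9`.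
    · have : stepCost n * (c₁ + c₂ + 1) = stepCost n * c₁ + stepCost n * c₂ + stepCost n := by ring
      rw [this]
      have : stepCost n = select.cost n + build.cost n + save.cost n + combine.cost n +
        outputEmpty.cost n + 2 := rfl
      omega
    · simpa [Test.Holds, h₁.size] using h9
  rcases hsel with ⟨e9, hempty⟩ | ⟨lab', v, h9, e8, h10, hv, hl', hact, hrec⟩ |
    ⟨C, h9, e8, hC, hl', hCc, hne, hrec⟩
  · obtain ⟨To, hTo, hEo⟩ := Code.exec_compile [solve] outputEmpty (by decide) s₁ h₁.one
    rw [h₁.size] at hTo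
    have hfo := Code.frame_run outputEmpty s₁
    have ho := run_outputEmpty h₁
    refine ⟨1, Ts + (To + 1) + 1, outputEmpty.run s₁, .empty hempty, ?_,
      .call (p := solve) rfl (.seq hEs (.branch_false ?_ hEo)), lift ?_⟩
    · have : stepCost n = select.cost n + build.cost n + save.cost n + combine.cost n +
        outputEmpty.cost n + 2 := rfl
      omega
    · simp [Test.Holds, h₁.size, e9]
    · refine ⟨h₁.of_frame hfo (by decide), hfo.reg 7 (by decide), fun c _ => ?_, fun c _ => ?_,
        fun c _ => ?_, fun c _ => ?_, ∅, ?_, ho.1, by simp [ho.2]⟩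
      · rw [hfo.arr 2 (by decide)]
      · rw [hfo.arr 3 (by decide)]
      · rw [hfo.arr 5 (by decide)]
      · rw [hfo.warr 1 (by decide)]
      · rw [hempty]
        refine ⟨Subset.rfl, by simp [SimpleGraph.IsIndepSet], fun S' hS' _ => ?_⟩
        rw [subset_empty.1 hS']
  · have a₁ : active (dropVertex lab' v (s₁.reg 10)) = (active lab).erase v := by
      rw [active_dropVertex h10, hact]
    have a₂ : active (takeVertex G lab' v (s₁.reg 10)) =
        {x ∈ active lab | x ≠ v ∧ ¬ G.Adj v x} := by
      rw [active_takeVertex h10, hact]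
    have hlt₁ : #(active (dropVertex lab' v (s₁.reg 10))) < #(active lab) := by
      rw [a₁]; exact card_erase_lt_of_mem hv
    have hlt₂ : #(active (takeVertex G lab' v (s₁.reg 10))) < #(active lab) := by
      rw [a₂]
      refine card_lt_card (filter_ssubset.2 ⟨v, hv, by simp⟩)
    have hcomb : ∀ S, IsOptimal G w (active (takeVertex G lab' v (s₁.reg 10))) S → v ∉ S ∧
        ∀ S', IsOptimal G w (active (dropVertex lab' v (s₁.reg 10))) S' → IsOptimal G w (active lab)
          (if ∑ x ∈ S', w x < ∑ x ∈ insert v S, w x then insert v S else S') := by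
      intro S hS
      rw [a₂] at hS
      refine ⟨fun hvS => (mem_filter.1 (hS.1 hvS)).2.1 rfl, fun S' hS' => ?_⟩
      rw [a₁] at hS'
      exact isOptimal_pivot hv hS' hS
    obtain ⟨c₁, c₂, T, s', t₁, t₂, hT, hE, r⟩ := exec_calls (A := active lab) (by omega) h₁
      (run_build_pivot h₁ hl' e8)
      (ih _ (hlt₁.trans_le hm) _ le_rfl) (ih _ (hlt₂.trans_le hm) _ le_rfl)
      (fun _ => ⟨v, e8, hcomb⟩) (fun hc => absurd (by rw [e8]; exact v.2) hc)
    exact recurse (hrec c₁ c₂ t₁ t₂) h9 hT hE r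
  · have a₁ : active (restrictTo lab C) = C := active_restrictTo hCc.1
    have a₂ : active (restrictAway lab C) = active lab \ C := active_restrictAway
    have hlt₁ : #(active (restrictTo lab C)) < #(active lab) := by
      rw [a₁]; exact card_lt_card (hCc.1.ssubset_of_ne hne)
    have hlt₂ : #(active (restrictAway lab C)) < #(active lab) := by
      rw [a₂, card_sdiff_of_subset hCc.1]
      have := hCc.2.1.card_pos
      have := card_le_card hCc.1
      omega
    have hcomb : ∀ S, IsOptimal G w (active (restrictAway lab C)) S →
        ∀ S', IsOptimal G w (active (restrictTo lab C)) S' →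
          Disjoint S' S ∧ IsOptimal G w (active lab) (S' ∪ S) := by
      intro S hS S' hS'
      rw [a₁] at hS'
      rw [a₂] at hS
      exact isOptimal_split hCc hS' hS
    obtain ⟨c₁, c₂, T, s', t₁, t₂, hT, hE, r⟩ := exec_calls (A := active lab) (by omega) h₁
      (run_build_split h₁ hl' e8 hC)
      (ih _ (hlt₁.trans_le hm) _ le_rfl) (ih _ (hlt₂.trans_le hm) _ le_rfl)
      (fun hc => absurd hc (by omega)) (fun _ => ⟨e8, hcomb⟩)
    exact recurse (hrec c₁ c₂ t₁ t₂) h9 hT hE r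

end PathFreeMWIS

/-! ### Initialisation and the whole program. -/

namespace PathFreeMWIS

open RAM Finset

variable {n : ℕ} {G : SimpleGraph (Fin n)} {w : Fin n → ℝ≥0}

/-- Constants, row addresses and initial labels. -/
def initTables : Code :=
  Instr.const 3 2 ;; Instr.const 4 3 ;; Instr.const 12 0 ;;
  .rep 11 (Instr.store 6 11 12 ;; Instr.add 12 12 0 ;; Instr.store 2 11 3)

/-- Write `n * L` into register `14`, for the number `L` of binary digits of `n`. -/
def initLog : Code :=
  Instr.const 13 1 ;; Instr.const 14 0 ;;
  .rep 11 (.branch (.le 13 0) (Instr.add 13 13 13 ;; Instr.add 14 14 0) .skip)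

/-- Write into register `6` the least `d` such that `t * d ^ 2` is at least the content of
register `14`. -/
def initThreshold : Code :=
  Instr.const 6 0 ;; Instr.const 15 0 ;; Instr.move 16 1 ;; Instr.add 17 1 1 ;;
  .rep 11 (.branch (.lt 15 14) (Instr.add 15 15 16 ;; Instr.add 16 16 17 ;; Instr.add 6 6 2) .skip)

/-- Register `12` runs through the multiples of `n`, which replaces multiplication. -/
lemma run_initTables {s : State} (h0 : s.reg 0 = n) (h2 : s.reg 2 = 1) :
    (initTables.run s).reg 3 = 2 ∧ (initTables.run s).reg 4 = 3 ∧
    ∀ x : Fin n, (initTables.run s).arr 6 x = n * x ∧ (initTables.run s).arr 2 x = 2 := by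
  have hf₁ := Code.frame_run (Instr.const 3 2 ;; Instr.const 4 3 ;; Instr.const 12 0) s
  have e : initTables.run s =
      Code.run (.rep 11 (Instr.store 6 11 12 ;; Instr.add 12 12 0 ;; Instr.store 2 11 3))
        (Code.run (Instr.const 3 2 ;; Instr.const 4 3 ;; Instr.const 12 0) s) := rfl
  rw [e]
  have e3 : (Code.run (Instr.const 3 2 ;; Instr.const 4 3 ;; Instr.const 12 0) s).reg 3 = 2 := by
    simp [Code.run, Instr.apply]
  have e4 : (Code.run (Instr.const 3 2 ;; Instr.const 4 3 ;; Instr.const 12 0) s).reg 4 = 3 := by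
    simp [Code.run, Instr.apply]
  have e12 : (Code.run (Instr.const 3 2 ;; Instr.const 4 3 ;; Instr.const 12 0) s).reg 12 = 0 := by
    simp [Code.run, Instr.apply]
  have e0 := (hf₁.reg 0 (by decide)).trans h0
  have e2 := (hf₁.reg 2 (by decide)).trans h2
  generalize Code.run (Instr.const 3 2 ;; Instr.const 4 3 ;; Instr.const 12 0) s = s₁ at *
  have hf₂ := Code.frame_run
    (.rep 11 (Instr.store 6 11 12 ;; Instr.add 12 12 0 ;; Instr.store 2 11 3)) s₁
  refine ⟨(hf₂.reg 3 (by decide)).trans e3, (hf₂.reg 4 (by decide)).trans e4, ?_⟩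
  have key : (Code.run (.rep 11 (Instr.store 6 11 12 ;; Instr.add 12 12 0 ;; Instr.store 2 11 3))
      s₁).reg 12 = n * n ∧ ∀ x : Fin n, (x : ℕ) < n →
      (Code.run (.rep 11 (Instr.store 6 11 12 ;; Instr.add 12 12 0 ;; Instr.store 2 11 3)) s₁).arr
        6 x = n * x ∧
      (Code.run (.rep 11 (Instr.store 6 11 12 ;; Instr.add 12 12 0 ;; Instr.store 2 11 3)) s₁).arr
        2 x = 2 := by
    refine Code.run_rep_induction (by decide) e0 e2
      (fun k s' => s'.reg 12 = n * k ∧ ∀ x : Fin n, (x : ℕ) < k →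
        s'.arr 6 x = n * x ∧ s'.arr 2 x = 2) (by simp [e12]) (fun v s' hv hf hI => ?_)
    have e0' := (hf.reg 0 (by decide)).trans e0
    have e3' := (hf.reg 3 (by decide)).trans e3
    refine ⟨by simp [Code.run, Instr.apply, hI.1, e0', mul_add], fun x hx => ?_⟩
    by_cases hxv : (x : ℕ) = v
    · simp [Code.run, Instr.apply, hI.1, hv, hxv, e3']
    · simpa [Code.run, Instr.apply, hv, Function.update_of_ne hxv] using hI.2 x (by omega)
  exact fun x => key.2 x x.2

/-- Register `13` runs through the powers of two until it exceeds `n`; the `n` rounds suffice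
because `n < 2 ^ n`. -/
lemma run_initLog {s : State} (h0 : s.reg 0 = n) (h2 : s.reg 2 = 1) :
    ∃ L, (initLog.run s).reg 14 = n * L ∧ n < 2 ^ L ∧ (L = 0 ∨ 2 ^ L ≤ 2 * n) := by
  have hf₁ := Code.frame_run (Instr.const 13 1 ;; Instr.const 14 0) s
  have key : ∃ L, (initLog.run s).reg 13 = 2 ^ L ∧ (initLog.run s).reg 14 = n * L ∧
      (n < 2 ^ L ∨ L = n) ∧ (L = 0 ∨ 2 ^ L ≤ 2 * n) := by
    refine Code.run_rep_induction
      (s := Code.run (Instr.const 13 1 ;; Instr.const 14 0) s) (by decide)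
      ((hf₁.reg 0 (by decide)).trans h0) ((hf₁.reg 2 (by decide)).trans h2)
      (fun k s' => ∃ L, s'.reg 13 = 2 ^ L ∧ s'.reg 14 = n * L ∧
        (n < 2 ^ L ∨ L = k) ∧ (L = 0 ∨ 2 ^ L ≤ 2 * n))
      ⟨0, by simp [Code.run, Instr.apply]⟩ (fun v s' hv hf hI => ?_)
    have e0 := (hf.reg 0 (by decide)).trans ((hf₁.reg 0 (by decide)).trans h0)
    obtain ⟨L, h13, h14, hor, hL⟩ := hI
    by_cases hc : 2 ^ L ≤ n
    · refine ⟨L + 1, ?_, ?_, Or.inr (by omega), Or.inr (by rw [pow_succ]; omega)⟩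
      · simp [Code.run, Instr.apply, Test.Holds, h13, e0, hc, pow_succ, mul_two]
      · simp [Code.run, Instr.apply, Test.Holds, h13, h14, e0, hc, mul_add]
    · refine ⟨L, ?_, ?_, Or.inl (by omega), hL⟩
      · simp [Code.run, Test.Holds, h13, e0, hc]
      · simp [Code.run, Test.Holds, h13, h14, e0, hc]
  obtain ⟨L, -, h14, hor, hL⟩ := key
  refine ⟨L, h14, ?_, hL⟩
  rcases hor with h | rfl
  · exact h
  · exact Nat.lt_two_pow_self

/-- Squares are accumulated from their differences: with `e` in register `6`, registers `15` and
`16` hold `t * e ^ 2` and the increment `t * (2 * e + 1)`, which grows by `t + t`. By `hmax` the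
search ends within `n` rounds. -/
lemma run_initThreshold {s : State} {t : ℕ} (h0 : s.reg 0 = n) (h2 : s.reg 2 = 1)
    (h1 : s.reg 1 = t) (hmax : s.reg 14 ≤ t * n ^ 2) :
    s.reg 14 ≤ t * (initThreshold.run s).reg 6 ^ 2 ∧
      ∀ e, e + 1 = (initThreshold.run s).reg 6 → t * e ^ 2 < s.reg 14 := by
  have hf₁ := Code.frame_run
    (Instr.const 6 0 ;; Instr.const 15 0 ;; Instr.move 16 1 ;; Instr.add 17 1 1) s
  have key : (initThreshold.run s).reg 15 = t * (initThreshold.run s).reg 6 ^ 2 ∧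
      (initThreshold.run s).reg 16 = t * (2 * (initThreshold.run s).reg 6 + 1) ∧
      (s.reg 14 ≤ t * (initThreshold.run s).reg 6 ^ 2 ∨ (initThreshold.run s).reg 6 = n) ∧
      ∀ e, e + 1 = (initThreshold.run s).reg 6 → t * e ^ 2 < s.reg 14 := by
    refine Code.run_rep_induction (s := Code.run
        (Instr.const 6 0 ;; Instr.const 15 0 ;; Instr.move 16 1 ;; Instr.add 17 1 1) s) (by decide)
      ((hf₁.reg 0 (by decide)).trans h0) ((hf₁.reg 2 (by decide)).trans h2)
      (fun k s' => s'.reg 15 = t * s'.reg 6 ^ 2 ∧ s'.reg 16 = t * (2 * s'.reg 6 + 1) ∧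
        (s.reg 14 ≤ t * s'.reg 6 ^ 2 ∨ s'.reg 6 = k) ∧
        ∀ e, e + 1 = s'.reg 6 → t * e ^ 2 < s.reg 14)
      (by simp [Code.run, Instr.apply, h1]) (fun v s' hv hf hI => ?_)
    have e14 : s'.reg 14 = s.reg 14 := (hf.reg 14 (by decide)).trans (hf₁.reg 14 (by decide))
    have e2 : s'.reg 2 = 1 := (hf.reg 2 (by decide)).trans ((hf₁.reg 2 (by decide)).trans h2)
    have e17 : s'.reg 17 = t + t := by
      rw [hf.reg 17 (by decide)]
      simp [Code.run, Instr.apply, h1]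
    obtain ⟨h15, h16, hor, hlt⟩ := hI
    by_cases hc : t * s'.reg 6 ^ 2 < s.reg 14
    · have a6 : (Code.run (.branch (.lt 15 14)
          (Instr.add 15 15 16 ;; Instr.add 16 16 17 ;; Instr.add 6 6 2) .skip) s').reg 6 =
          s'.reg 6 + 1 := by
        simp [Code.run, Instr.apply, Test.Holds, h15, e14, hc, e2]
      refine ⟨?_, ?_, Or.inr ?_, ?_⟩
      · simp [Code.run, Instr.apply, Test.Holds, h15, h16, e14, hc, e2]
        ring
      · simp [Code.run, Instr.apply, Test.Holds, h15, h16, e14, e17, hc, e2]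
        ring
      · simp [a6]
        omega
      · simp [a6]
        exact hc
    · have a : Code.run (.branch (.lt 15 14)
          (Instr.add 15 15 16 ;; Instr.add 16 16 17 ;; Instr.add 6 6 2) .skip) s' = s' := by
        simp [Code.run, Test.Holds, h15, e14, hc]
      simp only [a]
      simpa using ⟨h15, h16, Or.inl (by omega), hlt⟩
  refine ⟨?_, key.2.2.2⟩
  rcases key.2.2.1 with h | h
  · exact h
  · rw [h]; exact hmax

/-- The whole preparation. -/
def setup : Code := initTables ;; initLog ;; initThreshold

/-- The algorithm. -/
def program : Program where
  main := .seq (.instr (.const 2 1)) (.seq setup.compile (.call 0))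
  procs := [solve]

/-- `d` is the degree threshold for `n` vertices and forbidden path length `t`. -/
def IsThreshold (t n L d : ℕ) : Prop :=
  n < 2 ^ L ∧ (L = 0 ∨ 2 ^ L ≤ 2 * n) ∧ n * L ≤ t * d ^ 2 ∧ ∀ e, e + 1 = d → t * e ^ 2 < n * L

/-- The address determines row and column, as quotient and remainder modulo `n`. -/
lemma adj_inputState (t : ℕ) (G : SimpleGraph (Fin n)) (w : Fin n → ℝ≥0) (x y : Fin n) :
    open Classical in
    (inputState t G w).arr 0 (n * x + y) = if G.Adj x y then 1 else 0 := by
  classical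
  simp only [inputState, true_and]
  refine if_congr ⟨?_, fun h => ⟨x, y, h, rfl⟩⟩ rfl rfl
  rintro ⟨i, j, hij, e⟩
  have hn : 0 < n := by have := x.2; omega
  have hy : (y : ℕ) = j := by
    have := congrArg (· % n) e
    simpa [Nat.mul_add_mod, Nat.mod_eq_of_lt y.2, Nat.mod_eq_of_lt j.2] using this
  have hx : (x : ℕ) = i := by
    have : n * (x : ℕ) = n * i := by omega
    exact Nat.eq_of_mul_eq_mul_left hn this
  rwa [Fin.ext hx, Fin.ext hy]

/-- The program is correct, and its running time is governed by the recursion tree. -/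
lemma exec_program {t : ℕ} (ht : 0 < t) (G : SimpleGraph (Fin n)) (w : Fin n → ℝ≥0) :
    ∃ L d c T s S, IsThreshold t n L d ∧ RecTree G d (fun _ => 2) c ∧
      T ≤ setup.cost n + 1 + stepCost n * c ∧
      Exec program.procs program.main (inputState t G w) T s ∧
      IsMaxWeightIndepSet G w S ∧ IsOutput w S s := by
  set s₀ := (Instr.const 2 1).apply (inputState t G w) with hs₀
  have a0 : s₀.reg 0 = n := by simp [hs₀, Instr.apply, inputState]
  have a1 : s₀.reg 1 = t := by simp [hs₀, Instr.apply, inputState]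
  have a2 : s₀.reg 2 = 1 := by simp [hs₀, Instr.apply]
  obtain ⟨Ts, hTs, hEs⟩ := Code.exec_compile [solve] setup (by decide) s₀ a2
  rw [a0] at hTs
  have hf := Code.frame_run setup s₀
  have hfT := Code.frame_run initTables s₀
  have hT := run_initTables a0 a2
  have e : setup.run s₀ = initThreshold.run (initLog.run (initTables.run s₀)) := rfl
  rw [e] at hEs hf
  generalize initTables.run s₀ = s₁ at *
  have hfL := Code.frame_run initLog s₁
  obtain ⟨L, h14, hL1, hL2⟩ := run_initLog ((hfT.reg 0 (by decide)).trans a0)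
    ((hfT.reg 2 (by decide)).trans a2)
  generalize initLog.run s₁ = s₂ at *
  have hfD := Code.frame_run initThreshold s₂
  -- From `2 ^ L ≤ 2 * n < 2 ^ (n + 1)` follows `L ≤ n`, and `t` is positive.
  have hmax : s₂.reg 14 ≤ t * n ^ 2 := by
    have hLn : L ≤ n := by
      rcases hL2 with rfl | h
      · omega
      · have h1 : 2 ^ L < 2 ^ (n + 1) := by
          have := @Nat.lt_two_pow_self n
          rw [pow_succ]; omega
        have := (Nat.pow_lt_pow_iff_right (by norm_num)).1 h1
        omega
    rw [h14]
    calc n * L ≤ n * n := Nat.mul_le_mul_left n hLn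
      _ = 1 * n ^ 2 := by ring
      _ ≤ t * n ^ 2 := Nat.mul_le_mul_right _ ht
  have hD := run_initThreshold (t := t)
    ((hfL.reg 0 (by decide)).trans ((hfT.reg 0 (by decide)).trans a0))
    ((hfL.reg 2 (by decide)).trans ((hfT.reg 2 (by decide)).trans a2))
    ((hfL.reg 1 (by decide)).trans ((hfT.reg 1 (by decide)).trans a1)) hmax
  generalize initThreshold.run s₂ = s₃ at *
  rw [h14] at hD
  have e6 : s₃.arr 6 = s₁.arr 6 := (hfD.arr 6 (by decide)).trans (hfL.arr 6 (by decide))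
  have e2 : s₃.arr 2 = s₁.arr 2 := (hfD.arr 2 (by decide)).trans (hfL.arr 2 (by decide))
  have h7 : s₃.reg 7 = 0 := by
    rw [hf.reg 7 (by decide)]
    simp [hs₀, Instr.apply, inputState]
  have hA : Ambient G w (s₃.reg 6) s₃ := by
    constructor
    · exact (hf.reg 0 (by decide)).trans a0
    · exact (hf.reg 2 (by decide)).trans a2
    · rw [hfD.reg 3 (by decide), hfL.reg 3 (by decide), hT.1]
    · rw [hfD.reg 4 (by decide), hfL.reg 4 (by decide), hT.2.1]
    · rw [hf.reg 5 (by decide)]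
      simp [hs₀, Instr.apply, inputState]
    · rfl
    · intro x y
      rw [hf.arr 0 (by decide), ← adj_inputState t G w x y]
      rfl
    · intro x
      rw [e6]
      exact (hT.2.2 x).1
    · intro x
      rw [hf.warr 0 (by decide)]
      simp [hs₀, Instr.apply, inputState]
  obtain ⟨c, T, s', hc, hTc, hE, r⟩ := exec_solve (lab := fun _ => 2) _ le_rfl s₃ hA
    (fun x => by rw [h7, e2, zero_add]; exact (hT.2.2 x).2)
  obtain ⟨S, hS, hR⟩ := r.result
  refine ⟨L, s₃.reg 6, c, 1 + (Ts + T), s', S, ⟨hL1, hL2, hD.1, hD.2⟩, hc, by omega,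
    .seq (.instr _ _) (.seq hEs hE), ⟨hS.2.1, fun S' hI => hS.2.2 S' (fun x _ => by simp) hI⟩,
    fun v => ?_, hR.2⟩
  simpa using hR.1 v

end PathFreeMWIS

/-! ### Estimating the running time. -/

namespace PathFreeMWIS

open RAM Finset

variable {n : ℕ} {G : SimpleGraph (Fin n)} {w : Fin n → ℝ≥0}

/-- The path without vertices is contained in every graph. -/
lemma pos_of_isPathFree {t : ℕ} (h : IsPathFree t G) : 0 < t := by
  rcases Nat.eq_zero_or_pos t with rfl | ht
  · exact absurd ⟨⟨⟨fun i => i.elim0, fun i => i.elim0⟩, fun {i} => i.elim0⟩⟩ h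
  · exact ht

/-- The growth rate of the branching on vertices of degree at least `d`. -/
lemma pow_add_one_le {L d n : ℕ} (hL : n < 2 ^ L) (hd : 0 < d) (hdn : d < n) :
    (1 + (L : ℝ) / d) ^ d + 1 ≤ (1 + (L : ℝ) / d) ^ (d + 1) := by
  have hL0 : 0 < L := by
    rcases Nat.eq_zero_or_pos L with rfl | h
    · simp at hL; omega
    · exact h
  have hd' : (0 : ℝ) < d := by exact_mod_cast hd
  have hL' : (1 : ℝ) ≤ L := by exact_mod_cast hL0
  set r : ℝ := (L : ℝ) / d with hr
  have hr0 : 0 < r := by positivity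
  suffices h : 1 ≤ (1 + r) ^ d * r by
    rw [pow_succ]
    nlinarith
  by_cases hr1 : r ≤ 1
  -- Bernoulli's inequality for the exponent `r ≤ 1`. It yields `(1 + r) ^ d ≥ 2 ^ L ≥ d`, while `d
  -- * r = L ≥ 1`.
  · have h1 : (2 : ℝ) ^ r ≤ 1 + r := by
      have := rpow_one_add_le_one_add_mul_self (s := 1) (by norm_num) hr0.le hr1
      norm_num at this
      linarith
    have h2 : (2 : ℝ) ^ L ≤ (1 + r) ^ d := by
      calc (2 : ℝ) ^ L = ((2 : ℝ) ^ r) ^ d := by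
            rw [← Real.rpow_natCast ((2 : ℝ) ^ r), ← Real.rpow_mul (by norm_num), hr,
              div_mul_cancel₀ _ hd'.ne', Real.rpow_natCast]
        _ ≤ (1 + r) ^ d := by gcongr
    have h3 : (d : ℝ) ≤ (2 : ℝ) ^ L := by
      have : d ≤ 2 ^ L := by omega
      exact_mod_cast this
    calc (1 : ℝ) ≤ L := hL'
      _ = d * r := by rw [hr]; field_simp
      _ ≤ (1 + r) ^ d * r := by gcongr; exact h3.trans h2
  · push Not at hr1
    have : 1 ≤ (1 + r) ^ d := one_le_pow₀ (by linarith)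
    nlinarith

/-- The number of nodes of the recursion tree. -/
lemma recTree_le {t L d c : ℕ} (hfree : IsPathFree t G) (hd : IsThreshold t n L d)
    (hc : RecTree G d (fun _ => 2) c) :
    (c : ℝ) + 1 ≤ 2 * n.succ * 2 ^ (1 + min t (n + 1) * d) * (1 + (L : ℝ) / d) ^ n := by
  have hτ : ∀ X k r, IsTrail G X k r → k < min t (n + 1) := fun X k r h =>
    lt_min (h.lt_of_isPathFree hfree) (Nat.lt_succ_of_le h.le_card)
  have hq : 1 ≤ 1 + (L : ℝ) / d := by
    have : 0 ≤ (L : ℝ) / d := by positivity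
    linarith
  have h := hc.le hτ hq (fun hdn => ?_) (fun _ => Or.inr rfl)
  · have hcard : #(active fun _ : Fin n => 2) = n := by simp [active]
    rwa [hcard] at h
  -- For `d = 0` the growth rate would degenerate to `1`, but then `n * L = 0`, which is impossible
  -- for positive `n`.
  · refine pow_add_one_le hd.1 (Nat.pos_of_ne_zero fun h0 => ?_) hdn
    subst h0
    have h1 := hd.2.2.1
    have h2 := hd.1
    simp only [ne_eq, OfNat.ofNat_ne_zero, not_false_eq_true, zero_pow, mul_zero,
      nonpos_iff_eq_zero, Nat.mul_eq_zero] at h1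
    rcases h1 with h1 | h1
    · omega
    · subst h1; simp at h2; omega

section Estimates

variable {t L d : ℕ}

/-- The branching below the threshold, in terms of the target exponent. -/
lemma min_mul_threshold_le (hn : 1 ≤ n) (hd : IsThreshold t n L d) :
    ((min t (n + 1) * d : ℕ) : ℝ) ≤ 3 * √((t : ℝ) * n * L) := by
  have hL : 1 ≤ L := by
    rcases Nat.eq_zero_or_pos L with rfl | h
    · have := hd.1; simp at this; omega
    · exact h
  have hn' : (1 : ℝ) ≤ n := by exact_mod_cast hn
  have hL' : (1 : ℝ) ≤ L := by exact_mod_cast hL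
  have hE : 0 ≤ √((t : ℝ) * n * L) := Real.sqrt_nonneg _
  rcases Nat.eq_zero_or_pos d with rfl | hd0
  · rw [mul_zero, Nat.cast_zero]
    positivity
  obtain ⟨e, rfl⟩ : ∃ e, d = e + 1 := ⟨d - 1, by omega⟩
  -- The upper bound on `d` comes from minimality: its predecessor `e` misses the threshold.
  have h1 : ((t * e : ℕ) : ℝ) ≤ √((t : ℝ) * n * L) := by
    apply Real.le_sqrt_of_sq_le
    have h := (hd.2.2.2 e rfl).le
    have : (t * e) ^ 2 ≤ t * (n * L) := by
      calc (t * e) ^ 2 = t * (t * e ^ 2) := by ring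
        _ ≤ t * (n * L) := Nat.mul_le_mul_left t h
    have h' : ((t * e : ℕ) : ℝ) ^ 2 ≤ t * (n * L) := by exact_mod_cast this
    linarith
  -- The price of rounding `e` up to `d`. The square of the minimum is at most `t * (n + 1)`; for
  -- `t` alone the bound would fail when `t` is large.
  have h2 : ((min t (n + 1) : ℕ) : ℝ) ≤ 2 * √((t : ℝ) * n * L) := by
    have ht : ((min t (n + 1) : ℕ) : ℝ) ≤ t := by exact_mod_cast min_le_left _ _
    have hm : ((min t (n + 1) : ℕ) : ℝ) ≤ n + 1 := by exact_mod_cast min_le_right _ _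
    have h0 : (0 : ℝ) ≤ (min t (n + 1) : ℕ) := by positivity
    have ht0 : (0 : ℝ) ≤ t := by positivity
    have : ((min t (n + 1) : ℕ) : ℝ) / 2 ≤ √((t : ℝ) * n * L) := by
      apply Real.le_sqrt_of_sq_le
      calc (((min t (n + 1) : ℕ) : ℝ) / 2) ^ 2
          = ((min t (n + 1) : ℕ) : ℝ) * ((min t (n + 1) : ℕ) : ℝ) / 4 := by ring
        _ ≤ t * (n + 1) / 4 := by gcongr
        _ ≤ t * (n * 1) := by nlinarith
        _ ≤ t * (n * L) := by gcongr
        _ = t * n * L := by ring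
    linarith
  have h3 : min t (n + 1) * (e + 1) ≤ t * e + min t (n + 1) := by
    have := Nat.mul_le_mul_right e (min_le_left t (n + 1))
    rw [mul_add, mul_one]
    omega
  calc ((min t (n + 1) * (e + 1) : ℕ) : ℝ) ≤ ((t * e + min t (n + 1) : ℕ) : ℝ) := by
        exact_mod_cast h3
    _ = ((t * e : ℕ) : ℝ) + ((min t (n + 1) : ℕ) : ℝ) := by push_cast; ring
    _ ≤ 3 * √((t : ℝ) * n * L) := by linarith

/-- The branching above the threshold, in terms of the target exponent. -/
lemma one_add_div_pow_le (hn : 1 ≤ n) (hd : IsThreshold t n L d) :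
    (1 + (L : ℝ) / d) ^ n ≤ 2 ^ (2 * √((t : ℝ) * n * L)) := by
  have hE : 0 ≤ √((t : ℝ) * n * L) := Real.sqrt_nonneg _
  rcases Nat.eq_zero_or_pos d with rfl | hd0
  -- Division by zero gives `0`, so the left-hand side is `1`.
  · simp only [Nat.cast_zero, div_zero, add_zero, one_pow]
    exact Real.one_le_rpow (by norm_num) (by positivity)
  have hd' : (0 : ℝ) < d := by exact_mod_cast hd0
  -- This is `n * L ≤ t * d ^ 2` multiplied by `n * L`, under the root.
  have h1 : (n : ℝ) * L / d ≤ √((t : ℝ) * n * L) := by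
    rw [div_le_iff₀ hd']
    have h : (n : ℝ) * L ≤ t * d ^ 2 := by exact_mod_cast hd.2.2.1
    have hnL : (0 : ℝ) ≤ (n : ℝ) * L := by positivity
    rw [← Real.sqrt_sq hd'.le, ← Real.sqrt_mul (by positivity)]
    apply Real.le_sqrt_of_sq_le
    nlinarith
  have h2 : Real.exp 1 ≤ 4 := by linarith [Real.exp_one_lt_d9]
  calc (1 + (L : ℝ) / d) ^ n ≤ (Real.exp ((L : ℝ) / d)) ^ n := by
        gcongr
        linarith [Real.add_one_le_exp ((L : ℝ) / d)]
    _ = Real.exp (n * L / d) := by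
        rw [← Real.exp_nat_mul]
        congr 1
        ring
    _ ≤ Real.exp (1 * √((t : ℝ) * n * L)) := by
        rw [one_mul]
        exact Real.exp_le_exp.2 h1
    _ = (Real.exp 1) ^ √((t : ℝ) * n * L) := by rw [Real.exp_mul]
    _ ≤ 4 ^ √((t : ℝ) * n * L) := by gcongr
    _ = 2 ^ (2 * √((t : ℝ) * n * L)) := by
        rw [Real.rpow_mul (by norm_num)]
        norm_num

/-- From `2 ^ L ≤ 2 * n` and `n ≥ 2` follows `L * log 2 ≤ 2 * log n`, and `log 2` exceeds `1 / 2`.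
-/
lemma sqrt_le_two_mul_sqrt_log (hn : 2 ≤ n) (hd : IsThreshold t n L d) :
    √((t : ℝ) * n * L) ≤ 2 * √((t : ℝ) * n * Real.log n) := by
  have hn' : (2 : ℝ) ≤ n := by exact_mod_cast hn
  have hlog : Real.log 2 ≤ Real.log n := Real.log_le_log (by norm_num) hn'
  have hlog2 := Real.log_two_gt_d9
  have hL : (L : ℝ) ≤ 4 * Real.log n := by
    have h1 : (L : ℝ) * Real.log 2 ≤ Real.log 2 + Real.log n := by
      rcases hd.2.1 with rfl | h
      · simp; linarith
      · have h' : (2 : ℝ) ^ L ≤ 2 * n := by exact_mod_cast h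
        have := Real.log_le_log (by positivity) h'
        rwa [Real.log_pow, Real.log_mul (by norm_num) (by positivity)] at this
    nlinarith
  have : √((t : ℝ) * n * L) ≤ √(2 ^ 2 * ((t : ℝ) * n * Real.log n)) := by
    apply Real.sqrt_le_sqrt
    calc (t : ℝ) * n * L ≤ t * n * (4 * Real.log n) := by gcongr
      _ = 2 ^ 2 * ((t : ℝ) * n * Real.log n) := by ring
  rwa [Real.sqrt_mul (x := 2 ^ 2) (by norm_num), Real.sqrt_sq (by norm_num)] at this

/-- Lets the exponential absorb polynomial factors: `n + 1 ≤ n ^ 2`, and `log n` is at most the root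
because `log n ≤ n`. -/
lemma succ_le_two_rpow (hn : 2 ≤ n) (ht : 1 ≤ t) :
    (n : ℝ) + 1 ≤ 2 ^ (3 * √((t : ℝ) * n * Real.log n)) := by
  have hn' : (2 : ℝ) ≤ n := by exact_mod_cast hn
  have ht' : (1 : ℝ) ≤ t := by exact_mod_cast ht
  have hlog0 : 0 ≤ Real.log n := Real.log_nonneg (by linarith)
  have hlog2 := Real.log_two_gt_d9
  have hlogn : Real.log n ≤ n := (Real.log_le_sub_one_of_pos (by linarith)).trans (by linarith)
  have hZ : Real.log n ≤ √((t : ℝ) * n * Real.log n) := by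
    apply Real.le_sqrt_of_sq_le
    calc Real.log n ^ 2 = 1 * Real.log n * Real.log n := by ring
      _ ≤ t * n * Real.log n := by gcongr
  calc (n : ℝ) + 1 ≤ n ^ 2 := by nlinarith
    _ = Real.exp (2 * Real.log n) := by
        rw [show (2 : ℝ) * Real.log n = ((2 : ℕ) : ℝ) * Real.log n by norm_num, Real.exp_nat_mul,
          Real.exp_log (by linarith)]
    _ ≤ Real.exp (Real.log 2 * (3 * √((t : ℝ) * n * Real.log n))) := by
        apply Real.exp_le_exp.2
        nlinarith
    _ = 2 ^ (3 * √((t : ℝ) * n * Real.log n)) := by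
        rw [Real.rpow_def_of_pos (by norm_num)]

end Estimates

/-- The number of steps, for a polynomial bound `k * (n + 1) ^ k` on the work per node. -/
lemma steps_le {t L d c k : ℕ} (hfree : IsPathFree t G) (hd : IsThreshold t n L d)
    (hc : RecTree G d (fun _ => 2) c) :
    ((k * (n + 1) ^ k * (c + 1) : ℕ) : ℝ) ≤
      ((64 * 2 ^ k + 4) * k + 13 : ℝ) *
        2 ^ (((64 * 2 ^ k + 4) * k + 13 : ℝ) * √((t : ℝ) * n * Real.log n)) := by
  have hrec := recTree_le hfree hd hc
  have ht := pos_of_isPathFree hfree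
  have hk : (0 : ℝ) ≤ k := by positivity
  have hpow : (1 : ℝ) ≤ 2 ^ k := one_le_pow₀ (by norm_num)
  -- For `n ≤ 1` the exponent vanishes and the coefficient alone must suffice. Its `64` is the node
  -- bound `2 * 2 * 2 ^ 3 * 2` for `n = 1`.
  rcases Nat.lt_or_ge n 2 with hn | hn
  · have hz : (t : ℝ) * n * Real.log n = 0 := by
      interval_cases n <;> simp
    rw [hz, Real.sqrt_zero, mul_zero, Real.rpow_zero, mul_one]
    have hc' : (c : ℝ) + 1 ≤ 64 := by
      interval_cases n
      · have hd0 : d = 0 := by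
          by_contra h
          have := hd.2.2.2 (d - 1) (by omega)
          simp at this
        subst hd0
        norm_num at hrec
        linarith
      · have hL : L = 1 := by
          obtain ⟨h1, h2, -⟩ := hd
          rcases h2 with rfl | h2
          · simp at h1
          · have : L < 2 := (Nat.pow_lt_pow_iff_right (a := 2) (by norm_num)).1 (by omega)
            have : L ≠ 0 := by rintro rfl; simp at h1
            omega
        subst hL
        have hd1 : d = 1 := by
          obtain ⟨-, -, h3, h4⟩ := hd
          have h0 : d ≠ 0 := by rintro rfl; simp at h3
          by_contra h
          have h5 := h4 (d - 1) (by omega)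
          have : 1 ≤ (d - 1) ^ 2 := Nat.one_le_pow _ _ (by omega)
          nlinarith
        subst hd1
        have hm : (2 : ℝ) ^ (1 + min t (1 + 1) * 1) ≤ 2 ^ 3 :=
          pow_le_pow_right₀ (by norm_num) (by omega)
        norm_num at hrec hm
        linarith
    have hn1 : ((n : ℝ) + 1) ^ k ≤ 2 ^ k := by
      have : (n : ℝ) + 1 ≤ 2 := by
        have : n + 1 ≤ 2 := by omega
        exact_mod_cast this
      gcongr
    push_cast
    calc (k : ℝ) * (n + 1) ^ k * (c + 1) ≤ k * 2 ^ k * 64 := by gcongr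
      _ ≤ (64 * 2 ^ k + 4) * k + 13 := by nlinarith
  · set Z := √((t : ℝ) * n * Real.log n) with hZdef
    have hZ : 0 ≤ Z := Real.sqrt_nonneg _
    have hE := sqrt_le_two_mul_sqrt_log hn hd
    have h1 := min_mul_threshold_le (by omega) hd
    have h2 := one_add_div_pow_le (by omega) hd
    have h3 := succ_le_two_rpow hn ht
    have hA : (2 : ℝ) ^ (min t (n + 1) * d) ≤ 2 ^ (6 * Z) := by
      rw [← Real.rpow_natCast]
      exact Real.rpow_le_rpow_of_exponent_le (by norm_num) (by linarith)
    have hB : (1 + (L : ℝ) / d) ^ n ≤ 2 ^ (4 * Z) :=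
      h2.trans (Real.rpow_le_rpow_of_exponent_le (by norm_num) (by linarith))
    have hC : ((n : ℝ) + 1) ^ k ≤ 2 ^ (3 * Z * k) := by
      rw [Real.rpow_mul (by norm_num), Real.rpow_natCast]
      gcongr
    -- The exponents are `3` from the factor `n + 1`, `6` from the branching below the threshold and
    -- `4` from that above it. With `3 * k` for the work per node they give `3 * k + 13`.
    have hc' : (c : ℝ) + 1 ≤ 4 * (2 ^ (3 * Z) * 2 ^ (6 * Z) * 2 ^ (4 * Z)) := by
      refine hrec.trans ?_
      rw [pow_add, pow_one, Nat.cast_succ]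
      calc 2 * ((n : ℝ) + 1) * (2 * 2 ^ (min t (n + 1) * d)) * (1 + (L : ℝ) / d) ^ n
          ≤ 2 * (2 ^ (3 * Z)) * (2 * 2 ^ (6 * Z)) * 2 ^ (4 * Z) := by gcongr
        _ = 4 * (2 ^ (3 * Z) * 2 ^ (6 * Z) * 2 ^ (4 * Z)) := by ring
    have hsum : (2 : ℝ) ^ (3 * Z * k) * (2 ^ (3 * Z) * 2 ^ (6 * Z) * 2 ^ (4 * Z)) =
        2 ^ ((3 * k + 13) * Z) := by
      rw [← Real.rpow_add (by norm_num), ← Real.rpow_add (by norm_num),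
        ← Real.rpow_add (by norm_num)]
      congr 1
      ring
    push_cast
    calc (k : ℝ) * (n + 1) ^ k * (c + 1)
        ≤ k * 2 ^ (3 * Z * k) * (4 * (2 ^ (3 * Z) * 2 ^ (6 * Z) * 2 ^ (4 * Z))) := by gcongr
      _ = 4 * k * 2 ^ ((3 * k + 13) * Z) := by rw [← hsum]; ring
      _ ≤ ((64 * 2 ^ k + 4) * k + 13) * 2 ^ (((64 * 2 ^ k + 4) * k + 13) * Z) := by
        gcongr
        · nlinarith
        · norm_num
        · nlinarith

/-- One program solves all instances within the claimed time. -/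
lemma exists_solvesWithin : ∃ C : ℝ, 0 ≤ C ∧ ∀ (t n : ℕ) (G : SimpleGraph (Fin n))
    (w : Fin n → ℝ≥0), IsPathFree t G →
      SolvesWithin program t G w (C * 2 ^ (C * √((t : ℝ) * n * Real.log n))) := by
  -- The three occurrences of `.skip` stand for the first instruction of the program and the `2` in
  -- `stepCost`, so that one code has exactly the required cost.
  obtain ⟨k, hk⟩ := Code.exists_cost_le
    (setup ;; .skip ;; select ;; build ;; save ;; combine ;; outputEmpty ;; .skip ;; .skip)
  have hcost : ∀ n, setup.cost n + 1 + stepCost n ≤ k * (n + 1) ^ k := by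
    intro n
    refine le_trans (le_of_eq ?_) (hk n)
    simp only [Code.cost, stepCost]
    ring
  refine ⟨(64 * 2 ^ k + 4) * k + 13, by positivity, fun t n G w hfree => ?_⟩
  obtain ⟨L, d, c, T, s, S, hd, hc, hT, hE, hS, hO⟩ :=
    exec_program (pos_of_isPathFree hfree) G w
  refine ⟨T, s, S, hE, le_trans ?_ (steps_le (k := k) hfree hd hc), hS, hO⟩
  have : T ≤ k * (n + 1) ^ k * (c + 1) := by
    calc T ≤ setup.cost n + 1 + stepCost n * c := hT
      _ ≤ (setup.cost n + 1 + stepCost n) * (c + 1) := by nlinarith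
      _ ≤ k * (n + 1) ^ k * (c + 1) := Nat.mul_le_mul_right _ (hcost n)
  exact_mod_cast this

end PathFreeMWIS

theorem theorem4 :
    (∃ (P : RAM.Program) (C : ℝ), ∀ (t n : ℕ) (G : SimpleGraph (Fin n)) (w : Fin n → ℝ≥0),
      IsPathFree t G →
        SolvesWithin P t G w (C * 2 ^ (C * √((t : ℝ) * n * Real.log n)))) ∧
    (∀ t : ℕ, 5 ≤ t → ∃ (P : RAM.Program) (C : ℝ), ∀ (n : ℕ) (G : SimpleGraph (Fin n)),
      IsPathFree t G →
        SolvesWithin P t G (fun _ => 1) (C * 2 ^ (C * √((n : ℝ) * Real.log n)))) := by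
  obtain ⟨C, hC, h⟩ := PathFreeMWIS.exists_solvesWithin
  -- For fixed `t` the factor `√t` moves from the root into the constant; `√t ≥ 1` takes care of the
  -- coefficient in front.
  refine ⟨⟨_, C, h⟩, fun t ht => ⟨PathFreeMWIS.program, C * √t, fun n G hG => ?_⟩⟩
  obtain ⟨T, s, S, hE, hT, hS⟩ := h t n G (fun _ => 1) hG
  refine ⟨T, s, S, hE, hT.trans ?_, hS⟩
  have ht' : (1 : ℝ) ≤ √t := by
    rw [Real.one_le_sqrt]
    exact_mod_cast (by omega : 1 ≤ t)
  rw [mul_assoc (t : ℝ), Real.sqrt_mul (by positivity), ← mul_assoc C]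
  gcongr
  exact le_mul_of_one_le_right hC ht'
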